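/- **Theorem.** All manifolds and maps are $C^\infty$. Let $f\colon M^n\to\mathbb{R}^N$ be an isometric immersion of a connected Riemannian manifold that is locally substantial (no nonempty open subset of $M$ is mapped into a proper affine subspace of $\mathbb{R}^N$). Let $\alpha_f$ be its second fundamental form and $N_1(x)=\mathrm{span}\{\alpha_f(X,Y):X,Y\in T_xM\}$ its first normal spaces; assume that $f$ is 1-regular, i.e. $\dim N_1(x)=p$ for all $x$. Let $N_1^\perp$ be the orthogonal complement of $N_1$ in the normal bundle, and let $\mathcal S(x)\subset N_1(x)$ be the span of the orthogonal projections $(\nabla^\perp_X\mu)_{N_1}$ onto $N_1(x)$, where $X\in T_xM$ and $\mu$ is a local section of $N_1^\perp$ near $x$. Assume that $\dim\mathcal S(x)=s$ for all $x$, with $0<s<n$ and $s\le 6$. Notation. For an isometric immersion $F$, $\nu_F(x)$ is the dimension of the relative nullity $\{Y:\alpha_F(Y,X)=0\ \forall X\}$ at $x$, and $N_1^F$ denotes its first normal spaces; $N_1^F$ is nonparallel if the space defined for $F$ as $\mathcal S$ is for $f$ is nonzero at every point. $\mathcal N(\alpha_{\mathcal S})(x)=\{Y\in T_xM:(\alpha_f(Y,X))_{\mathcal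 S}=0\ \forall X\}$, where $(\cdot)_{\mathcal S}$ is the orthogonal projection onto $\mathcal S(x)$. An immersion is $D$-ruled if $D$ is a smooth integrable distribution whose leaves are mapped onto open subsets of affine subspaces of dimension $\dim D$; ranks of distributions are locally constant. An extension of the restriction of $f$ to an open set $U\subset M$ is an isometric immersion $F\colon N^m\to\mathbb{R}^N$ of a Riemannian manifold with $m>n$, together with an isometric embedding $i\colon U\to N^m$ such that $f|_U=F\circ i$. Then exactly one of the following holds: (i) $s=p$, and $\nu_f(x)\ge n-p$ for all $x\in M$; (ii) $1=s<p$, and $f$ has an extension $F\colon N^m\to\mathbb{R}^N$, $m=n+p-1$, such that $\nu_F=m-1$ everywhere and $N_1^F$ is nonparallel of rank one; (iii) $1<s<p$, and there are pairwise disjoint open subsets $U_k\subset M$, $s\le k\le p$, with dense union (each $U_k$ possibly empty or disconnected), such that (a) $f|_{U_p}$ is $D$-ruled with $D=\mathcal N(\alpha_{\mathcal S})$ and $\dim D\ge n-s$, and $\mathcal S$ is constant in $\mathbb{R}^N$ along the leaves of $D$; (b) for each $k$ with $s\le k<p$ and $U_k\ne\emptyset$, $f|_{U_k}$ has an extension $F\colon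 N^m\to\mathbb{R}^N$ with $m=n+p-k$ and $\mathrm{rank}\,N_1^F=k$; moreover, if $s=k$ then $\nu_F\ge m-k$ everywhere, and if $s<k$ then $F$ is $\Delta$-ruled for some distribution $\Delta$ with $\dim\Delta\ge m-s$. Moreover, in case (iii), the sets $U_k$ can be chosen so that in addition $U_5=U_6=\emptyset$ if $s=2$. -/

import Mathlib

open scoped Manifold ContDiff
open Bundle

universe u

noncomputable section

/-- The Euclidean space of dimension `q`. -/
abbrev Euc (q : ℕ) : Type := EuclideanSpace ℝ (Fin q)

/-- A smooth Riemannian metric on an `n`-dimensional manifold `M`. -/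
abbrev SmoothMetric (n : ℕ) (M : Type u) [TopologicalSpace M] [ChartedSpace (Euc n) M]
    [IsManifold (𝓡 n) ∞ M] : Type u :=
  ContMDiffRiemannianMetric (𝓡 n) ∞ (Euc n) (fun x : M => TangentSpace (𝓡 n) x)

section Immersions

variable {n q : ℕ} {M : Type u} [TopologicalSpace M] [ChartedSpace (Euc n) M]

/-- The differential `f_* : T_x M → ℝ^q` of a map into Euclidean space. -/
def differential (n : ℕ) {q : ℕ} {M : Type u} [TopologicalSpace M] [ChartedSpace (Euc n) M]
    (f : M → Euc q) (x : M) : TangentSpace (𝓡 n) x →L[ℝ] Euc q :=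
  mfderiv (𝓡 n) 𝓘(ℝ, Euc q) f x

/-- `f` is a smooth isometric immersion of `(M, g)` into `ℝ^q`
(injectivity of the differential follows from the positivity of `g`). -/
def IsIsometricImmersion [IsManifold (𝓡 n) ∞ M] (g : SmoothMetric n M) (f : M → Euc q) : Prop :=
  ContMDiff (𝓡 n) 𝓘(ℝ, Euc q) ∞ f ∧
    ∀ (x : M) (v w : TangentSpace (𝓡 n) x),
      inner ℝ (differential n f x v) (differential n f x w) = g.inner x v w

/-- No nonempty open subset is mapped into a proper affine subspace. -/
def IsLocallySubstantial (f : M → Euc q) : Prop :=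
  ∀ V : Set M, IsOpen V → V.Nonempty →
    ∀ A : AffineSubspace ℝ (Euc q), f '' V ⊆ (A : Set (Euc q)) → A = ⊤

/-- The normal space `N_x M`, as a subspace of the ambient space. -/
def normalSpace (n : ℕ) {q : ℕ} {M : Type u} [TopologicalSpace M] [ChartedSpace (Euc n) M]
    (f : M → Euc q) (x : M) : Submodule ℝ (Euc q) :=
  (LinearMap.range (differential n f x).toLinearMap)ᗮ

/-- The second derivative at `x` of `f`, read in the preferred chart at `x`. The tangent space
`T_x M` is identified with `ℝ^n` through this chart, as Mathlib does for `mfderiv`. -/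
def chartHessian (n : ℕ) {q : ℕ} {M : Type u} [TopologicalSpace M] [ChartedSpace (Euc n) M]
    (f : M → Euc q) (x : M) : Euc n →L[ℝ] Euc n →L[ℝ] Euc q :=
  fderiv ℝ (fderiv ℝ (f ∘ (extChartAt (𝓡 n) x).symm)) (extChartAt (𝓡 n) x x)

/-- The second fundamental form `α_f(x) : T_x M × T_x M → N_x M`: the normal part of the second
derivative of `f` (this normal part does not depend on the chart). -/
def secondFF (n : ℕ) {q : ℕ} {M : Type u} [TopologicalSpace M] [ChartedSpace (Euc n) M]
    (f : M → Euc q) (x : M) :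
    TangentSpace (𝓡 n) x →L[ℝ] TangentSpace (𝓡 n) x →L[ℝ] Euc q :=
  (ContinuousLinearMap.compL ℝ (Euc n) (Euc q) (Euc q) (normalSpace n f x).starProjection).comp
    (chartHessian n f x)

/-- The first normal space `N_1^f(x)`, spanned by the second fundamental form. -/
def firstNormal (n : ℕ) {q : ℕ} {M : Type u} [TopologicalSpace M] [ChartedSpace (Euc n) M]
    (f : M → Euc q) (x : M) : Submodule ℝ (Euc q) :=
  Submodule.span ℝ {ξ | ∃ X Y : TangentSpace (𝓡 n) x, ξ = secondFF n f x X Y}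

/-- The orthogonal complement `N_1^⊥(x)` of the first normal space in the normal space. -/
def firstNormalPerp (n : ℕ) {q : ℕ} {M : Type u} [TopologicalSpace M] [ChartedSpace (Euc n) M]
    (f : M → Euc q) (x : M) : Submodule ℝ (Euc q) :=
  normalSpace n f x ⊓ (firstNormal n f x)ᗮ

/-- The derivative `∇^⊥_X μ` in the normal connection of a section `μ` of the normal bundle. -/
def normalDeriv (n : ℕ) {q : ℕ} {M : Type u} [TopologicalSpace M] [ChartedSpace (Euc n) M]
    (f μ : M → Euc q) (x : M) (X : TangentSpace (𝓡 n) x) : Euc q :=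
  (normalSpace n f x).starProjection (differential n μ x X)

/-- The space `S(x) ⊆ N_1(x)` spanned by the projections `(∇^⊥_X μ)_{N_1}`, for `X` tangent at `x`
and `μ` a smooth local section of `N_1^⊥` around `x`. -/
def nonparallelSpace (n : ℕ) {q : ℕ} {M : Type u} [TopologicalSpace M] [ChartedSpace (Euc n) M]
    (f : M → Euc q) (x : M) : Submodule ℝ (Euc q) :=
  Submodule.span ℝ {ξ | ∃ (W : Set M) (μ : M → Euc q) (X : TangentSpace (𝓡 n) x),
    IsOpen W ∧ x ∈ W ∧ ContMDiffOn (𝓡 n) 𝓘(ℝ, Euc q) ∞ μ W ∧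
    (∀ y ∈ W, μ y ∈ firstNormalPerp n f y) ∧
    ξ = (firstNormal n f x).starProjection (normalDeriv n f μ x X)}

/-- The relative nullity subspace `{Y : α_f(Y, X) = 0 for all X}` at `x`. -/
def relNullity (n : ℕ) {q : ℕ} {M : Type u} [TopologicalSpace M] [ChartedSpace (Euc n) M]
    (f : M → Euc q) (x : M) : Submodule ℝ (TangentSpace (𝓡 n) x) :=
  LinearMap.ker (secondFF n f x).toLinearMap

/-- `N(α_S)(x) = {Y : (α_f(Y, X))_S = 0 for all X}`. -/
def nullityS (n : ℕ) {q : ℕ} {M : Type u} [TopologicalSpace M] [ChartedSpace (Euc n) M]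
    (f : M → Euc q) (x : M) : Submodule ℝ (TangentSpace (𝓡 n) x) where
  carrier := {Y | ∀ X : TangentSpace (𝓡 n) x,
    (nonparallelSpace n f x).starProjection (secondFF n f x Y X) = 0}
  zero_mem' := fun X => by simp
  add_mem' := fun {Y Z} hY hZ X => by
    have h1 := hY X
    have h2 := hZ X
    simp [h1, h2]
  smul_mem' := fun c Y hY X => by
    have h1 := hY X
    simp [h1]

/-- `D` is a smooth distribution on the open set `U`: around every point of `U` it has a smooth
frame. In particular its dimension is locally constant. -/
def IsSmoothDistributionOn [IsManifold (𝓡 n) 1 M]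
    (D : ∀ x : M, Submodule ℝ (TangentSpace (𝓡 n) x)) (U : Set M) : Prop :=
  ∀ x ∈ U, ∃ (W : Set M) (d : ℕ) (X : Fin d → ∀ y : M, TangentSpace (𝓡 n) y),
    IsOpen W ∧ x ∈ W ∧
    (∀ j, ContMDiffOn (𝓡 n) (𝓡 n).tangent ∞
      (fun y => (⟨y, X j y⟩ : TangentBundle (𝓡 n) M)) W) ∧
    ∀ y ∈ W, LinearIndependent ℝ (fun j => X j y) ∧
      Submodule.span ℝ (Set.range fun j => X j y) = D y

/-- `f` restricted to the open set `U` is `D`-ruled: `D` is a smooth distribution on `U` and through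
every point `x` of `U` passes an integral manifold of `D` (parametrized by an injective immersion
`c` of a connected open subset `O` of `ℝ^d`, where `d = dim D(x)`), which `f` maps
onto an open subset of a `d`-dimensional affine subspace `A`. -/
def IsRuledOn [IsManifold (𝓡 n) 1 M] (f : M → Euc q)
    (D : ∀ x : M, Submodule ℝ (TangentSpace (𝓡 n) x)) (U : Set M) : Prop :=
  IsSmoothDistributionOn D U ∧
  ∀ x ∈ U, ∃ (O : Set (Euc (Module.finrank ℝ (D x)))) (c : Euc (Module.finrank ℝ (D x)) → M)
      (A : AffineSubspace ℝ (Euc q)) (V : Set (Euc q)),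
    IsOpen O ∧ IsConnected O ∧ x ∈ c '' O ∧ c '' O ⊆ U ∧ Set.InjOn c O ∧
    ContMDiffOn (𝓡 (Module.finrank ℝ (D x))) (𝓡 n) ∞ c O ∧
    (∀ v ∈ O,
      Function.Injective (mfderiv (𝓡 (Module.finrank ℝ (D x))) (𝓡 n) c v) ∧
      LinearMap.range (mfderiv (𝓡 (Module.finrank ℝ (D x))) (𝓡 n) c v).toLinearMap = D (c v)) ∧
    Module.finrank ℝ A.direction = Module.finrank ℝ (D x) ∧
    IsOpen V ∧ f '' (c '' O) = V ∩ (A : Set (Euc q))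

/-- The field `S` of subspaces of the ambient space is constant along `D` on `U`: it is constant
along every smooth curve in `U` that is tangent to `D`, that is, along the leaves of `D`. -/
def IsConstantAlongOn (S : M → Submodule ℝ (Euc q))
    (D : ∀ x : M, Submodule ℝ (TangentSpace (𝓡 n) x)) (U : Set M) : Prop :=
  ∀ (c : ℝ → M) (a b : ℝ),
    ContMDiffOn 𝓘(ℝ, ℝ) (𝓡 n) ∞ c (Set.Ioo a b) →
    (∀ t ∈ Set.Ioo a b, c t ∈ U ∧ mfderiv 𝓘(ℝ, ℝ) (𝓡 n) c t (1 : ℝ) ∈ D (c t)) →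
    ∀ t ∈ Set.Ioo a b, ∀ t' ∈ Set.Ioo a b, S (c t) = S (c t')

end Immersions

/-- An extension `F : N^m → ℝ^q` of the restriction to the open set `U` of the map `f : M → ℝ^q`:
an isometric immersion `F` of an `m`-dimensional Riemannian manifold `N` (Hausdorff and second
countable), `m > n`, and an isometric embedding `i` of `U` into `N` with `f = F ∘ i` on `U`
(the values of `i` outside `U` play no role). -/
structure ExtensionOn {n q : ℕ} {M : Type u} [TopologicalSpace M] [ChartedSpace (Euc n) M]
    [IsManifold (𝓡 n) ∞ M] (g : SmoothMetric n M) (f : M → Euc q) (U : Set M) (m : ℕ) where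
  N : Type u
  [top : TopologicalSpace N]
  [charted : ChartedSpace (Euc m) N]
  [manifold : IsManifold (𝓡 m) ∞ N]
  [hausdorff : T2Space N]
  [countable : SecondCountableTopology N]
  dim_lt : n < m
  metric : SmoothMetric m N
  F : N → Euc q
  isometric : IsIsometricImmersion metric F
  i : M → N
  i_smooth : ContMDiffOn (𝓡 n) (𝓡 m) ∞ i U
  i_embedding : Topology.IsEmbedding (U.domRestrict i)
  i_isometric : ∀ x ∈ U, ∀ v w : TangentSpace (𝓡 n) x,
    metric.inner (i x) (mfderiv (𝓡 n) (𝓡 m) i x v) (mfderiv (𝓡 n) (𝓡 m) i x w) = g.inner x v w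
  extends_f : ∀ x ∈ U, f x = F (i x)

attribute [instance] ExtensionOn.top ExtensionOn.charted ExtensionOn.manifold
  ExtensionOn.hausdorff ExtensionOn.countable

end

/-! Every bundle is treated as a field B of subspaces of the fixed space ℝ^q, through its orthogonal
projection P_B and the derivative P'_B (`projDeriv`), so that no connection is needed. P'_B(X) is
self-adjoint and exchanges B with its orthogonal complement; a field is constant in a direction
exactly when P'_B vanishes there.

Let T be the tangent spaces of f, O = T + N_1 the osculating spaces, A the complement of S in O, and
N = N(α_S). Differentiating sections shows that S is spanned by the vectors P'_O(X)μ with μ normal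
to O, that T ⊆ A, and that P'_A maps A into S. Symmetry of second derivatives gives `codazzi`:
⟨P'_A(X)w, P'_O(Y)μ⟩ is symmetric in X and Y. Hence N consists of the Y with P'_A(Y) = 0,
equivalently of those for which P'_O(Y) vanishes on the complement of O; in particular S is constant
along N.

For fixed μ, ⟨P'_O(X)μ, α(Y,Z)⟩ is a cubic form in X, Y, Z whose first partial derivatives lie in
the space of quadratic forms given by S, of dimension s. The algebraic lemma `finrank_le_of_cubics`
says that, for s ≤ 6, such cubics depend on at most s variables. So dim N ≥ n − s
(`le_finrank_nullSub`), and this is the only use of s ≤ 6. If s = p then S = N_1 and N is the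
relative nullity, which is case (i).

Otherwise let Λ (`parallelSub`) be the set of w in A with P'_A(X)w = 0 for all X. Then Λ ∩ T = f_*N,
and Λ is constant along N (`projDeriv_parallelSub_eq_zero`). Where the dimensions of Λ and f_*N are
locally constant, which is an open dense condition, put k = p − (dim Λ − dim f_*N); this gives the
strata U_k. Since Λ + T ⊆ A, s ≤ k ≤ p.

If k = p, then Λ = f_*N is tangent to f and constant along itself, so f is ruled by N. If k < p, the
complement of f_*N in Λ is transversal to T, and F(x, v) = f(x) + v on this bundle is an immersion
near the zero section, of dimension n + p − k. Its tangent spaces lie in A and its osculating spaces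
in O; the latter coincide with O near the zero section, so N_1^F has rank k. Λ is tangent to F and
constant along the directions that it defines, so F is ruled by Λ, of dimension at least m − s. If k
= s, then A is the tangent bundle of F and the lift of N lies in its relative nullity.

If s = 1, all dimensions are forced and the stratum k = 1 is all of M. In general Λ is the kernel of
a map from A to Hom(T_xM/N, S), which bounds k by s²; for s = 2 this leaves no k above 4. -/

noncomputable section

section

open Topology Filter Module

/-! ### Cubic forms whose partial derivatives span few quadrics. -/

section Cubics

/-- If `A` has maximal rank among the `A + t • B`, then `B` maps the kernel of `A` into the range
of `A`. -/
theorem apply_mem_range_of_rank_max {V W : Type*} [AddCommGroup V] [Module ℝ V]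
    [AddCommGroup W] [Module ℝ W] [FiniteDimensional ℝ W] (A B : V →ₗ[ℝ] W)
    (h : ∀ t : ℝ, finrank ℝ (LinearMap.range (A + t • B)) ≤ finrank ℝ (LinearMap.range A))
    {x : V} (hx : A x = 0) : B x ∈ LinearMap.range A := by
  by_contra hB
  set r := finrank ℝ (LinearMap.range A) with hr
  let b := finBasis ℝ (LinearMap.range A)
  have hv : ∀ i, ∃ v, A v = (b i : W) := fun i => (b i).2
  choose v hv using hv
  let e := (finBasis ℝ W).equivFun
  -- At t = 0 these r + 1 vectors are B x and a basis of the range of A, so they are independent.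
  -- For t ≠ 0 they are the images of t⁻¹ x and the v i under A + t B. Independence being open, A +
  -- t B would have rank above r for some small t ≠ 0.
  let g : ℝ → Fin (r + 1) → (Fin (finrank ℝ W) → ℝ) := fun t =>
    Fin.cons (e (B x)) (fun i => e (A (v i)) + t • e (B (v i)))
  have h0 : LinearIndependent ℝ (g 0) := by
    have h1 : LinearIndependent ℝ (Fin.cons (B x) (fun i => (b i : W)) : Fin (r + 1) → W) := by
      rw [linearIndependent_finCons]
      refine ⟨b.linearIndependent.map' (LinearMap.range A).subtype (by simp), ?_⟩
      intro hmem
      apply hB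
      refine (Submodule.span_le.2 ?_) hmem
      rintro _ ⟨i, rfl⟩
      exact (b i).2
    have h2 := h1.map' e.toLinearMap e.ker
    have h3 : g 0 = e ∘ (Fin.cons (B x) (fun i => (b i : W)) : Fin (r + 1) → W) := by
      funext i
      refine Fin.cases ?_ (fun j => ?_) i
      · simp [g]
      · simp [g, hv]
    rw [h3]
    exact h2
  have hg : Continuous g := by
    refine continuous_pi fun i => ?_
    refine Fin.cases ?_ (fun j => ?_) i
    · simp only [g, Fin.cons_zero]; exact continuous_const
    · simp only [g, Fin.cons_succ]; fun_prop
  have hopen : IsOpen {t | LinearIndependent ℝ (g t)} :=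
    isOpen_setOfPred_linearIndependent.preimage hg
  obtain ⟨t, ht, ht0⟩ : ∃ t, LinearIndependent ℝ (g t) ∧ t ≠ 0 := by
    have h3 : ∀ᶠ t in nhdsWithin (0 : ℝ) {0}ᶜ, LinearIndependent ℝ (g t) :=
      nhdsWithin_le_nhds (hopen.mem_nhds h0)
    exact (h3.and self_mem_nhdsWithin).exists
  have hmem : ∀ i, e.symm (g t i) ∈ LinearMap.range (A + t • B) := by
    intro i
    refine Fin.cases ?_ (fun j => ?_) i
    · refine ⟨t⁻¹ • x, ?_⟩
      simp [g, hx, smul_smul, ht0]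
    · refine ⟨v j, ?_⟩
      simp [g]
  have h4 : LinearIndependent ℝ (fun i => (⟨e.symm (g t i), hmem i⟩ :
      LinearMap.range (A + t • B))) := by
    apply LinearIndependent.of_comp (LinearMap.range (A + t • B)).subtype
    exact ht.map' e.symm.toLinearMap e.symm.ker
  have h5 := h4.fintype_card_le_finrank
  have h6 := h t
  simp at h5
  omega

variable {V : Type*} [AddCommGroup V] [Module ℝ V] [FiniteDimensional ℝ V]

theorem finrank_eq_map_add_inf_ker {W W' : Type*} [AddCommGroup W] [Module ℝ W]
    [FiniteDimensional ℝ W] [AddCommGroup W'] [Module ℝ W'] (ρ : W →ₗ[ℝ] W')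
    (R : Submodule ℝ W) :
    finrank ℝ R = finrank ℝ (R.map ρ) + finrank ℝ (R ⊓ LinearMap.ker ρ : Submodule ℝ W) := by
  have h := (ρ.domRestrict R).finrank_range_add_finrank_ker
  rw [LinearMap.range_domRestrict, LinearMap.ker_domRestrict] at h
  rw [← h]
  congr 1
  rw [← Submodule.map_comap_subtype]
  exact (Submodule.equivMapOfInjective _ R.injective_subtype _).finrank_eq

variable {W : Type*} [AddCommGroup W] [Module ℝ W]

/-- If each member of a family of linear maps `φ : V → W` has rank at most one on `U`, then the
codimension in `U` of the common kernel is at most the rank of the pairing restricted to `U`. -/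
theorem finrank_le_of_rank_one_family {W' : Type*} [AddCommGroup W'] [Module ℝ W']
    [FiniteDimensional ℝ W'] {𝒮 : Set (V →ₗ[ℝ] W)} (β : W → V → V → ℝ)
    (hβ : ∀ w, w ≠ 0 → ∃ y z, β w y z ≠ 0)
    (hβs : ∀ (a : ℝ) w y z, β (a • w) y z = a * β w y z)
    (U K : Submodule ℝ V) (hKU : K ≤ U) (hK : ∀ x ∈ U, (∀ φ ∈ 𝒮, φ x = 0) → x ∈ K)
    (ev : W' →ₗ[ℝ] V →ₗ[ℝ] Dual ℝ U)
    (h𝓑 : ∀ φ ∈ 𝒮, ∀ e, ∃ b : W', ∀ (y : U) z, ev b z y = β (φ y) e z)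
    (hone : ∀ φ ∈ 𝒮, finrank ℝ (U.map φ) ≤ 1) :
    finrank ℝ U ≤ finrank ℝ K + finrank ℝ W' := by
  -- On U each φ has the form y ↦ l(y) q. The common zeros of these functionals l lie in K, so it is
  -- enough to bound the number of independent ones.
  let s : Set (Dual ℝ U) := {l | ∃ φ ∈ 𝒮, ∃ q : W, q ≠ 0 ∧ ∀ y : U, φ y = l y • q}
  obtain ⟨l, hl, -, hind⟩ := Submodule.exists_fun_fin_finrank_span_eq ℝ s
  have hcoann : (Submodule.span ℝ s).dualCoannihilator ≤ K.comap U.subtype := by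
    intro y hy
    rw [Submodule.mem_dualCoannihilator] at hy
    refine hK _ y.2 fun φ hφ => ?_
    obtain ⟨⟨q, hq⟩⟩ := (Submodule.finrank_le_one_iff_isPrincipal _).1 (hone φ hφ)
    by_cases hq0 : q = 0
    · have : φ y ∈ U.map φ := ⟨y, y.2, rfl⟩
      rw [hq, hq0] at this
      simpa using this
    have hex : ∀ y : U, ∃ c : ℝ, c • q = φ y := by
      intro y
      have : φ y ∈ U.map φ := ⟨y, y.2, rfl⟩
      rw [hq] at this
      exact Submodule.mem_span_singleton.1 this
    obtain ⟨ψ, hψ⟩ : ∃ ψ : Dual ℝ W, ψ q ≠ 0 := by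
      by_contra h
      push Not at h
      exact hq0 ((Module.forall_dual_apply_eq_zero_iff ℝ q).1 h)
    let lam : Dual ℝ U := ((ψ q)⁻¹ • ψ) ∘ₗ φ ∘ₗ U.subtype
    have hlam : ∀ y : U, φ y = lam y • q := by
      intro y
      obtain ⟨c, hc⟩ := hex y
      have : lam y = c := by
        change (ψ q)⁻¹ * ψ (φ y) = c
        rw [← hc, map_smul, smul_eq_mul]
        field_simp
      rw [this, hc]
    rw [Submodule.coe_subtype, hlam y,
      hy lam (Submodule.subset_span ⟨φ, hφ, q, hq0, hlam⟩), zero_smul]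
  have hfr : finrank ℝ U ≤ finrank ℝ (Submodule.span ℝ s) + finrank ℝ K := by
    have h1 := Subspace.finrank_add_finrank_dualCoannihilator_eq (Submodule.span ℝ s)
    have h2 := Submodule.finrank_mono hcoann
    have h3 : finrank ℝ (K.comap U.subtype) = finrank ℝ K :=
      (Submodule.comapSubtypeEquivOfLe hKU).finrank_eq
    omega
  choose φ hφ q hq0 hq using hl
  choose e z hz using fun i => hβ (q i) (hq0 i)
  choose B hBC using fun i => h𝓑 (φ i) (hφ i) (e i)
  have hBi : ∀ i w, ev (B i) w = β (q i) (e i) w • l i := by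
    intro i w
    ext y
    rw [hBC, hq, hβs, LinearMap.smul_apply, smul_eq_mul, mul_comm]
  -- B i pairs to w ↦ β(q i)(e i, w) l i. Evaluating a relation between the B i at z j and using
  -- independence of the l i leaves a j β(q j)(e j, z j) = 0.
  have hindB : LinearIndependent ℝ B := by
    refine Fintype.linearIndependent_iff.2 fun a ha j => ?_
    have h1 := Fintype.linearIndependent_iff.1 hind (fun i => a i * β (q i) (e i) (z j)) (by
      have h2 : ev (∑ i, a i • B i) (z j) = 0 := by rw [ha]; simp
      rw [map_sum, LinearMap.sum_apply] at h2
      rw [← h2]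
      refine Finset.sum_congr rfl fun i _ => ?_
      rw [map_smul, LinearMap.smul_apply, hBi, smul_smul]) j
    exact (mul_eq_zero.1 h1).resolve_right (hz j)
  have h1 := hindB.fintype_card_le_finrank
  rw [Fintype.card_fin] at h1
  omega

/-- If the symmetric trilinear forms `β (φ x) y z`, restricted to `y ∈ U`, span at most a line, then
`φ` has rank at most one on `U`. -/
theorem finrank_map_le_one_of_restrict {W' : Type*} [AddCommGroup W'] [Module ℝ W']
    [FiniteDimensional ℝ W'] (β : W →ₗ[ℝ] V →ₗ[ℝ] V →ₗ[ℝ] ℝ)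
    (hβ : Function.Injective β) (φ : V →ₗ[ℝ] W)
    (h12 : ∀ x y z, β (φ x) y z = β (φ y) x z) (h23 : ∀ x y z, β (φ x) y z = β (φ x) z y)
    (U : Submodule ℝ V) (ρ : W →ₗ[ℝ] W') (ev : W' →ₗ[ℝ] V →ₗ[ℝ] Dual ℝ U)
    (hρ : ∀ w (y : U) z, ev (ρ w) z y = β w y z)
    (h : finrank ℝ ((LinearMap.range φ).map ρ) ≤ 1) : finrank ℝ (U.map φ) ≤ 1 := by
  obtain ⟨⟨B, hB⟩⟩ := (Submodule.finrank_le_one_iff_isPrincipal _).1 h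
  have hex : ∀ Z, ∃ c : ℝ, c • B = ρ (φ Z) := by
    intro Z
    have : ρ (φ Z) ∈ (LinearMap.range φ).map ρ := ⟨_, ⟨Z, rfl⟩, rfl⟩
    rw [hB] at this
    exact Submodule.mem_span_singleton.1 this
  choose c hc using hex
  have hc' : ∀ (y : U) Z w, β (φ y) Z w = c Z * ev B w y := by
    intro y Z w
    rw [h12, ← hρ, ← hc, map_smul]
    rfl
  -- Symmetry in the last two arguments reads c(Z) B(w, y) = c(w) B(Z, y), so B is a product of c
  -- and a functional of y as soon as c is nonzero somewhere. The forms β(φ y) are then all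
  -- proportional.
  have hle : ∃ q, ∀ y : U, ∃ a : ℝ, a • q = φ y := by
    by_cases hex : ∃ (y₀ : U) (Z₀ : V), β (φ y₀) Z₀ Z₀ ≠ 0
    · obtain ⟨y₀, Z₀, h₀⟩ := hex
      refine ⟨φ y₀, fun y => ⟨(β (φ y₀) Z₀ Z₀)⁻¹ * β (φ y) Z₀ Z₀, hβ ?_⟩⟩
      ext Z w
      rw [map_smul]
      simp only [LinearMap.smul_apply, smul_eq_mul]
      have h1 := h23 y Z₀ w
      have h2 := h23 y₀ Z₀ w
      rw [hc'] at h₀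
      rw [hc', hc'] at h1 h2
      rw [hc', hc', hc', hc']
      have hcz : c Z₀ ≠ 0 := left_ne_zero_of_mul h₀
      have hbz : ev B Z₀ y₀ ≠ 0 := right_ne_zero_of_mul h₀
      have h1' : ev B w y = (c Z₀)⁻¹ * (c w * ev B Z₀ y) := by field_simp; linarith
      have h2' : ev B w y₀ = (c Z₀)⁻¹ * (c w * ev B Z₀ y₀) := by field_simp; linarith
      rw [h1', h2']
      field_simp
    · push Not at hex
      refine ⟨0, fun y => ⟨0, hβ ?_⟩⟩
      -- Polarization of the vanishing quadratic forms.
      have hs : ∀ Z w, β (φ y) Z w = 0 := by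
        intro Z w
        have h1 := hex y (Z + w)
        simp only [map_add, LinearMap.add_apply, hex y Z, hex y w, h23 y w Z] at h1
        linarith
      simp only [smul_zero, map_zero]
      exact (LinearMap.ext fun Z => LinearMap.ext fun w => hs Z w).symm
  obtain ⟨q, hq⟩ := hle
  have hq' : U.map φ ≤ Submodule.span ℝ {q} := by
    rintro _ ⟨y, hy, rfl⟩
    exact Submodule.mem_span_singleton.2 (hq ⟨y, hy⟩)
  have h1 := (Submodule.finrank_mono hq').trans (finrank_span_le_card ({q} : Set _))
  simpa using h1

/-- A linear space of cubic forms `β (φ x) y z`, whose first partial derivatives belong to a space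
of quadratic forms of dimension at most `6`, depends on at most as many variables as this
dimension. -/
theorem finrank_le_of_cubics [FiniteDimensional ℝ W] (β : W →ₗ[ℝ] V →ₗ[ℝ] V →ₗ[ℝ] ℝ)
    (hβ : Function.Injective β)
    (hβs : ∀ w y z, β w y z = β w z y) (Φ : Submodule ℝ (V →ₗ[ℝ] W))
    (h12 : ∀ φ ∈ Φ, ∀ x y z, β (φ x) y z = β (φ y) x z)
    (hd : finrank ℝ W ≤ 6) (K : Submodule ℝ V) (hK : ∀ x, x ∈ K ↔ ∀ φ ∈ Φ, φ x = 0) :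
    finrank ℝ V ≤ finrank ℝ K + finrank ℝ W := by
  obtain ⟨φ, hφ, hmax⟩ : ∃ φ ∈ Φ, ∀ φ' ∈ Φ,
      finrank ℝ (LinearMap.range φ') ≤ finrank ℝ (LinearMap.range φ) := by
    let s : Set ℕ := (fun φ : V →ₗ[ℝ] W => finrank ℝ (LinearMap.range φ)) '' Φ
    have hs : BddAbove s := by
      refine ⟨finrank ℝ W, ?_⟩
      rintro _ ⟨φ, -, rfl⟩
      exact Submodule.finrank_le _
    have hne : s.Nonempty := ⟨_, 0, Φ.zero_mem, rfl⟩
    obtain ⟨φ, hφ, hφs⟩ := Nat.sSup_mem hne hs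
    refine ⟨φ, hφ, fun φ' hφ' => ?_⟩
    have h1 : finrank ℝ (LinearMap.range φ') ≤ sSup s := le_csSup hs ⟨φ', hφ', rfl⟩
    have h2 : finrank ℝ (LinearMap.range φ) = sSup s := hφs
    omega
  obtain ⟨U, hU⟩ : ∃ U, U = LinearMap.ker φ := ⟨_, rfl⟩
  have hUr : finrank ℝ (LinearMap.range φ) + finrank ℝ U = finrank ℝ V := by
    rw [hU]; exact φ.finrank_range_add_finrank_ker
  have hUC : ∀ x ∈ U, φ x = 0 := fun x hx => by rw [hU] at hx; exact hx
  have hKU : K ≤ U := fun x hx => by rw [hU]; exact (hK x).1 hx φ hφ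
  have hmem : ∀ φ' ∈ Φ, ∀ x ∈ U, φ' x ∈ LinearMap.range φ := fun φ' hφ' x hx =>
    apply_mem_range_of_rank_max φ φ'
      (fun t => hmax _ (Φ.add_mem hφ (Φ.smul_mem t hφ'))) (hUC x hx)
  -- Only the values on V × U of a quadratic form are kept, U being the kernel of the φ of maximal
  -- rank r. The range of φ is lost, by symmetry of the cubic, so the t-dimensional space of
  -- restricted forms satisfies r + t ≤ dim W.
  let ρ₀ : W →ₗ[ℝ] V →ₗ[ℝ] Dual ℝ U :=
    (LinearMap.llcomp ℝ V _ _ (LinearMap.lcomp ℝ ℝ U.subtype)) ∘ₗ β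
  have hρ₀ : ∀ w (y : U) z, ρ₀ w z y = β w y z := fun w y z => hβs w z y
  have hrange : LinearMap.range φ ≤ LinearMap.ker ρ₀ := by
    rintro _ ⟨x, rfl⟩
    rw [LinearMap.mem_ker]
    ext z y
    rw [hρ₀, h12 φ hφ, hUC y y.2]; simp
  let ρ : W →ₗ[ℝ] W ⧸ LinearMap.ker ρ₀ := (LinearMap.ker ρ₀).mkQ
  have hkρ : LinearMap.ker ρ = LinearMap.ker ρ₀ := Submodule.ker_mkQ _
  obtain ⟨σ, hσ⟩ := ρ.exists_rightInverse_of_surjective (Submodule.range_mkQ _)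
  let ev : (W ⧸ LinearMap.ker ρ₀) →ₗ[ℝ] V →ₗ[ℝ] Dual ℝ U := ρ₀ ∘ₗ σ
  have hρ : ∀ w (y : U) z, ev (ρ w) z y = β w y z := by
    intro w y z
    have h1 : σ (ρ w) - w ∈ LinearMap.ker ρ₀ := by
      refine hkρ.le ?_
      rw [LinearMap.mem_ker, map_sub, sub_eq_zero]
      exact LinearMap.congr_fun hσ (ρ w)
    rw [LinearMap.mem_ker, map_sub, sub_eq_zero] at h1
    rw [← hρ₀, ← h1]
    rfl
  have ht : finrank ℝ (LinearMap.range φ) + finrank ℝ (W ⧸ LinearMap.ker ρ₀) ≤ finrank ℝ W := by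
    have h1 := (LinearMap.ker ρ₀).finrank_quotient_add_finrank
    have h2 := Submodule.finrank_mono hrange
    omega
  -- If every member has rank at most one on U, then dim U ≤ dim K + t, and adding r = dim V − dim U
  -- finishes the proof.
  by_cases hall : ∀ φ' ∈ Φ, finrank ℝ (U.map φ') ≤ 1
  · have h1 := finrank_le_of_rank_one_family (𝒮 := (Φ : Set _)) (fun w y z => β w y z)
      (fun w hw => by
        by_contra h
        push Not at h
        exact hw (hβ (by rw [map_zero]; ext y z; exact h y z)))
      (fun a w y z => by simp) U K hKU
      (fun x _ hx => (hK x).2 hx) ev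
      (fun φ' hφ' e => ⟨ρ (φ' e), fun y z => by rw [hρ, h12 φ' hφ']⟩) hall
    omega
  · push Not at hall
    obtain ⟨φ', hφ', hu⟩ := hall
    have hzero : U.map φ' ≤ LinearMap.range φ' ⊓ LinearMap.ker ρ := by
      rintro _ ⟨y, hy, rfl⟩
      exact ⟨⟨y, rfl⟩, hkρ.ge (hrange (hmem φ' hφ' y hy))⟩
    have hrank := finrank_eq_map_add_inf_ker ρ (LinearMap.range φ')
    have hu' := Submodule.finrank_mono hzero
    have hr' := hmax φ' hφ'
    have hwt := Submodule.finrank_le ((LinearMap.range φ').map ρ)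
    have hw : 2 ≤ finrank ℝ ((LinearMap.range φ').map ρ) := by
      by_contra hw
      push Not at hw
      have := finrank_map_le_one_of_restrict β hβ φ' (h12 φ' hφ') (fun x => hβs _) U ρ
        ev hρ (Nat.lt_succ_iff.1 hw)
      omega
    -- Let u ≥ 2 be the rank of φ' on U and w ≥ 2 the dimension of the restrictions of its range.
    -- Maximality gives u + w ≤ r, and w ≤ t, r + t ≤ 6; so u = w = t = 2, r = 4 and dim W = 6. This
    -- is where the bound 6 enters.
    by_contra hcon
    have heq : (LinearMap.range φ').map ρ = ⊤ := Submodule.eq_top_of_finrank_eq (by omega)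
    -- Since w = t, each form φ'' Z agrees on U with some φ' Z', so a vector of U killed by φ' is
    -- killed by every φ''. Then dim U ≤ dim K + 2, a contradiction.
    have hker : U ⊓ LinearMap.ker φ' ≤ K := by
      rintro y ⟨hy, hy'⟩
      rw [hK]
      intro φ'' hφ''
      apply hβ
      rw [map_zero]
      ext Z w
      have h1 : ρ (φ'' Z) ∈ (LinearMap.range φ').map ρ := by rw [heq]; trivial
      obtain ⟨_, ⟨Z', rfl⟩, hZ'⟩ := h1
      have h2 : β (φ' Z') y w = β (φ'' Z) y w := by
        rw [← hρ _ ⟨y, hy⟩, ← hρ _ ⟨y, hy⟩, hZ']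
      rw [h12 _ hφ'', ← h2, h12 _ hφ', LinearMap.mem_ker.1 hy']
      simp
    have h1 := finrank_eq_map_add_inf_ker φ' U
    have h2 := Submodule.finrank_mono hker
    omega

end Cubics

/-! ### Smoothness of orthogonal projections onto spans. -/

section Projections

variable {E : Type*} [NormedAddCommGroup E] [InnerProductSpace ℝ E] [FiniteDimensional ℝ E]

/-- The orthogonal projection onto the span of a linearly independent family depends smoothly on
the family. -/
theorem exists_contDiffAt_starProjection_span {r : ℕ} {w : Fin r → E}
    (hw : LinearIndependent ℝ w) :
    ∃ G : (Fin r → E) → (E →L[ℝ] E), ContDiffAt ℝ ∞ G w ∧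
      ∀ w', LinearIndependent ℝ w' → G w' = (Submodule.span ℝ (Set.range w')).starProjection := by
  -- S forms linear combinations of the family and T takes inner products with it; T S is the Gram
  -- matrix and the projection is S (T S)⁻¹ T.
  let S : (Fin r → E) → ((Fin r → ℝ) →L[ℝ] E) := fun w =>
    ∑ i, (ContinuousLinearMap.proj (R := ℝ) (φ := fun _ : Fin r => ℝ) i).smulRight (w i)
  let T : (Fin r → E) → (E →L[ℝ] (Fin r → ℝ)) := fun w =>
    ∑ i, (innerSL ℝ (w i)).smulRight (Pi.single i (1 : ℝ))
  have hS : ∀ w c, S w c = ∑ i, c i • w i := fun w c => by simp [S]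
  have hT : ∀ w v i, T w v i = inner ℝ (w i) v := fun w v i => by
    simp [T, Finset.sum_apply, Pi.single_apply]
  have hSc : ContDiff ℝ ∞ S := by
    refine ContDiff.sum fun i _ => ?_
    exact ((ContinuousLinearMap.smulRightL ℝ (Fin r → ℝ) E
      (ContinuousLinearMap.proj (R := ℝ) (φ := fun _ : Fin r => ℝ) i)).contDiff).comp
      (contDiff_apply ℝ E i)
  have hTc : ContDiff ℝ ∞ T := by
    refine ContDiff.sum fun i _ => ?_
    exact (((ContinuousLinearMap.smulRightL ℝ E (Fin r → ℝ)).flip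
      (Pi.single i (1 : ℝ))).comp (innerSL ℝ)).contDiff.comp (contDiff_apply ℝ E i)
  have hinj : ∀ w, LinearIndependent ℝ w → Function.Injective ((T w).comp (S w)) := by
    intro w hw
    rw [injective_iff_map_eq_zero]
    intro c hc
    have h1 : inner ℝ (S w c) (S w c) = 0 := by
      nth_rw 1 [hS]
      rw [sum_inner]
      refine Finset.sum_eq_zero fun i _ => ?_
      have := congrFun hc i
      rw [ContinuousLinearMap.comp_apply, hT] at this
      rw [inner_smul_left, this]; simp
    rw [inner_self_eq_zero, hS] at h1
    exact funext (Fintype.linearIndependent_iff.1 hw c h1)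
  have hequiv : ∀ w, LinearIndependent ℝ w →
      ∃ e : (Fin r → ℝ) ≃L[ℝ] (Fin r → ℝ), (e : (Fin r → ℝ) →L[ℝ] (Fin r → ℝ)) =
        (T w).comp (S w) := by
    intro w hw
    refine ⟨(LinearEquiv.ofInjectiveEndo ((T w).comp (S w)).toLinearMap
      (hinj w hw)).toContinuousLinearEquiv, ?_⟩
    ext; rfl
  refine ⟨fun w => (S w).comp ((ContinuousLinearMap.inverse ((T w).comp (S w))).comp (T w)),
    ?_, ?_⟩
  · obtain ⟨e, he⟩ := hequiv w hw
    have h1 : ContDiffAt ℝ ∞ (ContinuousLinearMap.inverse :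
        ((Fin r → ℝ) →L[ℝ] (Fin r → ℝ)) → _) ((T w).comp (S w)) := by
      rw [← he]; exact contDiffAt_map_inverse e
    have h2 : ContDiffAt ℝ ∞ (fun w => (T w).comp (S w)) w := (hTc.clm_comp hSc).contDiffAt
    have h3 : ContDiffAt ℝ ∞ (fun w => ContinuousLinearMap.inverse ((T w).comp (S w))) w :=
      ContDiffAt.comp (g := ContinuousLinearMap.inverse) (f := fun w => (T w).comp (S w)) w h1 h2
    exact hSc.contDiffAt.clm_comp (h3.clm_comp hTc.contDiffAt)
  · intro w' hw'
    obtain ⟨e, he⟩ := hequiv w' hw'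
    ext1 u
    symm
    apply Submodule.eq_starProjection_of_mem_of_inner_eq_zero
    · rw [ContinuousLinearMap.comp_apply, hS]
      exact Submodule.sum_mem _ fun i _ => Submodule.smul_mem _ _ (Submodule.subset_span ⟨i, rfl⟩)
    · have key : T w' (u - S w' (ContinuousLinearMap.inverse ((T w').comp (S w')) (T w' u))) = 0 := by
        rw [map_sub, ← ContinuousLinearMap.comp_apply (T w') (S w'), ← he,
          ContinuousLinearMap.inverse_equiv]
        simp
      intro v hv
      induction hv using Submodule.span_induction with
      | mem v hv =>
        obtain ⟨i, rfl⟩ := hv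
        have := congrFun key i
        rw [hT] at this
        rw [real_inner_comm]
        exact this
      | zero => simp
      | add a b _ _ ha hb => rw [inner_add_right, ha, hb, add_zero]
      | smul c a _ ha => rw [inner_smul_right, ha, mul_zero]

/-- A family of vectors spanning `B x₀`, continuous at `x₀`, contains a subfamily which is linearly
independent around `x₀` and spans `B x₀` at `x₀`. -/
theorem exists_linearIndependent_subfamily {X ι : Type*} [TopologicalSpace X] (v : ι → X → E)
    {x₀ : X} (hv : ∀ i, ContinuousAt (v i) x₀) {r : ℕ}
    (hr : r ≤ finrank ℝ (Submodule.span ℝ (Set.range fun i => v i x₀))) :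
    ∃ j : Fin r → ι, ∀ᶠ y in 𝓝 x₀, LinearIndependent ℝ (fun i => v (j i) y) := by
  obtain ⟨f, hf, -, hind⟩ := Submodule.exists_fun_fin_finrank_span_eq ℝ
    (Set.range fun i => v i x₀)
  choose j hj using hf
  refine ⟨fun i => j (Fin.castLE hr i), ?_⟩
  have h1 : LinearIndependent ℝ (fun i : Fin r => v (j (Fin.castLE hr i)) x₀) := by
    have h0 : (fun i : Fin r => v (j (Fin.castLE hr i)) x₀) = f ∘ Fin.castLE hr :=
      funext fun i => hj _
    rw [h0]
    exact hind.comp (Fin.castLE hr) (Fin.castLE_injective hr)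
  have h2 : ContinuousAt (fun y => fun i : Fin r => v (j (Fin.castLE hr i)) y) x₀ :=
    continuousAt_pi.2 fun i => hv _
  exact h2.eventually (isOpen_setOfPred_linearIndependent.mem_nhds h1)

/-- The dimension of the span of a continuous family is lower semicontinuous. -/
theorem eventually_le_finrank_span {X ι : Type*} [TopologicalSpace X] (v : ι → X → E)
    {x₀ : X} (hv : ∀ i, ContinuousAt (v i) x₀) {r : ℕ}
    (hr : r ≤ finrank ℝ (Submodule.span ℝ (Set.range fun i => v i x₀))) :
    ∀ᶠ y in 𝓝 x₀, r ≤ finrank ℝ (Submodule.span ℝ (Set.range fun i => v i y)) := by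
  obtain ⟨j, hj⟩ := exists_linearIndependent_subfamily v hv hr
  filter_upwards [hj] with y hy
  have h1 := finrank_span_eq_card hy
  rw [Fintype.card_fin] at h1
  rw [← h1]
  apply Submodule.finrank_mono
  apply Submodule.span_mono
  rintro _ ⟨i, rfl⟩
  exact ⟨j i, rfl⟩

variable {n : ℕ} {M : Type*} [TopologicalSpace M] [ChartedSpace (Euc n) M]

/-- The orthogonal projections onto the spans of a smooth family of vectors are smooth where the
dimension of these spans is locally constant. -/
theorem contMDiffAt_starProjection_of_span {ι : Type*} (v : ι → M → E) {x₀ : M}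
    (hv : ∀ i, ContMDiffAt (𝓡 n) 𝓘(ℝ, E) ∞ (v i) x₀) (B : M → Submodule ℝ E)
    (hB : ∀ᶠ y in 𝓝 x₀, B y = Submodule.span ℝ (Set.range fun i => v i y))
    (hc : ∀ᶠ y in 𝓝 x₀, finrank ℝ (B y) = finrank ℝ (B x₀)) :
    ContMDiffAt (𝓡 n) 𝓘(ℝ, E →L[ℝ] E) ∞ (fun y => (B y).starProjection) x₀ := by
  obtain ⟨j, hj⟩ := exists_linearIndependent_subfamily v (fun i => (hv i).continuousAt)
    (r := finrank ℝ (B x₀)) (by rw [hB.self_of_nhds])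
  obtain ⟨G, hG, hG'⟩ := exists_contDiffAt_starProjection_span hj.self_of_nhds
  have h1 : ContMDiffAt (𝓡 n) 𝓘(ℝ, Fin (finrank ℝ (B x₀)) → E) ∞ (fun y => fun i => v (j i) y) x₀ :=
    contMDiffAt_pi_space.2 fun i => hv _
  refine (ContMDiffAt.comp x₀ (I' := 𝓘(ℝ, Fin (finrank ℝ (B x₀)) → E))
    hG.contMDiffAt h1).congr_of_eventuallyEq ?_
  filter_upwards [hB, hc, hj] with y h1 h2 h3
  rw [Function.comp_apply, hG' _ h3]
  have h4 : Submodule.span ℝ (Set.range fun i => v (j i) y) = B y := by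
    apply Submodule.eq_of_le_of_finrank_eq
    · rw [h1]
      apply Submodule.span_mono
      rintro _ ⟨i, rfl⟩
      exact ⟨j i, rfl⟩
    · rw [finrank_span_eq_card h3, Fintype.card_fin, h2]
  simp only [h4]

end Projections

/-! ### Derivatives of vector valued functions on a manifold. -/

section VectorDerivative

variable {n : ℕ} {M : Type*} [TopologicalSpace M] [ChartedSpace (Euc n) M]
  {E F G : Type*} [NormedAddCommGroup E] [NormedSpace ℝ E] [NormedAddCommGroup F]
  [NormedSpace ℝ F] [NormedAddCommGroup G] [NormedSpace ℝ G]

/-- The derivative of a vector valued function on a manifold. -/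
def vderiv (n : ℕ) {M : Type*} [TopologicalSpace M] [ChartedSpace (Euc n) M]
    {E : Type*} [NormedAddCommGroup E] [NormedSpace ℝ E] (g : M → E) (x : M) : Euc n →L[ℝ] E :=
  mfderiv (𝓡 n) 𝓘(ℝ, E) g x

theorem vderiv_eq_fderiv {g : M → E} {x : M} (hg : MDifferentiableAt (𝓡 n) 𝓘(ℝ, E) g x) :
    vderiv n g x = fderiv ℝ (g ∘ (extChartAt (𝓡 n) x).symm) (extChartAt (𝓡 n) x x) := by
  have h : vderiv n g x = fderivWithin ℝ (writtenInExtChartAt (𝓡 n) 𝓘(ℝ, E) x g)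
      (Set.range (𝓡 n)) (extChartAt (𝓡 n) x x) := hg.mfderiv
  rw [h, ModelWithCorners.Boundaryless.range_eq_univ, fderivWithin_univ]
  rfl

theorem differentiableAt_of_mdifferentiableAt {g : M → E} {x : M}
    (hg : MDifferentiableAt (𝓡 n) 𝓘(ℝ, E) g x) :
    DifferentiableAt ℝ (g ∘ (extChartAt (𝓡 n) x).symm) (extChartAt (𝓡 n) x x) := by
  have h := ((mdifferentiableAt_iff _ _).1 hg).2
  rw [ModelWithCorners.Boundaryless.range_eq_univ, differentiableWithinAt_univ] at h
  exact h

theorem vderiv_clm_apply {A : M → F →L[ℝ] G} {w : M → F} {x : M}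
    (hA : MDifferentiableAt (𝓡 n) 𝓘(ℝ, F →L[ℝ] G) A x)
    (hw : MDifferentiableAt (𝓡 n) 𝓘(ℝ, F) w x) (X : Euc n) :
    vderiv n (fun y => A y (w y)) x X = vderiv n A x X (w x) + A x (vderiv n w x X) := by
  rw [vderiv_eq_fderiv (hA.clm_apply hw), vderiv_eq_fderiv hA, vderiv_eq_fderiv hw]
  have h := fderiv_clm_apply (differentiableAt_of_mdifferentiableAt hA)
    (differentiableAt_of_mdifferentiableAt hw)
  have h2 := congrArg (fun L => L X) h
  simp only [Function.comp_apply, extChartAt_to_inv, add_apply,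
    ContinuousLinearMap.comp_apply, ContinuousLinearMap.flip_apply] at h2
  rw [add_comm]
  exact h2

theorem vderiv_const (c : E) (x : M) : vderiv n (fun _ : M => c) x = 0 := mfderiv_const

theorem vderiv_congr {g g' : M → E} {x : M} (h : g =ᶠ[𝓝 x] g') : vderiv n g x = vderiv n g' x :=
  h.mfderiv_eq

theorem vderiv_clm_apply_const {A : M → F →L[ℝ] G} {x : M}
    (hA : MDifferentiableAt (𝓡 n) 𝓘(ℝ, F →L[ℝ] G) A x) (w : F) (X : Euc n) :
    vderiv n (fun y => A y w) x X = vderiv n A x X w := by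
  rw [vderiv_clm_apply hA mdifferentiableAt_const, vderiv_const]
  simp

theorem vderiv_const_clm_apply (A : F →L[ℝ] G) {w : M → F} {x : M}
    (hw : MDifferentiableAt (𝓡 n) 𝓘(ℝ, F) w x) (X : Euc n) :
    vderiv n (fun y => A (w y)) x X = A (vderiv n w x X) := by
  rw [vderiv_clm_apply (A := fun _ => A) mdifferentiableAt_const hw, vderiv_const]
  simp

theorem vderiv_add {g h : M → E} {x : M} (hg : MDifferentiableAt (𝓡 n) 𝓘(ℝ, E) g x)
    (hh : MDifferentiableAt (𝓡 n) 𝓘(ℝ, E) h x) :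
    vderiv n (fun y => g y + h y) x = vderiv n g x + vderiv n h x :=
  (hg.hasMFDerivAt.add hh.hasMFDerivAt).mfderiv

theorem vderiv_sub {g h : M → E} {x : M} (hg : MDifferentiableAt (𝓡 n) 𝓘(ℝ, E) g x)
    (hh : MDifferentiableAt (𝓡 n) 𝓘(ℝ, E) h x) :
    vderiv n (fun y => g y - h y) x = vderiv n g x - vderiv n h x :=
  (hg.hasMFDerivAt.sub hh.hasMFDerivAt).mfderiv

theorem vderiv_comp {m : ℕ} {N : Type*} [TopologicalSpace N] [ChartedSpace (Euc m) N]
    {g : N → E} {i : M → N} {x : M} (hg : MDifferentiableAt (𝓡 m) 𝓘(ℝ, E) g (i x))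
    (hi : MDifferentiableAt (𝓡 n) (𝓡 m) i x) (X : Euc n) :
    vderiv n (fun y => g (i y)) x X = vderiv m g (i x) (mfderiv (𝓡 n) (𝓡 m) i x X) := by
  have := mfderiv_comp x hg hi
  exact congrArg (fun L : TangentSpace (𝓡 n) x →L[ℝ] E => L X) this

/-- The derivative of `g` in the direction of the constant field `b` in the chart at `x₀`. -/
def chartDeriv (n : ℕ) {M : Type*} [TopologicalSpace M] [ChartedSpace (Euc n) M]
    {E : Type*} [NormedAddCommGroup E] [NormedSpace ℝ E] (x₀ : M) (b : Euc n) (g : M → E)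
    (y : M) : E :=
  fderiv ℝ (g ∘ (extChartAt (𝓡 n) x₀).symm) (extChartAt (𝓡 n) x₀ y) b

/-- The constant fields in the chart at `x₀`, as tangent vectors at `y`. -/
def chartFrame (n : ℕ) {M : Type*} [TopologicalSpace M] [ChartedSpace (Euc n) M]
    (x₀ : M) (y : M) : Euc n →L[ℝ] Euc n :=
  mfderiv 𝓘(ℝ, Euc n) (𝓡 n) (extChartAt (𝓡 n) x₀).symm (extChartAt (𝓡 n) x₀ y)

theorem chartDeriv_self {x : M} {g : M → E}
    (hg : MDifferentiableAt (𝓡 n) 𝓘(ℝ, E) g x) (b : Euc n) :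
    chartDeriv n x b g x = vderiv n g x b := by
  rw [vderiv_eq_fderiv hg]; rfl

theorem isOpen_target_inter_preimage {x₀ : M} {W : Set M} (hW : IsOpen W) :
    IsOpen ((extChartAt (𝓡 n) x₀).target ∩ (extChartAt (𝓡 n) x₀).symm ⁻¹' W) :=
  (continuousOn_extChartAt_symm x₀).isOpen_inter_preimage (isOpen_extChartAt_target x₀) hW

variable [IsManifold (𝓡 n) ∞ M]

theorem mdifferentiableAt_extChartAt_symm {x₀ y : M} (hy : y ∈ (chartAt (Euc n) x₀).source) :
    MDifferentiableAt 𝓘(ℝ, Euc n) (𝓡 n) (extChartAt (𝓡 n) x₀).symm (extChartAt (𝓡 n) x₀ y) := by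
  have : IsManifold (𝓡 n) 1 M := IsManifold.of_le (n := ∞) (by exact_mod_cast le_top)
  have hy' : y ∈ (extChartAt (𝓡 n) x₀).source := by rwa [extChartAt_source]
  have h := mdifferentiableWithinAt_extChartAt_symm (I := 𝓡 n) (x := x₀)
    ((extChartAt (𝓡 n) x₀).map_source hy')
  rw [ModelWithCorners.Boundaryless.range_eq_univ] at h
  exact mdifferentiableWithinAt_univ.1 h

/-- `vderiv` at y uses the preferred chart at y, so with a fixed vector it need not be smooth in y.
`chartDeriv` uses one chart around `x₀`, is smooth there, and gives the same set of values because
the frame is bijective. -/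
theorem chartDeriv_eq_vderiv {x₀ y : M} (hy : y ∈ (chartAt (Euc n) x₀).source) {g : M → E}
    (hg : MDifferentiableAt (𝓡 n) 𝓘(ℝ, E) g y) (b : Euc n) :
    chartDeriv n x₀ b g y = vderiv n g y (chartFrame n x₀ y b) := by
  have hy' : y ∈ (extChartAt (𝓡 n) x₀).source := by rwa [extChartAt_source]
  have hinv := (extChartAt (𝓡 n) x₀).left_inv hy'
  have h := mfderiv_comp_of_eq (I := 𝓘(ℝ, Euc n)) (I' := 𝓡 n) (I'' := 𝓘(ℝ, E))
    hg (mdifferentiableAt_extChartAt_symm hy) hinv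
  rw [mfderiv_eq_fderiv] at h
  have h2 : chartDeriv n x₀ b g y =
      vderiv n g ((extChartAt (𝓡 n) x₀).symm (extChartAt (𝓡 n) x₀ y)) (chartFrame n x₀ y b) :=
    congrArg (fun L : Euc n →L[ℝ] E => L b) h
  rw [h2, hinv]

theorem chartFrame_bijective {x₀ y : M} (hy : y ∈ (chartAt (Euc n) x₀).source) :
    Function.Bijective (chartFrame n x₀ y) := by
  have : IsManifold (𝓡 n) 1 M := IsManifold.of_le (n := ∞) (by exact_mod_cast le_top)
  have hy' : y ∈ (extChartAt (𝓡 n) x₀).source := by rwa [extChartAt_source]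
  have h := isInvertible_mfderivWithin_extChartAt_symm (I := 𝓡 n) (x := x₀)
    ((extChartAt (𝓡 n) x₀).map_source hy')
  rw [ModelWithCorners.Boundaryless.range_eq_univ, mfderivWithin_univ] at h
  obtain ⟨e, he⟩ := h
  have he' : ∀ v, chartFrame n x₀ y v = e v := fun v =>
    (congrArg (fun L : Euc n →L[ℝ] Euc n => L v) he).symm
  have : ⇑(chartFrame n x₀ y) = e := funext he'
  rw [this]
  exact e.bijective

theorem contDiffOn_comp_extChartAt_symm {x₀ : M} {g : M → E} {W : Set M}
    (hg : ContMDiffOn (𝓡 n) 𝓘(ℝ, E) ∞ g W) :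
    ContDiffOn ℝ ∞ (g ∘ (extChartAt (𝓡 n) x₀).symm)
      ((extChartAt (𝓡 n) x₀).target ∩ (extChartAt (𝓡 n) x₀).symm ⁻¹' W) := by
  rw [← contMDiffOn_iff_contDiffOn]
  refine hg.comp ((contMDiffOn_extChartAt_symm x₀).mono Set.inter_subset_left) ?_
  exact fun z hz => hz.2

theorem contMDiffOn_chartDeriv {x₀ : M} {g : M → E} {W : Set M} (hW : IsOpen W)
    (hg : ContMDiffOn (𝓡 n) 𝓘(ℝ, E) ∞ g W) (b : Euc n) :
    ContMDiffOn (𝓡 n) 𝓘(ℝ, E) ∞ (chartDeriv n x₀ b g) (W ∩ (chartAt (Euc n) x₀).source) := by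
  have h1 := (contDiffOn_comp_extChartAt_symm (x₀ := x₀) hg).fderiv_of_isOpen
    (isOpen_target_inter_preimage hW) (m := ∞) (by simp)
  have h2 : ContDiffOn ℝ ∞ (fun z => fderiv ℝ (g ∘ (extChartAt (𝓡 n) x₀).symm) z b)
    ((extChartAt (𝓡 n) x₀).target ∩ (extChartAt (𝓡 n) x₀).symm ⁻¹' W) :=
    h1.clm_apply contDiffOn_const
  refine (contMDiffOn_iff_contDiffOn.2 h2).comp
    ((contMDiffOn_extChartAt (I := 𝓡 n) (x := x₀)).mono Set.inter_subset_right) ?_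
  rintro y ⟨hy1, hy2⟩
  have hy' : y ∈ (extChartAt (𝓡 n) x₀).source := by rwa [extChartAt_source]
  refine ⟨(extChartAt (𝓡 n) x₀).map_source hy', ?_⟩
  rw [Set.mem_preimage, (extChartAt (𝓡 n) x₀).left_inv hy']
  exact hy1

/-- If the derivatives of `A` annihilate `w` around `x`, then `A' (Y) (w' (X))` is symmetric. -/
theorem vderiv_vderiv_symm {A : M → F →L[ℝ] G} {w : M → F} {W : Set M} {x : M} (hW : IsOpen W)
    (hx : x ∈ W) (hA : ContMDiffOn (𝓡 n) 𝓘(ℝ, F →L[ℝ] G) ∞ A W)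
    (hw : ContMDiffOn (𝓡 n) 𝓘(ℝ, F) ∞ w W)
    (h : ∀ y ∈ W, ∀ Y, vderiv n A y Y (w y) = 0) (X Y : Euc n) :
    vderiv n A x Y (vderiv n w x X) = vderiv n A x X (vderiv n w x Y) := by
  have hAx := (hA.contMDiffAt (hW.mem_nhds hx)).mdifferentiableAt (by simp)
  have hwx := (hw.contMDiffAt (hW.mem_nhds hx)).mdifferentiableAt (by simp)
  rw [vderiv_eq_fderiv hAx, vderiv_eq_fderiv hwx]
  set z := extChartAt (𝓡 n) x x with hz
  set a := A ∘ (extChartAt (𝓡 n) x).symm with ha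
  set wz := w ∘ (extChartAt (𝓡 n) x).symm with hwz
  have hopen := isOpen_target_inter_preimage (n := n) (x₀ := x) hW
  have hzW : z ∈ (extChartAt (𝓡 n) x).target ∩ (extChartAt (𝓡 n) x).symm ⁻¹' W :=
    ⟨mem_extChartAt_target x, by simpa [hz] using hx⟩
  have had := contDiffOn_comp_extChartAt_symm (x₀ := x) hA
  have hwzd := contDiffOn_comp_extChartAt_symm (x₀ := x) hw
  have haz : ContDiffAt ℝ ∞ a z := had.contDiffAt (hopen.mem_nhds hzW)
  have hwzz : DifferentiableAt ℝ wz z :=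
    (hwzd.contDiffAt (hopen.mem_nhds hzW)).differentiableAt (by simp)
  have hfa : DifferentiableAt ℝ (fderiv ℝ a) z :=
    (haz.fderiv_right (m := ∞) (by simp)).differentiableAt (by simp)
  have hsymm : IsSymmSndFDerivAt ℝ a z := haz.isSymmSndFDerivAt (by
    rw [minSmoothness_of_isRCLikeNormedField]
    exact WithTop.coe_le_coe.2 (le_top : (2 : ℕ∞) ≤ ⊤))
  -- The hypothesis in coordinates. Differentiating it once more gives A''(c, b) w + A'(b) w'(c) =
  -- 0, and the first term is symmetric in b and c.
  have hzero : ∀ b, (fun z => fderiv ℝ a z b (wz z)) =ᶠ[𝓝 z] fun _ => 0 := by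
    intro b
    filter_upwards [hopen.mem_nhds hzW] with z' hz'
    have hy : (extChartAt (𝓡 n) x).symm z' ∈ (chartAt (Euc n) x).source := by
      have := (extChartAt (𝓡 n) x).map_target hz'.1
      rwa [extChartAt_source] at this
    have h1 := chartDeriv_eq_vderiv hy
      ((hA.contMDiffAt (hW.mem_nhds hz'.2)).mdifferentiableAt (by simp)) b
    rw [chartDeriv, (extChartAt (𝓡 n) x).right_inv hz'.1] at h1
    rw [h1]
    exact h _ hz'.2 _
  have key : ∀ b c, fderiv ℝ (fderiv ℝ a) z c b (wz z) + fderiv ℝ a z b (fderiv ℝ wz z c) = 0 := by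
    intro b c
    have h1 := (hzero b).fderiv_eq (𝕜 := ℝ)
    have h2 : DifferentiableAt ℝ (fun z => fderiv ℝ a z b) z :=
      hfa.clm_apply (differentiableAt_const b)
    rw [fderiv_clm_apply h2 hwzz] at h1
    have h3 := congrArg (fun L : Euc n →L[ℝ] G => L c) h1
    have h4 : fderiv ℝ (fun z => fderiv ℝ a z b) z c = fderiv ℝ (fderiv ℝ a) z c b := by
      rw [fderiv_clm_apply hfa (differentiableAt_const b)]
      simp
    simp only [add_apply, ContinuousLinearMap.comp_apply,
      ContinuousLinearMap.flip_apply, fderiv_fun_const, Pi.zero_apply,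
      zero_apply, h4] at h3
    rw [add_comm]
    exact h3
  have k1 := key Y X
  have k2 := key X Y
  rw [hsymm.eq X Y] at k1
  exact add_left_cancel (a := fderiv ℝ (fderiv ℝ a) z Y X (wz z)) (k1.trans k2.symm)

end VectorDerivative

/-! ### The derivative of a field of orthogonal projections. -/

section ProjectionDerivative

variable {n : ℕ} {M : Type*} [TopologicalSpace M] [ChartedSpace (Euc n) M]
  {E : Type*} [NormedAddCommGroup E] [InnerProductSpace ℝ E] [FiniteDimensional ℝ E]

/-- The orthogonal projections onto the spaces `B y`. -/
abbrev projField (B : M → Submodule ℝ E) (y : M) : E →L[ℝ] E := (B y).starProjection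

/-- The derivative of the orthogonal projections onto the spaces `B y`. -/
def projDeriv (n : ℕ) {M : Type*} [TopologicalSpace M] [ChartedSpace (Euc n) M]
    {E : Type*} [NormedAddCommGroup E] [InnerProductSpace ℝ E] [FiniteDimensional ℝ E]
    (B : M → Submodule ℝ E) (x : M) : Euc n →L[ℝ] E →L[ℝ] E :=
  vderiv n (projField B) x

variable {B : M → Submodule ℝ E} {x : M}
  (hB : MDifferentiableAt (𝓡 n) 𝓘(ℝ, E →L[ℝ] E) (projField B) x)
include hB

/-- Differentiate w = P w. The first term plays the role of a second fundamental form of B and the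
second that of the induced connection. -/
theorem vderiv_of_section {w : M → E} (hw : MDifferentiableAt (𝓡 n) 𝓘(ℝ, E) w x)
    (h : ∀ᶠ y in 𝓝 x, w y ∈ B y) (X : Euc n) :
    vderiv n w x X = projDeriv n B x X (w x) + projField B x (vderiv n w x X) := by
  have h1 : w =ᶠ[𝓝 x] fun y => projField B y (w y) := by
    filter_upwards [h] with y hy
    exact (Submodule.starProjection_eq_self_iff.2 hy).symm
  have h2 := vderiv_clm_apply hB hw X
  rw [← vderiv_congr h1] at h2
  exact h2

theorem projField_vderiv_of_perp_section {w : M → E} (hw : MDifferentiableAt (𝓡 n) 𝓘(ℝ, E) w x)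
    (h : ∀ᶠ y in 𝓝 x, w y ∈ (B y)ᗮ) (X : Euc n) :
    projField B x (vderiv n w x X) = - projDeriv n B x X (w x) := by
  have h1 : (fun y => projField B y (w y)) =ᶠ[𝓝 x] fun _ => 0 := by
    filter_upwards [h] with y hy
    exact (Submodule.starProjection_apply_eq_zero_iff _).2 hy
  have h2 := vderiv_clm_apply hB hw X
  rw [vderiv_congr h1, vderiv_const] at h2
  exact (neg_eq_of_add_eq_zero_right h2.symm).symm

theorem vderiv_projField_apply (u : E) (X : Euc n) :
    vderiv n (fun y => projField B y u) x X = projDeriv n B x X u :=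
  vderiv_clm_apply_const hB u X

theorem inner_projDeriv (X : Euc n) (u v : E) :
    inner ℝ (projDeriv n B x X u) v = inner ℝ u (projDeriv n B x X v) := by
  have hd : ∀ w : E, MDifferentiableAt (𝓡 n) 𝓘(ℝ, E) (fun y => projField B y w) x :=
    fun w => hB.clm_apply mdifferentiableAt_const
  have h1 := vderiv_const_clm_apply (innerSL ℝ v) (hd u) X
  have h2 := vderiv_const_clm_apply (innerSL ℝ u) (hd v) X
  rw [vderiv_projField_apply hB] at h1 h2
  rw [real_inner_comm]
  have h3 : (fun y => innerSL ℝ v (projField B y u)) = fun y => innerSL ℝ u (projField B y v) := by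
    funext y
    change inner ℝ v ((B y).starProjection u) = inner ℝ u ((B y).starProjection v)
    rw [real_inner_comm]
    exact (B y).starProjection_isSymmetric u v
  rw [h3, h2] at h1
  exact h1.symm

/-- From P² = P: P P' + P' P = P', so the two diagonal blocks of P' vanish. The next lemma is the
other block. -/
theorem projDeriv_mem_orthogonal (X : Euc n) {u : E} (hu : u ∈ B x) :
    projDeriv n B x X u ∈ (B x)ᗮ := by
  have h1 := vderiv_of_section hB (w := fun y => projField B y u)
    (hB.clm_apply mdifferentiableAt_const)
    (Eventually.of_forall fun y => Submodule.starProjection_apply_mem _ _) X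
  rw [vderiv_projField_apply hB, Submodule.starProjection_eq_self_iff.2 hu] at h1
  exact (Submodule.starProjection_apply_eq_zero_iff _).1 (left_eq_add.1 h1)

theorem projDeriv_mem (X : Euc n) {u : E} (hu : u ∈ (B x)ᗮ) :
    projDeriv n B x X u ∈ B x := by
  have h1 := vderiv_of_section hB (w := fun y => projField B y u)
    (hB.clm_apply mdifferentiableAt_const)
    (Eventually.of_forall fun y => Submodule.starProjection_apply_mem _ _) X
  rw [vderiv_projField_apply hB, (Submodule.starProjection_apply_eq_zero_iff _).2 hu, map_zero,
    zero_add] at h1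
  exact Submodule.starProjection_eq_self_iff.1 h1.symm

/-- The off-diagonal blocks of P' are adjoint to each other, so one of them determines P'. -/
theorem projDeriv_eq_zero_of_forall (X : Euc n) (h : ∀ u ∈ B x, projDeriv n B x X u = 0) :
    projDeriv n B x X = 0 := by
  ext1 u
  have hperp : ∀ u ∈ (B x)ᗮ, projDeriv n B x X u = 0 := by
    intro u hu
    rw [← inner_self_eq_zero (𝕜 := ℝ), inner_projDeriv hB, h _ (projDeriv_mem hB X hu),
      inner_zero_right]
  obtain ⟨a, ha, b, hb, rfl⟩ := (B x).exists_add_mem_mem_orthogonal u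
  rw [map_add, h a ha, hperp b hb]
  simp

theorem projDeriv_eq_zero_of_forall_orthogonal (X : Euc n)
    (h : ∀ u ∈ (B x)ᗮ, projDeriv n B x X u = 0) : projDeriv n B x X = 0 := by
  refine projDeriv_eq_zero_of_forall hB X fun u hu => ?_
  rw [← inner_self_eq_zero (𝕜 := ℝ), inner_projDeriv hB, h _ (projDeriv_mem_orthogonal hB X hu),
    inner_zero_right]

end ProjectionDerivative

/-! ### Tangent, first normal and osculating spaces. -/

section FundamentalSpaces

variable {n q : ℕ} {M : Type*} [TopologicalSpace M] [ChartedSpace (Euc n) M]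
  {E : Type*} [NormedAddCommGroup E] [NormedSpace ℝ E]

/-- The tangent space `f_* T_x M`. -/
def tangentSub (n : ℕ) {q : ℕ} {M : Type*} [TopologicalSpace M] [ChartedSpace (Euc n) M]
    (f : M → Euc q) (x : M) : Submodule ℝ (Euc q) :=
  LinearMap.range (vderiv n f x).toLinearMap

/-- The osculating space, spanned by the tangent space and the first normal space. -/
def osculating (n : ℕ) {q : ℕ} {M : Type u} [TopologicalSpace M] [ChartedSpace (Euc n) M]
    (f : M → Euc q) (x : M) : Submodule ℝ (Euc q) :=
  tangentSub n f x ⊔ firstNormal n f x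

/-- The first and second derivatives of `f` in the chart at `x₀`. -/
def jetFamily (n : ℕ) {q : ℕ} {M : Type*} [TopologicalSpace M] [ChartedSpace (Euc n) M]
    (x₀ : M) (f : M → Euc q) : Euc n ⊕ Euc n × Euc n → M → Euc q
  | Sum.inl b => chartDeriv n x₀ b f
  | Sum.inr bc => chartDeriv n x₀ bc.1 (chartDeriv n x₀ bc.2 f)

theorem vderiv_mem_tangentSub (f : M → Euc q) (x : M) (X : Euc n) :
    vderiv n f x X ∈ tangentSub n f x := ⟨X, rfl⟩

variable {M : Type u} [TopologicalSpace M] [ChartedSpace (Euc n) M]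

/-- The second fundamental form, as a bilinear map on the model space. -/
def secondForm (n : ℕ) {q : ℕ} {M : Type*} [TopologicalSpace M] [ChartedSpace (Euc n) M]
    (f : M → Euc q) (x : M) : Euc n →L[ℝ] Euc n →L[ℝ] Euc q :=
  secondFF n f x

theorem firstNormal_eq_span (f : M → Euc q) (x : M) :
    firstNormal n f x = Submodule.span ℝ {ξ | ∃ X Y : Euc n, ξ = secondForm n f x X Y} := rfl

theorem secondForm_apply (f : M → Euc q) (x : M) (X Z : Euc n) :
    secondForm n f x X Z = ((tangentSub n f x)ᗮ).starProjection (chartHessian n f x X Z) := rfl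

theorem firstNormal_le (f : M → Euc q) (x : M) : firstNormal n f x ≤ (tangentSub n f x)ᗮ := by
  rw [firstNormal_eq_span, Submodule.span_le]
  rintro _ ⟨X, Y, rfl⟩
  exact Submodule.starProjection_apply_mem _ _

theorem secondForm_mem_firstNormal (f : M → Euc q) (x : M) (X Z : Euc n) :
    secondForm n f x X Z ∈ firstNormal n f x := Submodule.subset_span ⟨X, Z, rfl⟩

theorem inner_eq_zero_of_mem_firstNormal {f : M → Euc q} {x : M} {u v : Euc q}
    (h : ∀ X Z : Euc n, inner ℝ (secondForm n f x X Z) u = 0) (hv : v ∈ firstNormal n f x) :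
    inner ℝ v u = 0 := by
  rw [firstNormal_eq_span] at hv
  induction hv using Submodule.span_induction with
  | mem v hv =>
    obtain ⟨X, Z, rfl⟩ := hv
    exact h X Z
  | zero => simp
  | add a b _ _ ha hb => rw [inner_add_left, ha, hb, add_zero]
  | smul c a _ ha => rw [inner_smul_left, ha, mul_zero]

theorem tangentSub_le_osculating (f : M → Euc q) (x : M) :
    tangentSub n f x ≤ osculating n f x := le_sup_left

theorem firstNormal_le_osculating (f : M → Euc q) (x : M) :
    firstNormal n f x ≤ osculating n f x := le_sup_right

theorem firstNormalPerp_eq (f : M → Euc q) (x : M) :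
    firstNormalPerp n f x = (osculating n f x)ᗮ := by
  rw [osculating, ← Submodule.inf_orthogonal]; rfl

theorem firstNormal_eq (f : M → Euc q) (x : M) :
    firstNormal n f x = osculating n f x ⊓ (tangentSub n f x)ᗮ := by
  apply le_antisymm (le_inf (firstNormal_le_osculating f x) (firstNormal_le f x))
  rintro v ⟨hv, hv'⟩
  obtain ⟨a, ha, b, hb, rfl⟩ := Submodule.mem_sup.1 hv
  have h1 : a = 0 := by
    have h2 : a ∈ (tangentSub n f x)ᗮ := by
      have := Submodule.sub_mem _ hv' (firstNormal_le f x hb)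
      rwa [add_sub_cancel_right] at this
    have h3 := Submodule.inner_right_of_mem_orthogonal ha h2
    exact inner_self_eq_zero.1 h3
  rw [h1, zero_add]
  exact hb

theorem finrank_osculating (f : M → Euc q) (x : M) :
    finrank ℝ (osculating n f x) =
      finrank ℝ (tangentSub n f x) + finrank ℝ (firstNormal n f x) := by
  have h := Submodule.finrank_sup_add_finrank_inf_eq (tangentSub n f x) (firstNormal n f x)
  have h0 : tangentSub n f x ⊓ firstNormal n f x = ⊥ := by
    rw [eq_bot_iff]
    refine (inf_le_inf_left _ (firstNormal_le f x)).trans ?_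
    rw [Submodule.inf_orthogonal_eq_bot]
  rw [h0, finrank_bot] at h
  exact h

theorem mem_chart_source_nhds (n : ℕ) {M : Type*} [TopologicalSpace M] [ChartedSpace (Euc n) M]
    (x₀ : M) : (chartAt (Euc n) x₀).source ∈ 𝓝 x₀ :=
  (chartAt (Euc n) x₀).open_source.mem_nhds (mem_chart_source _ x₀)

variable [IsManifold (𝓡 n) ∞ M]

theorem contMDiffAt_chartDeriv {x₀ y : M} {g : M → E} (hg : ContMDiff (𝓡 n) 𝓘(ℝ, E) ∞ g)
    (hy : y ∈ (chartAt (Euc n) x₀).source) (b : Euc n) :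
    ContMDiffAt (𝓡 n) 𝓘(ℝ, E) ∞ (chartDeriv n x₀ b g) y := by
  refine ((contMDiffOn_chartDeriv isOpen_univ hg.contMDiffOn b).contMDiffAt ?_)
  exact (isOpen_univ.inter (chartAt (Euc n) x₀).open_source).mem_nhds ⟨trivial, hy⟩

theorem contMDiffAt_chartDeriv_chartDeriv {x₀ y : M} {g : M → E}
    (hg : ContMDiff (𝓡 n) 𝓘(ℝ, E) ∞ g)
    (hy : y ∈ (chartAt (Euc n) x₀).source) (b c : Euc n) :
    ContMDiffAt (𝓡 n) 𝓘(ℝ, E) ∞ (chartDeriv n x₀ c (chartDeriv n x₀ b g)) y := by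
  have h1 := contMDiffOn_chartDeriv (x₀ := x₀) isOpen_univ hg.contMDiffOn b
  have ho := isOpen_univ.inter (chartAt (Euc n) x₀).open_source
  exact (contMDiffOn_chartDeriv ho h1 c).contMDiffAt
    ((ho.inter (chartAt (Euc n) x₀).open_source).mem_nhds ⟨⟨trivial, hy⟩, hy⟩)

/-- The values of a linear map are the values on the coordinate fields of a chart. -/
theorem span_range_chartDeriv {x₀ y : M} {g : M → Euc q} (hg : ContMDiff (𝓡 n) 𝓘(ℝ, Euc q) ∞ g)
    (hy : y ∈ (chartAt (Euc n) x₀).source) :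
    tangentSub n g y = Submodule.span ℝ (Set.range fun b => chartDeriv n x₀ b g y) := by
  have hgy := hg.mdifferentiableAt (x := y) (by simp)
  apply le_antisymm
  · rintro _ ⟨X, rfl⟩
    obtain ⟨b, rfl⟩ := (chartFrame_bijective hy).2 X
    exact Submodule.subset_span ⟨b, chartDeriv_eq_vderiv hy hgy b⟩
  · rw [Submodule.span_le]
    rintro _ ⟨b, rfl⟩
    exact ⟨_, (chartDeriv_eq_vderiv hy hgy b).symm⟩

theorem chartDeriv_mem_tangentSub {x₀ y : M} {g : M → Euc q}
    (hg : ContMDiff (𝓡 n) 𝓘(ℝ, Euc q) ∞ g)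
    (hy : y ∈ (chartAt (Euc n) x₀).source) (b : Euc n) :
    chartDeriv n x₀ b g y ∈ tangentSub n g y := by
  rw [span_range_chartDeriv hg hy]
  exact Submodule.subset_span ⟨b, rfl⟩

theorem chartHessian_eq {f : M → Euc q} (hf : ContMDiff (𝓡 n) 𝓘(ℝ, Euc q) ∞ f) (x : M)
    (X Z : Euc n) :
    chartHessian n f x X Z = vderiv n (chartDeriv n x Z f) x X := by
  rw [vderiv_eq_fderiv
    ((contMDiffAt_chartDeriv hf (mem_chart_source _ x) Z).mdifferentiableAt (by simp))]
  have h1 : (chartDeriv n x Z f ∘ (extChartAt (𝓡 n) x).symm) =ᶠ[𝓝 (extChartAt (𝓡 n) x x)]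
      fun z => fderiv ℝ (f ∘ (extChartAt (𝓡 n) x).symm) z Z := by
    filter_upwards [extChartAt_target_mem_nhds (I := 𝓡 n) x] with z hz
    rw [Function.comp_apply, chartDeriv, (extChartAt (𝓡 n) x).right_inv hz]
  rw [h1.fderiv_eq]
  have h2 := contDiffOn_comp_extChartAt_symm (x₀ := x) (hf.contMDiffOn (s := Set.univ))
  have h3 : ContDiffAt ℝ ∞ (f ∘ (extChartAt (𝓡 n) x).symm) (extChartAt (𝓡 n) x x) :=
    h2.contDiffAt ((isOpen_target_inter_preimage isOpen_univ).mem_nhds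
      ⟨mem_extChartAt_target x, trivial⟩)
  have h4 : DifferentiableAt ℝ (fderiv ℝ (f ∘ (extChartAt (𝓡 n) x).symm))
      (extChartAt (𝓡 n) x x) := (h3.fderiv_right (m := ∞) (by simp)).differentiableAt (by simp)
  rw [fderiv_clm_apply h4 (differentiableAt_const Z)]
  simp [chartHessian]

theorem chartHessian_symm {f : M → Euc q} (hf : ContMDiff (𝓡 n) 𝓘(ℝ, Euc q) ∞ f) (x : M)
    (X Z : Euc n) : chartHessian n f x X Z = chartHessian n f x Z X := by
  have h2 := contDiffOn_comp_extChartAt_symm (x₀ := x) (hf.contMDiffOn (s := Set.univ))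
  have h3 : ContDiffAt ℝ ∞ (f ∘ (extChartAt (𝓡 n) x).symm) (extChartAt (𝓡 n) x x) :=
    h2.contDiffAt ((isOpen_target_inter_preimage isOpen_univ).mem_nhds
      ⟨mem_extChartAt_target x, trivial⟩)
  exact (h3.isSymmSndFDerivAt (by
    rw [minSmoothness_of_isRCLikeNormedField]
    exact WithTop.coe_le_coe.2 (le_top : (2 : ℕ∞) ≤ ⊤))).eq X Z

theorem secondForm_symm {f : M → Euc q} (hf : ContMDiff (𝓡 n) 𝓘(ℝ, Euc q) ∞ f) (x : M)
    (X Z : Euc n) : secondForm n f x X Z = secondForm n f x Z X := by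
  rw [secondForm_apply, secondForm_apply, chartHessian_symm hf]

variable {f : M → Euc q} (hf : ContMDiff (𝓡 n) 𝓘(ℝ, Euc q) ∞ f)
  (hinj : ∀ x, Function.Injective (vderiv n f x))
include hf hinj

omit [IsManifold (𝓡 n) ∞ M] hf in
theorem finrank_tangentSub (x : M) : finrank ℝ (tangentSub n f x) = n := by
  rw [tangentSub, LinearMap.finrank_range_of_inj (hinj x), finrank_euclideanSpace_fin]

theorem contMDiff_projField_tangentSub :
    ContMDiff (𝓡 n) 𝓘(ℝ, Euc q →L[ℝ] Euc q) ∞ (projField (tangentSub n f)) := fun x =>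
  contMDiffAt_starProjection_of_span (fun b y => chartDeriv n x b f y)
    (fun b => contMDiffAt_chartDeriv hf (mem_chart_source _ x) b) _
    (by
      filter_upwards [mem_chart_source_nhds n x] with y hy
      exact span_range_chartDeriv hf hy)
    (Eventually.of_forall fun y => by rw [finrank_tangentSub hinj, finrank_tangentSub hinj])

theorem mdifferentiableAt_projField_tangentSub (x : M) :
    MDifferentiableAt (𝓡 n) 𝓘(ℝ, Euc q →L[ℝ] Euc q) (projField (tangentSub n f)) x :=
  (contMDiff_projField_tangentSub hf hinj).mdifferentiableAt (by simp)

/-- The second fundamental form as the derivative of the tangent projection. -/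
theorem secondForm_eq_projDeriv (x : M) (X Z : Euc n) :
    secondForm n f x X Z = projDeriv n (tangentSub n f) x X (vderiv n f x Z) := by
  have hT := mdifferentiableAt_projField_tangentSub hf hinj x
  have hw := (contMDiffAt_chartDeriv hf (mem_chart_source _ x) Z).mdifferentiableAt
    (n := ∞) (by simp)
  have h1 := vderiv_of_section hT hw (by
    filter_upwards [mem_chart_source_nhds n x] with y hy
    exact chartDeriv_mem_tangentSub hf hy Z) X
  rw [chartDeriv_self (hf.mdifferentiableAt (by simp))] at h1
  rw [secondForm_apply, chartHessian_eq hf, h1, map_add,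
    (Submodule.starProjection_apply_eq_zero_iff _).2
      (Submodule.le_orthogonal_orthogonal _ (Submodule.starProjection_apply_mem _ _)),
    Submodule.starProjection_eq_self_iff.2
      (projDeriv_mem_orthogonal hT X (vderiv_mem_tangentSub f x Z)), add_zero]

/-- The derivatives of tangent sections belong to the osculating space. -/
theorem projDeriv_tangentSub_mem (x : M) (X : Euc n) {v : Euc q} (hv : v ∈ tangentSub n f x) :
    projDeriv n (tangentSub n f) x X v ∈ firstNormal n f x := by
  obtain ⟨Z, rfl⟩ := hv
  have := secondForm_eq_projDeriv hf hinj x X Z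
  exact this ▸ secondForm_mem_firstNormal f x X Z

theorem vderiv_section_mem_osculating {x : M} {w : M → Euc q}
    (hw : MDifferentiableAt (𝓡 n) 𝓘(ℝ, Euc q) w x) (h : ∀ᶠ y in 𝓝 x, w y ∈ tangentSub n f y)
    (X : Euc n) : vderiv n w x X ∈ osculating n f x := by
  rw [vderiv_of_section (mdifferentiableAt_projField_tangentSub hf hinj x) hw h X]
  exact Submodule.add_mem _
    (firstNormal_le_osculating f x (projDeriv_tangentSub_mem hf hinj x X h.self_of_nhds))
    (tangentSub_le_osculating f x (Submodule.starProjection_apply_mem _ _))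

omit [IsManifold (𝓡 n) ∞ M] hf hinj in
theorem jetFamily_inr (x₀ : M) (b c : Euc n) :
    jetFamily n x₀ f (Sum.inr (b, c)) = chartDeriv n x₀ b (chartDeriv n x₀ c f) := rfl

omit hinj in
theorem contMDiffAt_jetFamily {x₀ y : M} (hy : y ∈ (chartAt (Euc n) x₀).source)
    (i : Euc n ⊕ Euc n × Euc n) : ContMDiffAt (𝓡 n) 𝓘(ℝ, Euc q) ∞ (jetFamily n x₀ f i) y := by
  rcases i with b | ⟨b, c⟩
  · exact contMDiffAt_chartDeriv hf hy b
  · exact contMDiffAt_chartDeriv_chartDeriv hf hy c b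

/-- The osculating spaces are spanned by the first and second derivatives in any chart. -/
theorem osculating_eq_span {x₀ y : M} (hy : y ∈ (chartAt (Euc n) x₀).source) :
    osculating n f y = Submodule.span ℝ (Set.range fun i => jetFamily n x₀ f i y) := by
  have hT := mdifferentiableAt_projField_tangentSub hf hinj y
  have hnhds : ∀ᶠ y' in 𝓝 y, y' ∈ (chartAt (Euc n) x₀).source :=
    (chartAt (Euc n) x₀).open_source.mem_nhds hy
  have hw : ∀ Z, MDifferentiableAt (𝓡 n) 𝓘(ℝ, Euc q) (chartDeriv n x₀ Z f) y := fun Z =>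
    (contMDiffAt_chartDeriv hf hy Z).mdifferentiableAt (n := ∞) (by simp)
  have hsec : ∀ Z, ∀ᶠ y' in 𝓝 y, chartDeriv n x₀ Z f y' ∈ tangentSub n f y' := fun Z => by
    filter_upwards [hnhds] with y' hy'
    exact chartDeriv_mem_tangentSub hf hy' Z
  have hjet : ∀ i, jetFamily n x₀ f i y ∈
      Submodule.span ℝ (Set.range fun i => jetFamily n x₀ f i y) :=
    fun i => Submodule.subset_span ⟨i, rfl⟩
  have htan : tangentSub n f y ≤
      Submodule.span ℝ (Set.range fun i => jetFamily n x₀ f i y) := by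
    rw [span_range_chartDeriv hf hy, Submodule.span_le]
    rintro _ ⟨b, rfl⟩
    exact hjet (Sum.inl b)
  apply le_antisymm
  · refine sup_le htan ?_
    rw [firstNormal_eq_span, Submodule.span_le]
    rintro _ ⟨X, Z, rfl⟩
    obtain ⟨X', rfl⟩ := (chartFrame_bijective hy).2 X
    obtain ⟨Z', rfl⟩ := (chartFrame_bijective hy).2 Z
    -- A vector α(X, Z) is a second derivative in the chart minus its tangential part.
    have h1 := vderiv_of_section hT (hw Z') (hsec Z') (chartFrame n x₀ y X')
    rw [chartDeriv_eq_vderiv hy (hf.mdifferentiableAt (by simp)) Z'] at h1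
    have h2 := secondForm_eq_projDeriv hf hinj y (chartFrame n x₀ y X') (chartFrame n x₀ y Z')
    have h3 := eq_sub_of_add_eq (h1.symm)
    rw [← h2, ← chartDeriv_eq_vderiv hy (hw Z') X'] at h3
    have h4 := Submodule.sub_mem _ (hjet (Sum.inr (X', Z')))
      (htan (Submodule.starProjection_apply_mem (tangentSub n f y)
        (chartDeriv n x₀ X' (chartDeriv n x₀ Z' f) y)))
    rw [jetFamily_inr] at h4
    rw [SetLike.mem_coe]
    exact h3 ▸ h4
  · rw [Submodule.span_le]
    rintro _ ⟨b | ⟨b, c⟩, rfl⟩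
    · exact tangentSub_le_osculating f y (chartDeriv_mem_tangentSub hf hy b)
    · rw [SetLike.mem_coe]
      simp only [jetFamily_inr]
      rw [chartDeriv_eq_vderiv hy (hw c)]
      exact vderiv_section_mem_osculating hf hinj (hw c) (hsec c) _

theorem eventually_le_finrank_osculating {x : M} {c : ℕ} (hc : c ≤ finrank ℝ (osculating n f x)) :
    ∀ᶠ y in 𝓝 x, c ≤ finrank ℝ (osculating n f y) := by
  rw [osculating_eq_span hf hinj (mem_chart_source _ x)] at hc
  have h := eventually_le_finrank_span (jetFamily n x f) (x₀ := x)
    (fun i => (contMDiffAt_jetFamily hf (mem_chart_source _ x) i).continuousAt) hc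
  filter_upwards [h, mem_chart_source_nhds n x] with y h1 h2
  rwa [osculating_eq_span hf hinj h2]

theorem contMDiff_projField_osculating {p : ℕ} (hp : ∀ x, finrank ℝ (firstNormal n f x) = p) :
    ContMDiff (𝓡 n) 𝓘(ℝ, Euc q →L[ℝ] Euc q) ∞ (projField (osculating n f)) := fun x =>
  contMDiffAt_starProjection_of_span (jetFamily n x f)
    (contMDiffAt_jetFamily hf (mem_chart_source _ x)) _
    (by
      filter_upwards [mem_chart_source_nhds n x] with y hy
      exact osculating_eq_span hf hinj hy)
    (Eventually.of_forall fun y => by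
      rw [finrank_osculating, finrank_osculating, hp, hp, finrank_tangentSub hinj,
        finrank_tangentSub hinj])

end FundamentalSpaces

theorem starProjection_inf_orthogonal {E : Type*} [NormedAddCommGroup E] [InnerProductSpace ℝ E]
    [FiniteDimensional ℝ E] {A B : Submodule ℝ E} (h : A ≤ B) :
    (B ⊓ Aᗮ).starProjection = B.starProjection - A.starProjection := by
  ext1 u
  have hmem : B.starProjection u - A.starProjection u ∈ B ⊓ Aᗮ := by
    refine Submodule.mem_inf.2 ⟨Submodule.sub_mem _ (Submodule.starProjection_apply_mem _ _)
      (h (Submodule.starProjection_apply_mem _ _)), ?_⟩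
    rw [Submodule.mem_orthogonal']
    intro v hv
    have h1 := Submodule.starProjection_inner_eq_zero (K := B) u v (h hv)
    have h2 := Submodule.starProjection_inner_eq_zero (K := A) u v hv
    rw [inner_sub_left] at h1 h2 ⊢
    linarith
  change _ = B.starProjection u - A.starProjection u
  refine Submodule.eq_starProjection_of_mem_of_inner_eq_zero hmem ?_
  rintro v ⟨hv, hv'⟩
  have h1 := Submodule.starProjection_inner_eq_zero (K := B) u v hv
  have h2 : inner ℝ (A.starProjection u) v = 0 :=
    Submodule.inner_right_of_mem_orthogonal (Submodule.starProjection_apply_mem _ _) hv'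
  rw [← sub_add, inner_add_left, h1, h2, add_zero]

theorem finrank_inf_orthogonal {E : Type*} [NormedAddCommGroup E] [InnerProductSpace ℝ E]
    [FiniteDimensional ℝ E] {A B : Submodule ℝ E} (h : A ≤ B) :
    finrank ℝ A + finrank ℝ (B ⊓ Aᗮ : Submodule ℝ E) = finrank ℝ B := by
  rw [inf_comm]
  exact Submodule.finrank_add_inf_finrank_orthogonal h

/-! ### The space S, the adapted bundle and N(α_S). -/

section Nonparallel

variable {n q : ℕ} {M : Type u} [TopologicalSpace M] [ChartedSpace (Euc n) M]
  [IsManifold (𝓡 n) ∞ M] {f : M → Euc q}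

/-- The orthogonal complement of the nonparallel space in the osculating space. -/
def adapted (n : ℕ) {q : ℕ} {M : Type u} [TopologicalSpace M] [ChartedSpace (Euc n) M]
    (f : M → Euc q) (x : M) : Submodule ℝ (Euc q) :=
  osculating n f x ⊓ (nonparallelSpace n f x)ᗮ

/-- The subspace `N(α_S)`, as a subspace of the model space. -/
def nullSub (n : ℕ) {q : ℕ} {M : Type u} [TopologicalSpace M] [ChartedSpace (Euc n) M]
    (f : M → Euc q) (x : M) : Submodule ℝ (Euc n) :=
  nullityS n f x

variable (hf : ContMDiff (𝓡 n) 𝓘(ℝ, Euc q) ∞ f)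
  (hinj : ∀ x, Function.Injective (vderiv n f x))
  {p : ℕ} (hp : ∀ x, finrank ℝ (firstNormal n f x) = p)
include hf hinj hp

theorem mdifferentiableAt_projField_osculating (x : M) :
    MDifferentiableAt (𝓡 n) 𝓘(ℝ, Euc q →L[ℝ] Euc q) (projField (osculating n f)) x :=
  (contMDiff_projField_osculating hf hinj hp).mdifferentiableAt (by simp)

/-- Derivatives of tangent sections stay in the osculating space, so the component of the derivative
outside it, which is P'_O applied to the section, vanishes. -/
theorem projDeriv_osculating_tangentSub (x : M) (X : Euc n) {v : Euc q}
    (hv : v ∈ tangentSub n f x) : projDeriv n (osculating n f) x X v = 0 := by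
  have hO := mdifferentiableAt_projField_osculating hf hinj hp x
  have hT := mdifferentiableAt_projField_tangentSub hf hinj x
  have hw : MDifferentiableAt (𝓡 n) 𝓘(ℝ, Euc q) (fun y => projField (tangentSub n f) y v) x :=
    hT.clm_apply mdifferentiableAt_const
  have h1 := vderiv_of_section hO hw (Eventually.of_forall fun y =>
    tangentSub_le_osculating f y (Submodule.starProjection_apply_mem _ _)) X
  have h2 := vderiv_section_mem_osculating hf hinj hw (Eventually.of_forall fun y =>
    Submodule.starProjection_apply_mem _ _) X
  rw [Submodule.starProjection_eq_self_iff.2 h2, Submodule.starProjection_eq_self_iff.2 hv] at h1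
  exact right_eq_add.1 h1

/-- The adjoint form of the preceding lemma: the value lies in O and is orthogonal to T. -/
theorem projDeriv_osculating_mem_firstNormal (x : M) (X : Euc n) {μ : Euc q}
    (hμ : μ ∈ (osculating n f x)ᗮ) : projDeriv n (osculating n f) x X μ ∈ firstNormal n f x := by
  have hO := mdifferentiableAt_projField_osculating hf hinj hp x
  rw [firstNormal_eq]
  refine ⟨projDeriv_mem hO X hμ, ?_⟩
  rw [SetLike.mem_coe, Submodule.mem_orthogonal']
  intro v hv
  rw [inner_projDeriv hO, projDeriv_osculating_tangentSub hf hinj hp x X hv, inner_zero_right]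

/-- The nonparallel space in terms of the derivative of the osculating projection. -/
theorem nonparallelSpace_eq (x : M) : nonparallelSpace n f x =
    Submodule.span ℝ {ξ | ∃ X : Euc n, ∃ μ ∈ (osculating n f x)ᗮ,
      ξ = projDeriv n (osculating n f) x X μ} := by
  have hO := mdifferentiableAt_projField_osculating hf hinj hp x
  have hproj : ∀ v : Euc q, (firstNormal n f x).starProjection
      ((normalSpace n f x).starProjection v) =
      (firstNormal n f x).starProjection (projField (osculating n f) x v) := by
    intro v
    have h1 := Submodule.starProjection_comp_starProjection_of_le
      (firstNormal_le (n := n) f x)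
    have h2 := Submodule.starProjection_comp_starProjection_of_le
      (firstNormal_le_osculating (n := n) f x)
    exact (congrArg (fun L : Euc q →L[ℝ] Euc q => L v) h1).trans
      (congrArg (fun L : Euc q →L[ℝ] Euc q => L v) h2).symm
  have hself : ∀ (X : Euc n) {μ : Euc q}, μ ∈ (osculating n f x)ᗮ →
      (firstNormal n f x).starProjection (projDeriv n (osculating n f) x X μ) =
        projDeriv n (osculating n f) x X μ := fun X μ hμ =>
    Submodule.starProjection_eq_self_iff.2
      (projDeriv_osculating_mem_firstNormal hf hinj hp x X hμ)
  apply le_antisymm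
  · refine Submodule.span_le.2 ?_
    rintro _ ⟨W, μ, X, hW, hx, hμ, hperp, rfl⟩
    -- For a section of the complement of O, the projection to O of its derivative is −P'_O(X) of
    -- its value, so only the value at x matters.
    have h1 := projField_vderiv_of_perp_section hO
      ((hμ.contMDiffAt (hW.mem_nhds hx)).mdifferentiableAt (by simp))
      (by
        filter_upwards [hW.mem_nhds hx] with y hy
        rw [← firstNormalPerp_eq]
        exact hperp y hy) X
    have hμx : μ x ∈ (osculating n f x)ᗮ := by
      rw [← firstNormalPerp_eq]; exact hperp x hx
    have h2 : (firstNormal n f x).starProjection (normalDeriv n f μ x X) =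
        - projDeriv n (osculating n f) x X (μ x) := by
      refine (hproj (vderiv n μ x X)).trans ?_
      rw [h1, map_neg, hself X hμx]
    rw [h2]
    exact Submodule.neg_mem _ (Submodule.subset_span ⟨X, μ x, hμx, rfl⟩)
  · refine Submodule.span_le.2 ?_
    rintro _ ⟨X, μ, hμ, rfl⟩
    -- Any μ normal to O at x extends to the section μ − P_O μ, whose derivative at x is −P'_O(X)μ.
    have hsm : ContMDiff (𝓡 n) 𝓘(ℝ, Euc q) ∞ (fun y => μ - projField (osculating n f) y μ) :=
      contMDiff_const.sub ((contMDiff_projField_osculating hf hinj hp).clm_apply contMDiff_const)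
    have hd : vderiv n (fun y => μ - projField (osculating n f) y μ) x X =
        - projDeriv n (osculating n f) x X μ := by
      rw [vderiv_sub mdifferentiableAt_const (hO.clm_apply mdifferentiableAt_const), vderiv_const,
        zero_sub, neg_apply, vderiv_projField_apply hO]
    have hmem := projDeriv_osculating_mem_firstNormal hf hinj hp x X hμ
    have h2 : (firstNormal n f x).starProjection
        (normalDeriv n f (fun y => μ - projField (osculating n f) y μ) x X) =
        - projDeriv n (osculating n f) x X μ := by
      refine (hproj (vderiv n _ x X)).trans ?_
      rw [hd, map_neg, map_neg, Submodule.starProjection_eq_self_iff.2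
        (firstNormal_le_osculating f x hmem), hself X hμ]
    rw [← neg_neg (projDeriv n (osculating n f) x X μ), ← h2]
    refine Submodule.neg_mem _ (Submodule.subset_span
      ⟨Set.univ, _, X, isOpen_univ, trivial, hsm.contMDiffOn, fun y _ => ?_, rfl⟩)
    rw [firstNormalPerp_eq]
    exact Submodule.sub_starProjection_mem_orthogonal _

theorem projDeriv_osculating_mem_nonparallelSpace (x : M) (X : Euc n) {μ : Euc q}
    (hμ : μ ∈ (osculating n f x)ᗮ) :
    projDeriv n (osculating n f) x X μ ∈ nonparallelSpace n f x := by
  rw [nonparallelSpace_eq hf hinj hp]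
  exact Submodule.subset_span ⟨X, μ, hμ, rfl⟩

theorem nonparallelSpace_le_firstNormal (x : M) : nonparallelSpace n f x ≤ firstNormal n f x := by
  rw [nonparallelSpace_eq hf hinj hp, Submodule.span_le]
  rintro _ ⟨X, μ, hμ, rfl⟩
  exact projDeriv_osculating_mem_firstNormal hf hinj hp x X hμ

theorem nonparallelSpace_le_osculating (x : M) :
    nonparallelSpace n f x ≤ osculating n f x :=
  (nonparallelSpace_le_firstNormal hf hinj hp x).trans (firstNormal_le_osculating f x)

theorem tangentSub_le_adapted (x : M) : tangentSub n f x ≤ adapted n f x := by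
  refine le_inf (tangentSub_le_osculating f x) ?_
  have h1 := Submodule.orthogonal_le
    ((nonparallelSpace_le_firstNormal hf hinj hp x).trans (firstNormal_le f x))
  rwa [Submodule.orthogonal_orthogonal] at h1

theorem projField_adapted (x : M) : projField (adapted n f) x =
    projField (osculating n f) x - projField (nonparallelSpace n f) x :=
  starProjection_inf_orthogonal (nonparallelSpace_le_osculating hf hinj hp x)

variable {s : ℕ} (hs : ∀ x, finrank ℝ (nonparallelSpace n f x) = s)
include hs

theorem finrank_adapted (x : M) : finrank ℝ (adapted n f x) + s = n + p := by
  have h := finrank_inf_orthogonal (nonparallelSpace_le_osculating hf hinj hp x)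
  rw [hs, finrank_osculating, hp, finrank_tangentSub hinj] at h
  rw [adapted]
  omega

/-- Around x, S is the span, of constant dimension, of the smooth family P'_O(∂_b)(u − P_O u). -/
theorem contMDiff_projField_nonparallelSpace :
    ContMDiff (𝓡 n) 𝓘(ℝ, Euc q →L[ℝ] Euc q) ∞ (projField (nonparallelSpace n f)) := by
  intro x
  have hO := contMDiff_projField_osculating hf hinj hp
  refine contMDiffAt_starProjection_of_span
    (fun (i : Euc n × Euc q) y => chartDeriv n x i.1 (projField (osculating n f)) y
      (i.2 - projField (osculating n f) y i.2)) ?_ _ ?_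
    (Eventually.of_forall fun y => by rw [hs, hs])
  · rintro ⟨b, u⟩
    exact (contMDiffAt_chartDeriv hO (mem_chart_source _ x) b).clm_apply
      (contMDiffAt_const.sub (hO.contMDiffAt.clm_apply contMDiffAt_const))
  · filter_upwards [mem_chart_source_nhds n x] with y hy
    rw [nonparallelSpace_eq hf hinj hp]
    congr 1
    ext ξ
    constructor
    · rintro ⟨X, μ, hμ, rfl⟩
      obtain ⟨b, rfl⟩ := (chartFrame_bijective hy).2 X
      refine ⟨(b, μ), ?_⟩
      simp only
      rw [chartDeriv_eq_vderiv hy (hO.mdifferentiableAt (by simp)),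
        (Submodule.starProjection_apply_eq_zero_iff _).2 hμ, sub_zero]
      rfl
    · rintro ⟨⟨b, u⟩, rfl⟩
      refine ⟨chartFrame n x y b, u - projField (osculating n f) y u,
        Submodule.sub_starProjection_mem_orthogonal _, ?_⟩
      simp only
      rw [chartDeriv_eq_vderiv hy (hO.mdifferentiableAt (by simp))]
      rfl

theorem contMDiff_projField_adapted :
    ContMDiff (𝓡 n) 𝓘(ℝ, Euc q →L[ℝ] Euc q) ∞ (projField (adapted n f)) := by
  have h : projField (adapted n f) =
      fun x => projField (osculating n f) x - projField (nonparallelSpace n f) x :=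
    funext fun x => projField_adapted hf hinj hp x
  rw [h]
  exact (contMDiff_projField_osculating hf hinj hp).sub
    (contMDiff_projField_nonparallelSpace hf hinj hp hs)

theorem mdifferentiableAt_projField_adapted (x : M) :
    MDifferentiableAt (𝓡 n) 𝓘(ℝ, Euc q →L[ℝ] Euc q) (projField (adapted n f)) x :=
  (contMDiff_projField_adapted hf hinj hp hs).mdifferentiableAt (by simp)

theorem mdifferentiableAt_projField_nonparallelSpace (x : M) :
    MDifferentiableAt (𝓡 n) 𝓘(ℝ, Euc q →L[ℝ] Euc q) (projField (nonparallelSpace n f)) x :=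
  (contMDiff_projField_nonparallelSpace hf hinj hp hs).mdifferentiableAt (by simp)

theorem projDeriv_adapted (x : M) (X : Euc n) : projDeriv n (adapted n f) x X =
    projDeriv n (osculating n f) x X - projDeriv n (nonparallelSpace n f) x X := by
  have h : projField (adapted n f) =
      fun x => projField (osculating n f) x - projField (nonparallelSpace n f) x :=
    funext fun x => projField_adapted hf hinj hp x
  rw [projDeriv, h, vderiv_sub (mdifferentiableAt_projField_osculating hf hinj hp x)
    (mdifferentiableAt_projField_nonparallelSpace hf hinj hp hs x)]
  rfl

-- P'_O(X)w is normal to O, so a second application of P'_O(X) lands in S, which is orthogonal to w;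
-- by self-adjointness that pairing is the square of the norm of P'_O(X)w.
omit hs in
theorem projDeriv_osculating_adapted (x : M) (X : Euc n) {w : Euc q} (hw : w ∈ adapted n f x) :
    projDeriv n (osculating n f) x X w = 0 := by
  have hO := mdifferentiableAt_projField_osculating hf hinj hp x
  have h1 := projDeriv_mem_orthogonal hO X hw.1
  rw [← inner_self_eq_zero (𝕜 := ℝ), inner_projDeriv hO]
  exact Submodule.inner_left_of_mem_orthogonal
    (projDeriv_osculating_mem_nonparallelSpace hf hinj hp x X h1) hw.2

/-- P_A = P_O − P_S; on A the first derivative vanishes, and P'_S sends the complement of S into S.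
-/
theorem projDeriv_adapted_mem (x : M) (X : Euc n) {w : Euc q} (hw : w ∈ adapted n f x) :
    projDeriv n (adapted n f) x X w ∈ nonparallelSpace n f x := by
  rw [projDeriv_adapted hf hinj hp hs, sub_apply,
    projDeriv_osculating_adapted hf hinj hp x X hw, zero_sub]
  exact Submodule.neg_mem _
    (projDeriv_mem (mdifferentiableAt_projField_nonparallelSpace hf hinj hp hs x) X hw.2)

/-- The Codazzi equation, for the adapted bundle instead of the tangent bundle. -/
theorem codazzi (x : M) (X Y : Euc n) (w μ : Euc q) :
    inner ℝ (projDeriv n (adapted n f) x X w) (projDeriv n (osculating n f) x Y μ) =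
      inner ℝ (projDeriv n (adapted n f) x Y w) (projDeriv n (osculating n f) x X μ) := by
  have hO := contMDiff_projField_osculating hf hinj hp
  have hA := contMDiff_projField_adapted hf hinj hp hs
  have hOd := mdifferentiableAt_projField_osculating hf hinj hp
  let m : M → Euc q := fun y => projField (osculating n f) y μ
  have hm : ContMDiff (𝓡 n) 𝓘(ℝ, Euc q) ∞ m := hO.clm_apply contMDiff_const
  let W : M → Euc q := fun y => projField (adapted n f) y w
  have hW : ContMDiff (𝓡 n) 𝓘(ℝ, Euc q) ∞ W := hA.clm_apply contMDiff_const
  -- The covector field ⟨P_O μ, ·⟩ has derivative ⟨P'_O(Y)μ, ·⟩, which annihilates sections of the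
  -- adapted bundle. So `vderiv_vderiv_symm` applies to it and the section P_A w.
  let A : M → Euc q →L[ℝ] ℝ := fun y => innerSL ℝ (m y)
  have hAs : ContMDiff (𝓡 n) 𝓘(ℝ, Euc q →L[ℝ] ℝ) ∞ A :=
    (innerSL ℝ (E := Euc q)).contMDiff.comp hm
  have hAd : ∀ y Y v, vderiv n A y Y v = inner ℝ (projDeriv n (osculating n f) y Y μ) v := by
    intro y Y v
    have h1 := vderiv_const_clm_apply (innerSL ℝ (E := Euc q))
      (hm.mdifferentiableAt (x := y) (by simp)) Y
    rw [vderiv_projField_apply (hOd y)] at h1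
    exact congrArg (fun L : Euc q →L[ℝ] ℝ => L v) h1
  have hzero : ∀ y ∈ (Set.univ : Set M), ∀ Y, vderiv n A y Y (W y) = 0 := by
    intro y _ Y
    rw [hAd]
    have hWy : W y ∈ adapted n f y := Submodule.starProjection_apply_mem _ _
    rw [inner_projDeriv (hOd y), projDeriv_osculating_adapted hf hinj hp y Y hWy,
      inner_zero_right]
  have key := vderiv_vderiv_symm isOpen_univ (Set.mem_univ x) hAs.contMDiffOn hW.contMDiffOn
    hzero X Y
  have hWd : ∀ Z, vderiv n W x Z = projDeriv n (adapted n f) x Z w := fun Z =>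
    vderiv_projField_apply (mdifferentiableAt_projField_adapted hf hinj hp hs x) w Z
  rw [hAd, hAd, hWd, hWd] at key
  rw [real_inner_comm, key, real_inner_comm]

/-- Tangent sections are sections of A. The section P_T(f_*Z) has derivative α(X, Z) at x, and what
P_A removes from it is its component in S. -/
theorem projDeriv_adapted_vderiv (x : M) (X Z : Euc n) :
    projDeriv n (adapted n f) x X (vderiv n f x Z) =
      (nonparallelSpace n f x).starProjection (secondForm n f x X Z) := by
  have hA := mdifferentiableAt_projField_adapted hf hinj hp hs x
  have hT := mdifferentiableAt_projField_tangentSub hf hinj x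
  have hw : MDifferentiableAt (𝓡 n) 𝓘(ℝ, Euc q)
      (fun y => projField (tangentSub n f) y (vderiv n f x Z)) x :=
    hT.clm_apply mdifferentiableAt_const
  have h1 := vderiv_of_section hA hw (Eventually.of_forall fun y =>
    tangentSub_le_adapted hf hinj hp y (Submodule.starProjection_apply_mem _ _)) X
  rw [vderiv_projField_apply hT, Submodule.starProjection_eq_self_iff.2
    (vderiv_mem_tangentSub f x Z), ← secondForm_eq_projDeriv hf hinj, projField_adapted hf hinj hp,
    sub_apply, Submodule.starProjection_eq_self_iff.2
    (firstNormal_le_osculating f x (secondForm_mem_firstNormal f x X Z))] at h1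
  have h2 := eq_sub_of_add_eq h1.symm
  rw [sub_sub_cancel] at h2
  exact h2

theorem mem_nullSub_iff_forall (x : M) (Y : Euc n) :
    Y ∈ nullSub n f x ↔ ∀ Z : Euc n,
      projDeriv n (adapted n f) x Y (vderiv n f x Z) = 0 := by
  constructor
  · intro h Z
    rw [projDeriv_adapted_vderiv hf hinj hp hs]
    exact h Z
  · intro h (Z : Euc n)
    have := h Z
    rw [projDeriv_adapted_vderiv hf hinj hp hs] at this
    exact this

/-- The value lies in S ⊆ N_1. By `codazzi` with w = f_*Z, its product with the S-part of α(X, Z) is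
⟨P'_A(Y) f_*Z, P'_O(X)μ⟩ = 0, so it is orthogonal to all of N_1. -/
theorem projDeriv_osculating_of_mem_nullSub (x : M) {Y : Euc n} (hY : Y ∈ nullSub n f x)
    {μ : Euc q} (hμ : μ ∈ (osculating n f x)ᗮ) : projDeriv n (osculating n f) x Y μ = 0 := by
  rw [mem_nullSub_iff_forall hf hinj hp hs] at hY
  have hmem := projDeriv_osculating_mem_nonparallelSpace hf hinj hp x Y hμ
  refine inner_self_eq_zero.1 (inner_eq_zero_of_mem_firstNormal (n := n) (f := f) (x := x)
    (fun X Z => ?_) (nonparallelSpace_le_firstNormal hf hinj hp x hmem))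
  have h2 := codazzi hf hinj hp hs x X Y (vderiv n f x Z) μ
  rw [hY, inner_zero_left, projDeriv_adapted_vderiv hf hinj hp hs] at h2
  have h3 := Submodule.starProjection_inner_eq_zero (K := nonparallelSpace n f x)
    (secondForm n f x X Z) _ hmem
  rw [inner_sub_left, h2, sub_zero] at h3
  exact h3

/-- For w in A the value lies in S, and `codazzi` makes it orthogonal to the generators P'_O(X)μ of
S. -/
theorem projDeriv_adapted_eq_zero (x : M) {Y : Euc n}
    (hY : ∀ μ ∈ (osculating n f x)ᗮ, projDeriv n (osculating n f) x Y μ = 0) :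
    projDeriv n (adapted n f) x Y = 0 := by
  have hA := mdifferentiableAt_projField_adapted hf hinj hp hs x
  refine projDeriv_eq_zero_of_forall hA Y fun w hw => ?_
  have hmem := projDeriv_adapted_mem hf hinj hp hs x Y hw
  have h1 : ∀ v ∈ nonparallelSpace n f x,
      inner ℝ (projDeriv n (adapted n f) x Y w) v = 0 := by
    intro v hv
    rw [nonparallelSpace_eq hf hinj hp] at hv
    induction hv using Submodule.span_induction with
    | mem v hv =>
      obtain ⟨X, μ, hμ, rfl⟩ := hv
      rw [codazzi hf hinj hp hs x Y X w μ, hY μ hμ, inner_zero_right]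
    | zero => simp
    | add a b _ _ ha hb => rw [inner_add_right, ha, hb, add_zero]
    | smul c a _ ha => rw [inner_smul_right, ha, mul_zero]
  exact inner_self_eq_zero.1 (h1 _ hmem)

theorem mem_nullSub_iff (x : M) (Y : Euc n) :
    Y ∈ nullSub n f x ↔ projDeriv n (adapted n f) x Y = 0 := by
  constructor
  · intro h
    exact projDeriv_adapted_eq_zero hf hinj hp hs x fun μ hμ =>
      projDeriv_osculating_of_mem_nullSub hf hinj hp hs x h hμ
  · intro h
    rw [mem_nullSub_iff_forall hf hinj hp hs]
    intro Z
    rw [h]; rfl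

theorem mem_nullSub_iff_osculating (x : M) (Y : Euc n) :
    Y ∈ nullSub n f x ↔ ∀ μ ∈ (osculating n f x)ᗮ, projDeriv n (osculating n f) x Y μ = 0 :=
  ⟨fun h _ hμ => projDeriv_osculating_of_mem_nullSub hf hinj hp hs x h hμ, fun h =>
    (mem_nullSub_iff hf hinj hp hs x Y).2 (projDeriv_adapted_eq_zero hf hinj hp hs x h)⟩

/-- The projections onto the nonparallel spaces are constant along `N(α_S)`. -/
theorem projDeriv_nonparallelSpace_eq_zero (x : M) {Y : Euc n} (hY : Y ∈ nullSub n f x) :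
    projDeriv n (nonparallelSpace n f) x Y = 0 := by
  have hO := mdifferentiableAt_projField_osculating hf hinj hp x
  have h1 : projDeriv n (osculating n f) x Y = 0 :=
    projDeriv_eq_zero_of_forall_orthogonal hO Y
      ((mem_nullSub_iff_osculating hf hinj hp hs x Y).1 hY)
  have h2 := projDeriv_adapted hf hinj hp hs x Y
  rw [(mem_nullSub_iff hf hinj hp hs x Y).1 hY, h1, zero_sub] at h2
  exact neg_eq_zero.1 h2.symm

/-- The dimension estimate for `N(α_S)`. -/
theorem le_finrank_nullSub (hs6 : s ≤ 6) (x : M) :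
    n ≤ finrank ℝ (nullSub n f x) + s := by
  have hO := mdifferentiableAt_projField_osculating hf hinj hp x
  let β : nonparallelSpace n f x →ₗ[ℝ] Euc n →ₗ[ℝ] Euc n →ₗ[ℝ] ℝ :=
    LinearMap.mk₂ ℝ (fun (ξ : nonparallelSpace n f x) (Y : Euc n) =>
      ((innerSL ℝ (ξ : Euc q)).comp (secondForm n f x Y)).toLinearMap)
      (by intros; ext; simp) (by intros; ext; simp)
      (by intros; ext; simp) (by intros; ext; simp)
  have hβ : ∀ ξ Y Z, β ξ Y Z = inner ℝ (ξ : Euc q) (secondForm n f x Y Z) := fun _ _ _ => rfl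
  have hβinj : Function.Injective β := by
    rw [injective_iff_map_eq_zero]
    intro ξ hξ
    refine Subtype.ext (inner_self_eq_zero.1 (inner_eq_zero_of_mem_firstNormal
      (n := n) (f := f) (x := x) (fun X Z => ?_)
      (nonparallelSpace_le_firstNormal hf hinj hp x ξ.2)))
    rw [real_inner_comm, ← hβ, hξ]; rfl
  -- Each normal μ gives the cubic form ⟨P'_O(X)μ, α(Y, Z)⟩. Injectivity of β is S ⊆ N_1 = span of
  -- α, and symmetry of the cubic in X and Y is `codazzi`. The common kernel is N(α_S).
  let φ : ((osculating n f x)ᗮ : Submodule ℝ (Euc q)) →ₗ[ℝ] Euc n →ₗ[ℝ] nonparallelSpace n f x :=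
    LinearMap.mk₂ ℝ (fun (μ : ((osculating n f x)ᗮ : Submodule ℝ (Euc q))) (X : Euc n) =>
      (⟨projDeriv n (osculating n f) x X μ,
        projDeriv_osculating_mem_nonparallelSpace hf hinj hp x X μ.2⟩ : nonparallelSpace n f x))
      (by intros; ext1; simp) (by intros; ext1; simp)
      (by intros; ext1; simp) (by intros; ext1; simp)
  have hφ : ∀ μ X, (φ μ X : Euc q) = projDeriv n (osculating n f) x X μ := fun _ _ => rfl
  have hαS : ∀ (X Z : Euc n) (ξ : nonparallelSpace n f x),
      inner ℝ (ξ : Euc q) (secondForm n f x X Z) =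
      inner ℝ (projDeriv n (adapted n f) x X (vderiv n f x Z)) (ξ : Euc q) := by
    intro X Z ξ
    rw [projDeriv_adapted_vderiv hf hinj hp hs]
    have h3 := Submodule.starProjection_inner_eq_zero (K := nonparallelSpace n f x)
        (secondForm n f x X Z) _ ξ.2
    rw [inner_sub_left] at h3
    rw [real_inner_comm]
    linarith
  have h := finrank_le_of_cubics β hβinj
    (fun ξ Y Z => by rw [hβ, hβ, secondForm_symm hf]) (LinearMap.range φ)
    (by
      rintro _ ⟨μ, rfl⟩ X Y Z
      rw [hβ, hβ, hαS, hαS, hφ, hφ]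
      exact codazzi hf hinj hp hs x Y X _ _)
    (by rw [hs]; exact hs6) (nullSub n f x)
    (by
      intro Y
      rw [mem_nullSub_iff_osculating hf hinj hp hs]
      constructor
      · rintro h _ ⟨μ, rfl⟩
        exact Subtype.ext (h μ μ.2)
      · intro h μ hμ
        exact congrArg Subtype.val (h (φ ⟨μ, hμ⟩) ⟨_, rfl⟩))
  rw [hs, finrank_euclideanSpace_fin] at h
  exact h

end Nonparallel

/-! ### Subspaces given by smooth equations. -/

section Orthogonal

variable {E : Type*} [NormedAddCommGroup E] [InnerProductSpace ℝ E] [FiniteDimensional ℝ E]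

theorem finrank_orthogonal_eq (A : Submodule ℝ E) : finrank ℝ Aᗮ = finrank ℝ E - finrank ℝ A := by
  have := Submodule.finrank_add_finrank_orthogonal A
  omega

theorem eventually_finrank_le_of_orthogonal_span {X ι : Type*} [TopologicalSpace X]
    (v : ι → X → E) {x₀ : X} (hv : ∀ i, ContinuousAt (v i) x₀) (B : X → Submodule ℝ E)
    (hB : ∀ᶠ y in 𝓝 x₀, (B y)ᗮ = Submodule.span ℝ (Set.range fun i => v i y)) :
    ∀ᶠ y in 𝓝 x₀, finrank ℝ (B y) ≤ finrank ℝ (B x₀) := by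
  filter_upwards [hB, eventually_le_finrank_span v hv le_rfl] with y hy h
  rw [← hy, ← hB.self_of_nhds] at h
  have h1 := Submodule.finrank_add_finrank_orthogonal (B y)
  have h2 := Submodule.finrank_add_finrank_orthogonal (B x₀)
  omega

theorem contMDiffAt_starProjection_of_orthogonal_span {n : ℕ} {M : Type*} [TopologicalSpace M]
    [ChartedSpace (Euc n) M] {ι : Type*} (v : ι → M → E) {x₀ : M}
    (hv : ∀ i, ContMDiffAt (𝓡 n) 𝓘(ℝ, E) ∞ (v i) x₀) (B : M → Submodule ℝ E)
    (hB : ∀ᶠ y in 𝓝 x₀, (B y)ᗮ = Submodule.span ℝ (Set.range fun i => v i y))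
    (hc : ∀ᶠ y in 𝓝 x₀, finrank ℝ (B y) = finrank ℝ (B x₀)) :
    ContMDiffAt (𝓡 n) 𝓘(ℝ, E →L[ℝ] E) ∞ (fun y => (B y).starProjection) x₀ := by
  have h := contMDiffAt_starProjection_of_span v hv (fun y => (B y)ᗮ) hB (by
    filter_upwards [hc] with y hy
    rw [finrank_orthogonal_eq, finrank_orthogonal_eq, hy])
  have h2 : (fun y => (B y).starProjection) =
      fun y => ContinuousLinearMap.id ℝ E - (B y)ᗮ.starProjection := by
    funext y
    rw [Submodule.starProjection_orthogonal']
    exact (sub_sub_cancel _ _).symm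
  rw [h2]
  exact contMDiffAt_const.sub h

theorem eq_orthogonal_span_of_forall {ι : Type*} {v : ι → E} {B : Submodule ℝ E}
    (h : ∀ w, w ∈ B ↔ ∀ i, inner ℝ (v i) w = 0) : Bᗮ = Submodule.span ℝ (Set.range v) := by
  have h1 : B = (Submodule.span ℝ (Set.range v))ᗮ := by
    ext w
    rw [h, Submodule.mem_orthogonal]
    constructor
    · intro hw u hu
      induction hu using Submodule.span_induction with
      | mem u hu => obtain ⟨i, rfl⟩ := hu; exact hw i
      | zero => simp
      | add a b _ _ ha hb => rw [inner_add_left, ha, hb, add_zero]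
      | smul c a _ ha => rw [inner_smul_left, ha, mul_zero]
    · exact fun hw i => hw _ (Submodule.subset_span ⟨i, rfl⟩)
  rw [h1, Submodule.orthogonal_orthogonal]

theorem mem_iff_forall_inner_sub_starProjection {B : Submodule ℝ E} {w : E} :
    w ∈ B ↔ ∀ u, inner ℝ (u - B.starProjection u) w = 0 := by
  constructor
  · intro h u
    exact Submodule.starProjection_inner_eq_zero (K := B) u w h
  · intro h
    rw [← Submodule.starProjection_eq_self_iff, ← sub_eq_zero, ← neg_eq_zero, neg_sub,
      ← inner_self_eq_zero (𝕜 := ℝ), inner_sub_right, h w,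
      Submodule.starProjection_inner_eq_zero _ _ (Submodule.starProjection_apply_mem _ _),
      sub_zero]

end Orthogonal

/-! ### The space Λ, its tangential part and generic points. -/

section Parallel

variable {n q : ℕ} {M : Type u} [TopologicalSpace M] [ChartedSpace (Euc n) M]
  [IsManifold (𝓡 n) ∞ M] {f : M → Euc q}

/-- The vectors of the adapted bundle at which its second fundamental form vanishes. -/
def parallelSub (n : ℕ) {q : ℕ} {M : Type u} [TopologicalSpace M] [ChartedSpace (Euc n) M]
    (f : M → Euc q) (x : M) : Submodule ℝ (Euc q) :=
  adapted n f x ⊓ LinearMap.ker (projDeriv n (adapted n f) x).flip.toLinearMap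

/-- The image of `N(α_S)` in the ambient space. -/
def rulingSub (n : ℕ) {q : ℕ} {M : Type u} [TopologicalSpace M] [ChartedSpace (Euc n) M]
    (f : M → Euc q) (x : M) : Submodule ℝ (Euc q) :=
  (nullSub n f x).map (vderiv n f x).toLinearMap

/-- The orthogonal complement of `rulingSub` in `parallelSub`. -/
def rulingCompl (n : ℕ) {q : ℕ} {M : Type u} [TopologicalSpace M] [ChartedSpace (Euc n) M]
    (f : M → Euc q) (x : M) : Submodule ℝ (Euc q) :=
  parallelSub n f x ⊓ (rulingSub n f x)ᗮ

omit [IsManifold (𝓡 n) ∞ M] in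
theorem mem_parallelSub_iff {x : M} {w : Euc q} : w ∈ parallelSub n f x ↔
    w ∈ adapted n f x ∧ ∀ X, projDeriv n (adapted n f) x X w = 0 := by
  refine and_congr_right fun _ => ?_
  exact ContinuousLinearMap.ext_iff (f := (projDeriv n (adapted n f) x).flip w) (g := 0)

/-- A family spanning the orthogonal complement of `parallelSub`. -/
def parallelFamily (n : ℕ) {q : ℕ} {M : Type u} [TopologicalSpace M] [ChartedSpace (Euc n) M]
    (f : M → Euc q) (x₀ : M) : Euc q ⊕ Euc n × Euc q → M → Euc q
  | Sum.inl u => fun y => u - projField (adapted n f) y u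
  | Sum.inr bu => fun y => chartDeriv n x₀ bu.1 (projField (adapted n f)) y bu.2

/-- A family spanning the orthogonal complement of `rulingSub`. -/
def rulingFamily (n : ℕ) {q : ℕ} {M : Type u} [TopologicalSpace M] [ChartedSpace (Euc n) M]
    (f : M → Euc q) (x₀ : M) : (Euc q ⊕ Euc n × Euc q) ⊕ Euc q → M → Euc q
  | Sum.inl i => parallelFamily n f x₀ i
  | Sum.inr u => fun y => u - projField (tangentSub n f) y u

variable (hf : ContMDiff (𝓡 n) 𝓘(ℝ, Euc q) ∞ f)
  (hinj : ∀ x, Function.Injective (vderiv n f x))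

include hinj in
omit [IsManifold (𝓡 n) ∞ M] in
theorem finrank_rulingSub (x : M) : finrank ℝ (rulingSub n f x) = finrank ℝ (nullSub n f x) :=
  (Submodule.equivMapOfInjective (vderiv n f x).toLinearMap (hinj x) _).finrank_eq.symm

variable {p : ℕ} (hp : ∀ x, finrank ℝ (firstNormal n f x) = p)
  {s : ℕ} (hs : ∀ x, finrank ℝ (nonparallelSpace n f x) = s)
include hf hinj hp hs

/-- Both conditions say that the S-part of α(X, Y) vanishes for all X, by symmetry of α. -/
theorem vderiv_mem_parallelSub_iff (x : M) (Y : Euc n) :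
    vderiv n f x Y ∈ parallelSub n f x ↔ Y ∈ nullSub n f x := by
  rw [mem_parallelSub_iff, mem_nullSub_iff_forall hf hinj hp hs]
  refine (and_iff_right (tangentSub_le_adapted hf hinj hp x (vderiv_mem_tangentSub f x Y))).trans ?_
  refine forall_congr' fun Z => ?_
  rw [projDeriv_adapted_vderiv hf hinj hp hs, projDeriv_adapted_vderiv hf hinj hp hs,
    secondForm_symm hf]

theorem rulingSub_eq (x : M) : rulingSub n f x = parallelSub n f x ⊓ tangentSub n f x := by
  ext w
  constructor
  · rintro ⟨Y, hY, rfl⟩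
    exact ⟨(vderiv_mem_parallelSub_iff hf hinj hp hs x Y).2 hY, vderiv_mem_tangentSub f x Y⟩
  · rintro ⟨h, Y, rfl⟩
    exact ⟨Y, (vderiv_mem_parallelSub_iff hf hinj hp hs x Y).1 h, rfl⟩

theorem rulingSub_le (x : M) : rulingSub n f x ≤ parallelSub n f x := by
  rw [rulingSub_eq hf hinj hp hs]; exact inf_le_left

/-- P'_A is self-adjoint, so P'_A(X)w = 0 means that w is orthogonal to all P'_A(X)u. Thus Λ is cut
out by smooth equations, and its dimension is upper semicontinuous. -/
theorem forall_inner_parallelFamily_iff {x y : M} (hy : y ∈ (chartAt (Euc n) x).source)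
    (w : Euc q) :
    (∀ i, inner ℝ (parallelFamily n f x i y) w = 0) ↔ w ∈ parallelSub n f y := by
  have hA := contMDiff_projField_adapted hf hinj hp hs
  have hAy := mdifferentiableAt_projField_adapted hf hinj hp hs y
  rw [mem_parallelSub_iff, Sum.forall, mem_iff_forall_inner_sub_starProjection]
  refine and_congr Iff.rfl ?_
  rw [Prod.forall]
  have hval : ∀ (b : Euc n) (u : Euc q), parallelFamily n f x (Sum.inr (b, u)) y =
      projDeriv n (adapted n f) y (chartFrame n x y b) u := fun b u =>
    congrArg (fun L : Euc q →L[ℝ] Euc q => L u) (chartDeriv_eq_vderiv hy hAy b)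
  constructor
  · intro h X
    obtain ⟨b, rfl⟩ := (chartFrame_bijective hy).2 X
    rw [← inner_self_eq_zero (𝕜 := ℝ), ← inner_projDeriv hAy, ← hval]
    exact h _ _
  · intro h b u
    rw [hval, inner_projDeriv hAy, h, inner_zero_right]

theorem parallelSub_orthogonal {x y : M} (hy : y ∈ (chartAt (Euc n) x).source) :
    (parallelSub n f y)ᗮ =
      Submodule.span ℝ (Set.range fun i => parallelFamily n f x i y) :=
  eq_orthogonal_span_of_forall fun w => (forall_inner_parallelFamily_iff hf hinj hp hs hy w).symm

theorem rulingSub_orthogonal {x y : M} (hy : y ∈ (chartAt (Euc n) x).source) :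
    (rulingSub n f y)ᗮ = Submodule.span ℝ (Set.range fun i => rulingFamily n f x i y) := by
  refine eq_orthogonal_span_of_forall fun w => ?_
  rw [rulingSub_eq hf hinj hp hs, Sum.forall]
  exact and_congr (forall_inner_parallelFamily_iff hf hinj hp hs hy w).symm
    mem_iff_forall_inner_sub_starProjection

theorem contMDiffAt_parallelFamily (x : M) (i : Euc q ⊕ Euc n × Euc q) :
    ContMDiffAt (𝓡 n) 𝓘(ℝ, Euc q) ∞ (parallelFamily n f x i) x := by
  have hA := contMDiff_projField_adapted hf hinj hp hs
  rcases i with u | ⟨b, u⟩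
  · exact contMDiffAt_const.sub (hA.contMDiffAt.clm_apply contMDiffAt_const)
  · exact (contMDiffAt_chartDeriv hA (mem_chart_source _ x) b).clm_apply contMDiffAt_const

theorem contMDiffAt_rulingFamily (x : M) (i : (Euc q ⊕ Euc n × Euc q) ⊕ Euc q) :
    ContMDiffAt (𝓡 n) 𝓘(ℝ, Euc q) ∞ (rulingFamily n f x i) x := by
  rcases i with i | u
  · exact contMDiffAt_parallelFamily hf hinj hp hs x i
  · exact contMDiffAt_const.sub
      ((contMDiff_projField_tangentSub hf hinj).contMDiffAt.clm_apply contMDiffAt_const)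

theorem eventually_finrank_parallelSub_le (x : M) :
    ∀ᶠ y in 𝓝 x, finrank ℝ (parallelSub n f y) ≤ finrank ℝ (parallelSub n f x) :=
  eventually_finrank_le_of_orthogonal_span (parallelFamily n f x)
    (fun i => (contMDiffAt_parallelFamily hf hinj hp hs x i).continuousAt) _
    (Filter.Eventually.mono (mem_chart_source_nhds n x) fun _ hy =>
      parallelSub_orthogonal hf hinj hp hs hy)

theorem eventually_finrank_rulingSub_le (x : M) :
    ∀ᶠ y in 𝓝 x, finrank ℝ (rulingSub n f y) ≤ finrank ℝ (rulingSub n f x) :=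
  eventually_finrank_le_of_orthogonal_span (rulingFamily n f x)
    (fun i => (contMDiffAt_rulingFamily hf hinj hp hs x i).continuousAt) _
    (Filter.Eventually.mono (mem_chart_source_nhds n x) fun _ hy =>
      rulingSub_orthogonal hf hinj hp hs hy)

theorem contMDiffAt_projField_parallelSub {x : M}
    (hc : ∀ᶠ y in 𝓝 x, finrank ℝ (parallelSub n f y) = finrank ℝ (parallelSub n f x)) :
    ContMDiffAt (𝓡 n) 𝓘(ℝ, Euc q →L[ℝ] Euc q) ∞ (projField (parallelSub n f)) x :=
  contMDiffAt_starProjection_of_orthogonal_span (parallelFamily n f x)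
    (contMDiffAt_parallelFamily hf hinj hp hs x) _
    (Filter.Eventually.mono (mem_chart_source_nhds n x) fun _ hy =>
      parallelSub_orthogonal hf hinj hp hs hy) hc

theorem contMDiffAt_projField_rulingSub {x : M}
    (hc : ∀ᶠ y in 𝓝 x, finrank ℝ (rulingSub n f y) = finrank ℝ (rulingSub n f x)) :
    ContMDiffAt (𝓡 n) 𝓘(ℝ, Euc q →L[ℝ] Euc q) ∞ (projField (rulingSub n f)) x :=
  contMDiffAt_starProjection_of_orthogonal_span (rulingFamily n f x)
    (contMDiffAt_rulingFamily hf hinj hp hs x) _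
    (Filter.Eventually.mono (mem_chart_source_nhds n x) fun _ hy =>
      rulingSub_orthogonal hf hinj hp hs hy) hc

theorem contMDiffAt_projField_rulingCompl {x : M}
    (hc : ∀ᶠ y in 𝓝 x, finrank ℝ (parallelSub n f y) = finrank ℝ (parallelSub n f x))
    (hc' : ∀ᶠ y in 𝓝 x, finrank ℝ (rulingSub n f y) = finrank ℝ (rulingSub n f x)) :
    ContMDiffAt (𝓡 n) 𝓘(ℝ, Euc q →L[ℝ] Euc q) ∞ (projField (rulingCompl n f)) x := by
  have h : projField (rulingCompl n f) =
      fun x => projField (parallelSub n f) x - projField (rulingSub n f) x :=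
    funext fun x => starProjection_inf_orthogonal (rulingSub_le hf hinj hp hs x)
  rw [h]
  exact (contMDiffAt_projField_parallelSub hf hinj hp hs hc).sub
    (contMDiffAt_projField_rulingSub hf hinj hp hs hc')

theorem finrank_rulingCompl (x : M) :
    finrank ℝ (rulingSub n f x) + finrank ℝ (rulingCompl n f x) = finrank ℝ (parallelSub n f x) :=
  finrank_inf_orthogonal (rulingSub_le hf hinj hp hs x)

theorem rulingCompl_inf_tangentSub (x : M) : rulingCompl n f x ⊓ tangentSub n f x = ⊥ := by
  rw [eq_bot_iff]
  rintro w ⟨⟨h1, h2⟩, h3⟩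
  have h4 : w ∈ rulingSub n f x := by
    rw [rulingSub_eq hf hinj hp hs]; exact ⟨h1, h3⟩
  exact inner_self_eq_zero.1 (Submodule.inner_right_of_mem_orthogonal h4 h2)

/-- The spaces `parallelSub` are constant along `N(α_S)`. -/
theorem projDeriv_parallelSub_eq_zero {U : Set M} (hU : IsOpen U)
    (hsm : ContMDiffOn (𝓡 n) 𝓘(ℝ, Euc q →L[ℝ] Euc q) ∞ (projField (parallelSub n f)) U)
    {x : M} (hx : x ∈ U) {X : Euc n} (hX : X ∈ nullSub n f x) :
    projDeriv n (parallelSub n f) x X = 0 := by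
  have hA := contMDiff_projField_adapted hf hinj hp hs
  have hAd := mdifferentiableAt_projField_adapted hf hinj hp hs x
  have hB := (hsm.contMDiffAt (hU.mem_nhds hx)).mdifferentiableAt (by simp)
  have hX0 := (mem_nullSub_iff hf hinj hp hs x X).1 hX
  refine projDeriv_eq_zero_of_forall hB X fun w hw => ?_
  -- For a section W of Λ, the derivative W'(X) stays in A because P'_A(X) = 0, and P'_A(Y) W'(X) =
  -- P'_A(X) W'(Y) = 0. So W'(X) is again in Λ.
  let W : M → Euc q := fun y => projField (parallelSub n f) y w
  have hWmem : ∀ y, W y ∈ parallelSub n f y := fun y => Submodule.starProjection_apply_mem _ _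
  have hW : ContMDiffOn (𝓡 n) 𝓘(ℝ, Euc q) ∞ W U := hsm.clm_apply contMDiffOn_const
  have hWd : vderiv n W x X = projDeriv n (parallelSub n f) x X w := vderiv_projField_apply hB w X
  have hmem : projDeriv n (parallelSub n f) x X w ∈ parallelSub n f x := by
    rw [← hWd, mem_parallelSub_iff]
    constructor
    · have h1 := vderiv_of_section hAd
        ((hW.contMDiffAt (hU.mem_nhds hx)).mdifferentiableAt (by simp))
        (Eventually.of_forall fun y => (hWmem y).1) X
      rw [hX0, zero_apply, zero_add] at h1
      exact Submodule.starProjection_eq_self_iff.1 h1.symm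
    · intro Y
      have h2 := vderiv_vderiv_symm hU hx hA.contMDiffOn hW
        (fun y _ Y => (mem_parallelSub_iff.1 (hWmem y)).2 Y) X Y
      have h3 : vderiv n (projField (adapted n f)) x X = 0 := hX0
      rw [h3, zero_apply] at h2
      exact h2
  exact inner_self_eq_zero.1
    (Submodule.inner_right_of_mem_orthogonal hmem (projDeriv_mem_orthogonal hB X hw))

/-- Λ + T ⊆ A and Λ ∩ T = f_*N, with dim A = n + p − s. In terms of the strata this is s ≤ k. -/
theorem finrank_parallelSub_add_le (x : M) :
    finrank ℝ (parallelSub n f x) + s ≤ finrank ℝ (rulingSub n f x) + p := by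
  have h1 := Submodule.finrank_sup_add_finrank_inf_eq (parallelSub n f x) (tangentSub n f x)
  have h2 : finrank ℝ (parallelSub n f x ⊔ tangentSub n f x : Submodule ℝ (Euc q)) ≤
      finrank ℝ (adapted n f x) :=
    Submodule.finrank_mono (sup_le inf_le_left (tangentSub_le_adapted hf hinj hp x))
  have h3 := finrank_adapted hf hinj hp hs x
  rw [← rulingSub_eq hf hinj hp hs, finrank_tangentSub hinj] at h1
  omega

/-- Λ is the kernel of the map from A to Hom(K, S) given by P'_A, where K is a complement of N(α_S);
directions in N(α_S) impose no condition. -/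
theorem le_finrank_parallelSub (x : M) :
    n + p ≤ finrank ℝ (parallelSub n f x) + s + s * (n - finrank ℝ (nullSub n f x)) := by
  obtain ⟨K, hK⟩ := (nullSub n f x).exists_isCompl
  have hKd : finrank ℝ K = n - finrank ℝ (nullSub n f x) := by
    have := Submodule.finrank_add_eq_of_isCompl hK
    rw [finrank_euclideanSpace_fin] at this
    omega
  let Φ : adapted n f x →ₗ[ℝ] K →ₗ[ℝ] nonparallelSpace n f x :=
    LinearMap.mk₂ ℝ (fun (w : adapted n f x) (X : K) =>
      (⟨projDeriv n (adapted n f) x X w, projDeriv_adapted_mem hf hinj hp hs x X w.2⟩ :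
        nonparallelSpace n f x))
      (by intros; ext1; simp) (by intros; ext1; simp)
      (by intros; ext1; simp) (by intros; ext1; simp)
  have h1 := LinearMap.finrank_range_add_finrank_ker Φ
  have h2 : finrank ℝ (LinearMap.range Φ) ≤ finrank ℝ K * s := by
    refine (Submodule.finrank_le _).trans ?_
    rw [finrank_linearMap, hs]
  have h3 : finrank ℝ (LinearMap.ker Φ) ≤ finrank ℝ (parallelSub n f x) := by
    rw [← Submodule.finrank_map_subtype_eq]
    refine Submodule.finrank_mono ?_
    rintro _ ⟨w, hw, rfl⟩
    rw [mem_parallelSub_iff]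
    refine ⟨w.2, fun X => ?_⟩
    obtain ⟨a, ha, b, hb, rfl⟩ := Submodule.mem_sup.1
      (hK.sup_eq_top ▸ Submodule.mem_top : X ∈ nullSub n f x ⊔ K)
    have h4 := congrArg (fun φ : K →ₗ[ℝ] nonparallelSpace n f x => (φ ⟨b, hb⟩ : Euc q)) hw
    rw [map_add, add_apply, (mem_nullSub_iff hf hinj hp hs x a).1 ha, zero_apply, zero_add]
    exact h4
  have h5 := finrank_adapted hf hinj hp hs x
  rw [← hKd, mul_comm s]
  omega

/-- At a minimum over V of the sum of the two dimensions, upper semicontinuity forces both to be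
locally constant. -/
theorem exists_generic_point {V : Set M} (hV : IsOpen V) (hne : V.Nonempty) :
    ∃ x ∈ V, (∀ᶠ y in 𝓝 x, finrank ℝ (parallelSub n f y) = finrank ℝ (parallelSub n f x)) ∧
      ∀ᶠ y in 𝓝 x, finrank ℝ (rulingSub n f y) = finrank ℝ (rulingSub n f x) := by
  let h : M → ℕ := fun x => finrank ℝ (parallelSub n f x) + finrank ℝ (rulingSub n f x)
  obtain ⟨x, hx, hmin⟩ := exists_minimalFor_of_wellFoundedLT (· ∈ V) h hne
  have key : ∀ᶠ y in 𝓝 x, finrank ℝ (parallelSub n f y) = finrank ℝ (parallelSub n f x) ∧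
      finrank ℝ (rulingSub n f y) = finrank ℝ (rulingSub n f x) := by
    filter_upwards [hV.mem_nhds hx, eventually_finrank_parallelSub_le hf hinj hp hs x,
      eventually_finrank_rulingSub_le hf hinj hp hs x] with y hy h1 h2
    have h3 : h x ≤ h y := by
      rcases le_total (h x) (h y) with h3 | h3
      · exact h3
      · exact hmin hy h3
    simp only [h] at h3
    omega
  exact ⟨x, hx, key.mono fun _ h => h.1, key.mono fun _ h => h.2⟩

end Parallel

/-! ### Local inverses of smooth maps on a manifold. -/

section LocalInverse

variable {n : ℕ} {M : Type u} [TopologicalSpace M] [ChartedSpace (Euc n) M]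
  [IsManifold (𝓡 n) ∞ M]

/-- The inverse function theorem on a manifold. -/
theorem exists_local_inverse {E : Type*} [NormedAddCommGroup E] [NormedSpace ℝ E]
    [FiniteDimensional ℝ E] {θ : M → E} {W : Set M} (hW : IsOpen W) {x : M} (hx : x ∈ W)
    (hθ : ContMDiffOn (𝓡 n) 𝓘(ℝ, E) ∞ θ W) (hb : Function.Bijective (vderiv n θ x)) :
    ∃ (r : ℝ) (c : E → M), 0 < r ∧ c (θ x) = x ∧
      ContMDiffOn 𝓘(ℝ, E) (𝓡 n) ∞ c (Metric.ball (θ x) r) ∧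
      ∀ v ∈ Metric.ball (θ x) r, c v ∈ W ∧ θ (c v) = v := by
  set z := extChartAt (𝓡 n) x x with hz
  set g : Euc n → E := θ ∘ (extChartAt (𝓡 n) x).symm with hg
  set S := (extChartAt (𝓡 n) x).target ∩ (extChartAt (𝓡 n) x).symm ⁻¹' W with hS
  have hSo : IsOpen S := isOpen_target_inter_preimage hW
  have hzS : z ∈ S := by
    refine ⟨mem_extChartAt_target x, ?_⟩
    rw [Set.mem_preimage, extChartAt_to_inv]; exact hx
  have hgS : ContDiffOn ℝ ∞ g S := contDiffOn_comp_extChartAt_symm hθ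
  have hgz : ContDiffAt ℝ ∞ g z := hgS.contDiffAt (hSo.mem_nhds hzS)
  have hgx : g z = θ x := by simp [hg, hz]
  have hd : fderiv ℝ g z = vderiv n θ x :=
    (vderiv_eq_fderiv ((hθ.contMDiffAt (hW.mem_nhds hx)).mdifferentiableAt (by simp))).symm
  let e : Euc n ≃L[ℝ] E :=
    (LinearEquiv.ofBijective (vderiv n θ x).toLinearMap hb).toContinuousLinearEquiv
  have he : (e : Euc n →L[ℝ] E) = fderiv ℝ g z := by rw [hd]; ext; rfl
  have hder : HasFDerivAt g (e : Euc n →L[ℝ] E) z := by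
    rw [he]; exact (hgz.differentiableAt (by simp)).hasFDerivAt
  let H := hgz.toOpenPartialHomeomorph g hder (by simp)
  have hHg : ∀ y, H y = g y := fun y => rfl
  have hzH : z ∈ H.source := hgz.mem_toOpenPartialHomeomorph_source hder (by simp)
  -- The inverse is to be smooth on a whole ball, so the derivative has to be invertible at all
  -- nearby points.
  have hinv : ∀ᶠ y in 𝓝 z, fderiv ℝ g y ∈ Set.range ((↑) : (Euc n ≃L[ℝ] E) → Euc n →L[ℝ] E) := by
    have hc : ContinuousAt (fderiv ℝ g) z :=
      (hgS.continuousOn_fderiv_of_isOpen hSo (by simp)).continuousAt (hSo.mem_nhds hzS)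
    refine hc.eventually_mem ?_
    rw [← he]
    exact ContinuousLinearEquiv.nhds e
  have hHz : H.symm (θ x) = z := by
    rw [← hgx]; exact H.left_inv hzH
  have hxt : θ x ∈ H.target := by rw [← hgx]; exact H.map_source hzH
  have hev : ∀ᶠ v in 𝓝 (θ x), v ∈ H.target ∧ H.symm v ∈ S ∧
      fderiv ℝ g (H.symm v) ∈ Set.range ((↑) : (Euc n ≃L[ℝ] E) → Euc n →L[ℝ] E) := by
    have hcs : ContinuousAt H.symm (θ x) := H.symm.continuousAt hxt
    have hts : ∀ᶠ v in 𝓝 (θ x), v ∈ H.target := H.open_target.mem_nhds hxt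
    refine hts.and ((hcs.eventually_mem (s := S) ?_).and ?_)
    · rw [hHz]; exact hSo.mem_nhds hzS
    · refine Filter.Tendsto.eventually (p := fun y => fderiv ℝ g y ∈
        Set.range ((↑) : (Euc n ≃L[ℝ] E) → Euc n →L[ℝ] E)) hcs ?_
      rw [hHz]; exact hinv
  obtain ⟨r, hr, hball⟩ := Metric.eventually_nhds_iff_ball.1 hev
  refine ⟨r, (extChartAt (𝓡 n) x).symm ∘ H.symm, hr, ?_, ?_, ?_⟩
  · rw [Function.comp_apply, hHz, hz, extChartAt_to_inv]
  · have h1 : ContDiffOn ℝ ∞ H.symm (Metric.ball (θ x) r) := by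
      intro v hv
      obtain ⟨hvt, hvS, e', he'⟩ := hball v hv
      have hgv : ContDiffAt ℝ ∞ g (H.symm v) := hgS.contDiffAt (hSo.mem_nhds hvS)
      refine (H.contDiffAt_symm (f₀' := e') hvt ?_ hgv).contDiffWithinAt
      rw [he']
      exact (hgv.differentiableAt (by simp)).hasFDerivAt
    exact (contMDiffOn_extChartAt_symm x).comp (contMDiffOn_iff_contDiffOn.2 h1)
      fun v hv => (hball v hv).2.1.1
  · intro v hv
    obtain ⟨hvt, hvS, -⟩ := hball v hv
    exact ⟨hvS.2, (hHg _).symm.trans (H.right_inv hvt)⟩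

end LocalInverse

/-! ### Smooth frames of a distribution given by its image in ℝ^q. -/

section Ruled

variable {m q : ℕ} {N : Type u} [TopologicalSpace N] [ChartedSpace (Euc m) N]
  [IsManifold (𝓡 m) ∞ N] {F : N → Euc q}

theorem exists_left_inverse_clm {E G : Type*} [NormedAddCommGroup E] [NormedSpace ℝ E]
    [FiniteDimensional ℝ E] [NormedAddCommGroup G] [NormedSpace ℝ G] [FiniteDimensional ℝ G]
    (A : E →L[ℝ] G) (hA : Function.Injective A) : ∃ R : G →L[ℝ] E, ∀ v, R (A v) = v := by
  obtain ⟨R, hR⟩ := LinearMap.exists_leftInverse_of_injective A.toLinearMap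
    (LinearMap.ker_eq_bot.2 hA)
  exact ⟨R.toContinuousLinearMap, fun v => congrArg (fun L : E →ₗ[ℝ] E => L v) hR⟩

theorem exists_linearIndependent_mem {E : Type*} [AddCommGroup E] [Module ℝ E]
    [FiniteDimensional ℝ E] (A : Submodule ℝ E) :
    ∃ w : Fin (finrank ℝ A) → E, (∀ j, w j ∈ A) ∧ LinearIndependent ℝ w :=
  ⟨fun j => finBasis ℝ A j, fun j => (finBasis ℝ A j).2,
    (finBasis ℝ A).linearIndependent.map' A.subtype (Submodule.ker_subtype _)⟩

/-- The preimages of the spaces `Λ y` under the differential of `F`. -/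
def comapSub (m : ℕ) {q : ℕ} {N : Type u} [TopologicalSpace N] [ChartedSpace (Euc m) N]
    (F : N → Euc q) (Λ : N → Submodule ℝ (Euc q)) (y : N) : Submodule ℝ (Euc m) :=
  (Λ y).comap (vderiv m F y).toLinearMap

omit [IsManifold (𝓡 m) ∞ N] in
theorem mem_comapSub {Λ : N → Submodule ℝ (Euc q)} {y : N} {ξ : Euc m} :
    ξ ∈ comapSub m F Λ y ↔ vderiv m F y ξ ∈ Λ y := Iff.rfl

omit [IsManifold (𝓡 m) ∞ N] in
theorem map_comapSub {Λ : N → Submodule ℝ (Euc q)} {y : N} (h : Λ y ≤ tangentSub m F y) :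
    (comapSub m F Λ y).map (vderiv m F y).toLinearMap = Λ y :=
  Submodule.map_comap_eq_of_le h

theorem contMDiffOn_chartFrame_section {x : N} {W : Set N} (hWo : IsOpen W)
    (hWs : W ⊆ (chartAt (Euc m) x).source) {a : N → Euc m}
    (ha : ContMDiffOn (𝓡 m) 𝓘(ℝ, Euc m) ∞ a W) :
    ContMDiffOn (𝓡 m) (𝓡 m).tangent ∞
      (fun y => (⟨y, chartFrame m x y (a y)⟩ : TangentBundle (𝓡 m) N)) W := by
  have : IsManifold (𝓡 m) 1 N := IsManifold.of_le (n := ∞) (by exact_mod_cast le_top)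
  have hsub : W ⊆ (trivializationAt (Euc m) (TangentSpace (𝓡 m) (M := N)) x).baseSet := by
    intro y hy
    rw [TangentBundle.trivializationAt_baseSet]
    exact hWs hy
  refine ((trivializationAt (Euc m) (TangentSpace (𝓡 m)) x).contMDiffOn_section_iff
    hWo hsub).2 ?_
  refine ha.congr fun y hy => ?_
  have h3 : chartFrame m x y (a y) =
      (trivializationAt (Euc m) (TangentSpace (𝓡 m)) x).symmL ℝ y (a y) := by
    rw [TangentBundle.symmL_trivializationAt (hWs hy),
      ModelWithCorners.Boundaryless.range_eq_univ, mfderivWithin_univ]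
    rfl
  have h4 := (trivializationAt (Euc m) (TangentSpace (𝓡 m)) x).continuousLinearMapAt_symmL
    (R := ℝ) (hsub hy) (a y)
  rw [Trivialization.continuousLinearMapAt_apply,
    Trivialization.coe_linearMapAt_of_mem _ (hsub hy)] at h4
  rw [h3]
  exact h4

variable (hF : ContMDiff (𝓡 m) 𝓘(ℝ, Euc q) ∞ F)
  (hinj : ∀ y, Function.Injective (vderiv m F y))

include hinj in
omit [IsManifold (𝓡 m) ∞ N] in
theorem finrank_comapSub {Λ : N → Submodule ℝ (Euc q)} {y : N} (h : Λ y ≤ tangentSub m F y) :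
    finrank ℝ (comapSub m F Λ y) = finrank ℝ (Λ y) := by
  rw [← map_comapSub h]
  exact (Submodule.equivMapOfInjective (vderiv m F y).toLinearMap (hinj y) _).finrank_eq

variable {Λ : N → Submodule ℝ (Euc q)} {U : Set N} (hU : IsOpen U)
  (hΛ : ContMDiffOn (𝓡 m) 𝓘(ℝ, Euc q →L[ℝ] Euc q) ∞ (projField Λ) U)
  (hle : ∀ y ∈ U, Λ y ≤ tangentSub m F y)
  (hdim : ∀ x ∈ U, ∀ᶠ y in 𝓝 x, finrank ℝ (Λ y) = finrank ℝ (Λ x))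
include hF hinj hU hΛ hle hdim

theorem isSmoothDistributionOn_comapSub [IsManifold (𝓡 m) 1 N] :
    IsSmoothDistributionOn (comapSub m F Λ) U := by
  intro x hx
  obtain ⟨R, hR⟩ := exists_left_inverse_clm (vderiv m F x) (hinj x)
  obtain ⟨w, hwΛ, hwli⟩ := exists_linearIndependent_mem (Λ x)
  -- The differential of F in the fixed chart followed by R. It is the identity at x, hence
  -- invertible nearby, and its inverse lifts the vectors P_Λ(w j), which lie in the image of F_*,
  -- to a smooth frame.
  let K : N → Euc m →L[ℝ] Euc m := fun y => R.comp
    (fderiv ℝ (F ∘ (extChartAt (𝓡 m) x).symm) (extChartAt (𝓡 m) x y))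
  have hKa : ∀ y b, K y b = R (chartDeriv m x b F y) := fun _ _ => rfl
  have hKx : K x = ContinuousLinearEquiv.refl ℝ (Euc m) := by
    ext1 b
    rw [hKa, chartDeriv_self (hF.mdifferentiableAt (by simp)), hR]
    rfl
  have hKsm : ContMDiffOn (𝓡 m) 𝓘(ℝ, Euc m →L[ℝ] Euc m) ∞ K (chartAt (Euc m) x).source := by
    have h1 := (contDiffOn_comp_extChartAt_symm (x₀ := x) hF.contMDiffOn).fderiv_of_isOpen
      (isOpen_target_inter_preimage isOpen_univ) (m := ∞) (by simp)
    have h2 := (contMDiffOn_iff_contDiffOn.2 h1).comp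
      (contMDiffOn_extChartAt (I := 𝓡 m) (x := x)) (fun y hy =>
        ⟨(extChartAt (𝓡 m) x).map_source (by rwa [extChartAt_source]), trivial⟩)
    exact (contMDiffOn_const (c := R)).clm_comp h2
  have hsrc : (chartAt (Euc m) x).source ∈ 𝓝 x := mem_chart_source_nhds m x
  have hev : ∀ᶠ y in 𝓝 x, y ∈ U ∧ y ∈ (chartAt (Euc m) x).source ∧
      K y ∈ Set.range ((↑) : (Euc m ≃L[ℝ] Euc m) → Euc m →L[ℝ] Euc m) ∧
      LinearIndependent ℝ (fun j => projField Λ y (w j)) ∧ finrank ℝ (Λ y) = finrank ℝ (Λ x) := by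
    have hUx : ∀ᶠ y in 𝓝 x, y ∈ U := hU.mem_nhds hx
    have hsx : ∀ᶠ y in 𝓝 x, y ∈ (chartAt (Euc m) x).source := hsrc
    refine hUx.and (hsx.and (Eventually.and ?_ (Eventually.and ?_ (hdim x hx))))
    · refine (hKsm.continuousOn.continuousAt hsrc).eventually_mem ?_
      rw [hKx]
      exact ContinuousLinearEquiv.nhds _
    · have hc : ContinuousAt (fun y j => projField Λ y (w j)) x :=
        continuousAt_pi.2 fun j => ((hΛ.continuousOn.continuousAt (hU.mem_nhds hx)).clm_apply
          continuousAt_const)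
      refine hc.eventually_mem (isOpen_setOfPred_linearIndependent.mem_nhds ?_)
      have : (fun j => projField Λ x (w j)) = w :=
        funext fun j => Submodule.starProjection_eq_self_iff.2 (hwΛ j)
      change LinearIndependent ℝ fun j => projField Λ x (w j)
      rw [this]; exact hwli
  obtain ⟨W, hWev, hWo, hxW⟩ := eventually_nhds_iff.1 hev
  let a : Fin (finrank ℝ (Λ x)) → N → Euc m := fun j y => (K y).inverse (R (projField Λ y (w j)))
  let X : Fin (finrank ℝ (Λ x)) → ∀ y : N, TangentSpace (𝓡 m) y := fun j y => chartFrame m x y (a j y)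
  have hdX : ∀ j, ∀ y ∈ W, vderiv m F y (X j y) = projField Λ y (w j) := by
    intro j y hy
    obtain ⟨hyU, hys, ⟨e, he⟩, -, -⟩ := hWev y hy
    obtain ⟨ξ, hξ⟩ := hle y hyU (Submodule.starProjection_apply_mem (Λ y) (w j))
    obtain ⟨b, rfl⟩ := (chartFrame_bijective hys).2 ξ
    have h1 : chartDeriv m x b F y = projField Λ y (w j) := by
      rw [chartDeriv_eq_vderiv hys (hF.mdifferentiableAt (by simp))]; exact hξ
    have h2 : a j y = b := by
      change (K y).inverse (R (projField Λ y (w j))) = b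
      rw [← h1, ← hKa, ← he, ContinuousLinearMap.inverse_equiv]
      exact e.symm_apply_apply b
    change vderiv m F y (chartFrame m x y (a j y)) = _
    rw [h2]; exact hξ
  refine ⟨W, _, X, hWo, hxW, fun j => ?_, fun y hy => ?_⟩
  · refine contMDiffOn_chartFrame_section hWo (fun y hy => (hWev y hy).2.1) ?_
    intro y hy
    obtain ⟨hyU, hys, ⟨e, he⟩, -, -⟩ := hWev y hy
    have hK : ContMDiffAt (𝓡 m) 𝓘(ℝ, Euc m →L[ℝ] Euc m) ∞ K y :=
      hKsm.contMDiffAt ((chartAt (Euc m) x).open_source.mem_nhds hys)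
    have hi : ContDiffAt ℝ ∞ ContinuousLinearMap.inverse (K y) := by
      rw [← he]; exact contDiffAt_map_inverse e
    refine ContMDiffAt.contMDiffWithinAt ?_
    exact (hi.contMDiffAt.comp y hK).clm_apply (contMDiffAt_const.clm_apply
      ((hΛ.contMDiffAt (hU.mem_nhds hyU)).clm_apply contMDiffAt_const))
  · obtain ⟨hyU, hys, -, hli, hfr⟩ := hWev y hy
    let xs : Fin (finrank ℝ (Λ x)) → Euc m := fun j => chartFrame m x y (a j y)
    have hX : LinearIndependent ℝ xs := by
      refine LinearIndependent.of_comp (vderiv m F y).toLinearMap ?_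
      have : (vderiv m F y).toLinearMap ∘ xs = fun j => projField Λ y (w j) :=
        funext fun j => hdX j y hy
      rw [this]; exact hli
    have hspan : Submodule.span ℝ (Set.range xs) = comapSub m F Λ y := by
      refine Submodule.eq_of_le_of_finrank_eq ?_ ?_
      · rw [Submodule.span_le]
        rintro _ ⟨j, rfl⟩
        change vderiv m F y (X j y) ∈ Λ y
        rw [hdX j y hy]
        exact Submodule.starProjection_apply_mem _ _
      · rw [finrank_span_eq_card hX, Fintype.card_fin, finrank_comapSub hinj (hle y hyU), hfr]
    exact ⟨hX, hspan⟩

end Ruled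

theorem vderiv_euclidean {d : ℕ} {E : Type*} [NormedAddCommGroup E] [NormedSpace ℝ E]
    (g : Euc d → E) (v : Euc d) : vderiv d g v = fderiv ℝ g v := mfderiv_eq_fderiv

theorem exists_clm_range_eq {E : Type*} [NormedAddCommGroup E] [NormedSpace ℝ E]
    [FiniteDimensional ℝ E] (A : Submodule ℝ E) : ∃ j : Euc (finrank ℝ A) →L[ℝ] E,
      Function.Injective j ∧ ∀ u, u ∈ A ↔ ∃ v, j v = u := by
  have e : Euc (finrank ℝ A) ≃ₗ[ℝ] A := LinearEquiv.ofFinrankEq _ _ finrank_euclideanSpace_fin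
  refine ⟨(A.subtype ∘ₗ e.toLinearMap).toContinuousLinearMap,
    A.injective_subtype.comp e.injective, fun u => ⟨fun hu => ⟨e.symm ⟨u, hu⟩, ?_⟩, ?_⟩⟩
  · change ((e (e.symm ⟨u, hu⟩) : A) : E) = u
    rw [e.apply_symm_apply]
  · rintro ⟨v, rfl⟩
    exact (e v).2

/-! ### Leaves of a tangent field of subspaces that is constant along itself. -/

section Leaves

variable {m q : ℕ} {N : Type u} [TopologicalSpace N] [ChartedSpace (Euc m) N]
  {F : N → Euc q}

theorem eq_of_vderiv_eq_zero_on {E : Type*} [NormedAddCommGroup E] [NormedSpace ℝ E]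
    {d : ℕ} {O : Set (Euc d)} (hO : IsOpen O) (hc : Convex ℝ O) {g : Euc d → E}
    (hg : ContMDiffOn (𝓡 d) 𝓘(ℝ, E) ∞ g O) (h : ∀ v ∈ O, ∀ w, vderiv d g v w = 0)
    {v v' : Euc d} (hv : v ∈ O) (hv' : v' ∈ O) : g v = g v' := by
  refine hO.is_const_of_fderiv_eq_zero (𝕜 := ℝ) hc.isPreconnected
    ((contMDiffOn_iff_contDiffOn.1 hg).differentiableOn (by simp)) (fun v hv => ?_) hv hv'
  ext1 w
  rw [← vderiv_euclidean]
  exact h v hv w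

variable [IsManifold (𝓡 m) ∞ N] (hF : ContMDiff (𝓡 m) 𝓘(ℝ, Euc q) ∞ F)
  (hinj : ∀ y, Function.Injective (vderiv m F y))
  {Λ : N → Submodule ℝ (Euc q)} {U : Set N} (hU : IsOpen U)
  (hΛ : ContMDiffOn (𝓡 m) 𝓘(ℝ, Euc q →L[ℝ] Euc q) ∞ (projField Λ) U)
  (hle : ∀ y ∈ U, Λ y ≤ tangentSub m F y)
  (hdim : ∀ x ∈ U, ∀ᶠ y in 𝓝 x, finrank ℝ (Λ y) = finrank ℝ (Λ x))
  (hpar : ∀ y ∈ U, ∀ ξ, vderiv m F y ξ ∈ Λ y → projDeriv m Λ y ξ = 0)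
include hF hinj hU hΛ hle hdim hpar

/-- No integrability theorem is used: an explicit chart θ at x sends every space of the distribution
D = F_*⁻¹Λ to the single space D(x), so the leaf through x is the preimage of a linear slice. Along
it Λ is constant, hence F is affine there in the slice parameter. -/
theorem exists_leaf {x : N} (hx : x ∈ U) :
    ∃ (O : Set (Euc (finrank ℝ (comapSub m F Λ x)))) (γ : Euc (finrank ℝ (comapSub m F Λ x)) → N)
      (A : AffineSubspace ℝ (Euc q)) (V : Set (Euc q)),
      IsOpen O ∧ IsConnected O ∧ x ∈ γ '' O ∧ γ '' O ⊆ U ∧ Set.InjOn γ O ∧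
      ContMDiffOn (𝓡 (finrank ℝ (comapSub m F Λ x))) (𝓡 m) ∞ γ O ∧
      (∀ v ∈ O,
        Function.Injective (mfderiv (𝓡 (finrank ℝ (comapSub m F Λ x))) (𝓡 m) γ v) ∧
        LinearMap.range
          (mfderiv (𝓡 (finrank ℝ (comapSub m F Λ x))) (𝓡 m) γ v).toLinearMap =
            comapSub m F Λ (γ v)) ∧
      finrank ℝ A.direction = finrank ℝ (comapSub m F Λ x) ∧
      IsOpen V ∧ F '' (γ '' O) = V ∩ (A : Set (Euc q)) := by
  obtain ⟨R, hR⟩ := exists_left_inverse_clm (vderiv m F x) (hinj x)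
  obtain ⟨j, hjinj, hj⟩ := exists_clm_range_eq (comapSub m F Λ x)
  generalize hd : finrank ℝ (comapSub m F Λ x) = d at j hjinj hj ⊢
  obtain ⟨W, hWev, hWo, hxW⟩ := eventually_nhds_iff.1
    ((hdim x hx).and (show ∀ᶠ y in 𝓝 x, y ∈ U from hU.mem_nhds hx))
  set P₀ := projField Λ x with hP₀
  let B : Euc q →L[ℝ] Euc q := ContinuousLinearMap.id ℝ _ - P₀
  have hB : ∀ u, B u = u - P₀ u := fun _ => rfl
  -- With P₀ = P_Λ(x), the derivative at x is R F_* = id since (1 − P₀)P₀ = 0. At a nearby y and for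
  -- ξ in D(y) the term with P'_Λ vanishes and P_Λ F_*ξ = F_*ξ, so the derivative is R P₀ F_*ξ,
  -- which lies in D(x).
  let θ : N → Euc m := fun y => R (F y - F x - B (projField Λ y (F y - F x)))
  have hΛd : ∀ y ∈ U, MDifferentiableAt (𝓡 m) 𝓘(ℝ, Euc q →L[ℝ] Euc q) (projField Λ) y :=
    fun y hy => (hΛ.contMDiffAt (hU.mem_nhds hy)).mdifferentiableAt (by simp)
  have hFd : ∀ y, MDifferentiableAt (𝓡 m) 𝓘(ℝ, Euc q) F y := fun y =>
    hF.mdifferentiableAt (by simp)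
  have hθsm : ContMDiffOn (𝓡 m) 𝓘(ℝ, Euc m) ∞ θ W := by
    have h1 : ContMDiffOn (𝓡 m) 𝓘(ℝ, Euc q) ∞ (fun y => F y - F x) W :=
      hF.contMDiffOn.sub contMDiffOn_const
    have h2 := (hΛ.mono fun y hy => (hWev y hy).2).clm_apply h1
    exact contMDiffOn_const.clm_apply (h1.sub (contMDiffOn_const.clm_apply h2))
  have hθd : ∀ y ∈ U, ∀ ξ, vderiv m θ y ξ = R (vderiv m F y ξ -
      B (projDeriv m Λ y ξ (F y - F x) + projField Λ y (vderiv m F y ξ))) := by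
    intro y hy ξ
    have h0 : MDifferentiableAt (𝓡 m) 𝓘(ℝ, Euc q) (fun y => F y - F x) y :=
      (hFd y).sub mdifferentiableAt_const
    have h0' : vderiv m (fun y => F y - F x) y ξ = vderiv m F y ξ := by
      rw [vderiv_sub (hFd y) mdifferentiableAt_const, vderiv_const, sub_zero]
    have h1 := (hΛd y hy).clm_apply h0
    have h2 : MDifferentiableAt (𝓡 m) 𝓘(ℝ, Euc q)
        (fun y => B (projField Λ y (F y - F x))) y := mdifferentiableAt_const.clm_apply h1
    have h3 := vderiv_const_clm_apply R (h0.sub h2) ξ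
    refine h3.trans ?_
    have h4 := congrArg (fun L : Euc m →L[ℝ] Euc q => L ξ) (vderiv_sub h0 h2)
    refine (congrArg R h4).trans ?_
    rw [sub_apply, h0', vderiv_const_clm_apply B h1, vderiv_clm_apply (hΛd y hy) h0, h0']
    rfl
  have hθx : θ x = 0 := by simp [θ]
  have hθdx : ∀ ξ, vderiv m θ x ξ = ξ := by
    intro ξ
    rw [hθd x hx, sub_self, map_zero, zero_add, hB, hP₀,
      Submodule.starProjection_eq_self_iff.2 (Submodule.starProjection_apply_mem _ _), sub_self,
      sub_zero, hR]
  have hθD : ∀ y ∈ U, ∀ ξ ∈ comapSub m F Λ y, vderiv m θ y ξ = R (P₀ (vderiv m F y ξ)) := by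
    intro y hy ξ hξ
    rw [hθd y hy, hpar y hy ξ hξ, zero_apply, zero_add,
      Submodule.starProjection_eq_self_iff.2 (mem_comapSub.1 hξ), hB, sub_sub_cancel]
  have hRΛ : ∀ u ∈ Λ x, R u ∈ comapSub m F Λ x ∧ vderiv m F x (R u) = u := by
    intro u hu
    obtain ⟨ζ, rfl⟩ := hle x hx hu
    have hR' : R ((vderiv m F x).toLinearMap ζ) = ζ := hR ζ
    rw [hR']
    exact ⟨hu, rfl⟩
  obtain ⟨r, c, hr, hcx, hcsm, hcb⟩ := exists_local_inverse hWo hxW hθsm (by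
    have : ⇑(vderiv m θ x) = id := funext hθdx
    rw [this]; exact Function.bijective_id)
  rw [hθx] at hcx hcsm hcb
  -- The leaf is parametrized by the inverse of θ on the slice D(x), with linear coordinates j.
  let O : Set (Euc d) := j ⁻¹' Metric.ball 0 r
  let γ : Euc d → N := fun v => c (j v)
  have hOo : IsOpen O := Metric.isOpen_ball.preimage j.continuous
  have hOc : Convex ℝ O := (convex_ball _ _).linear_preimage j.toLinearMap
  have hO0 : (0 : Euc d) ∈ O := by simp [O, hr]
  have hγ0 : γ 0 = x := by simp [γ, hcx]
  have hγsm : ContMDiffOn (𝓡 d) (𝓡 m) ∞ γ O :=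
    hcsm.comp j.contMDiff.contMDiffOn fun v hv => hv
  have hγd : ∀ v ∈ O, MDifferentiableAt (𝓡 d) (𝓡 m) γ v := fun v hv =>
    (hγsm.contMDiffAt (hOo.mem_nhds hv)).mdifferentiableAt (by simp)
  have hγW : ∀ v ∈ O, γ v ∈ W := fun v hv => (hcb _ hv).1
  have hγU : ∀ v ∈ O, γ v ∈ U := fun v hv => (hWev _ (hγW v hv)).2
  have hθdiff : ∀ y ∈ W, MDifferentiableAt (𝓡 m) 𝓘(ℝ, Euc m) θ y := fun y hy =>
    (hθsm.contMDiffAt (hWo.mem_nhds hy)).mdifferentiableAt (by simp)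
  let dγ : Euc d → Euc d →L[ℝ] Euc m := fun v => mfderiv (𝓡 d) (𝓡 m) γ v
  have hθγ : ∀ v ∈ O, ∀ w, vderiv m θ (γ v) (dγ v w) = j w := by
    intro v hv w
    have h1 := vderiv_comp (hθdiff _ (hγW v hv)) (hγd v hv) w
    have h2 : (fun v => θ (γ v)) =ᶠ[𝓝 v] j := by
      filter_upwards [hOo.mem_nhds hv] with v hv
      exact (hcb _ hv).2
    rw [vderiv_congr h2, vderiv_euclidean, ContinuousLinearMap.fderiv] at h1
    exact h1.symm
  have hθinj : ∀ v ∈ O, Function.Injective (vderiv m θ (γ v)) := by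
    intro v hv
    refine (LinearMap.injective_iff_surjective (f := (vderiv m θ (γ v)).toLinearMap)).2 fun e => ?_
    have h1 := vderiv_comp (g := θ) (i := c) (x := j v) (hθdiff _ (hγW v hv))
      ((hcsm.contMDiffAt (Metric.isOpen_ball.mem_nhds hv)).mdifferentiableAt (by simp)) e
    have h2 : (fun v => θ (c v)) =ᶠ[𝓝 (j v)] id := by
      filter_upwards [Metric.isOpen_ball.mem_nhds hv] with v hv
      exact (hcb _ hv).2
    rw [vderiv_congr h2, vderiv_euclidean, fderiv_id] at h1
    exact ⟨_, h1.symm⟩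
  -- The derivative of θ is injective and maps D(γ v) into D(x); the dimensions agree near x.
  have hmap : ∀ v ∈ O, (comapSub m F Λ (γ v)).map (vderiv m θ (γ v)).toLinearMap =
      comapSub m F Λ x := by
    intro v hv
    refine Submodule.eq_of_le_of_finrank_eq ?_ ?_
    · rintro _ ⟨ξ, hξ, rfl⟩
      have h1 := hθD _ (hγU v hv) ξ hξ
      change vderiv m θ (γ v) ξ ∈ _
      rw [h1]
      exact (hRΛ _ (Submodule.starProjection_apply_mem _ _)).1
    · rw [← (Submodule.equivMapOfInjective (vderiv m θ (γ v)).toLinearMap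
        (hθinj v hv) _).finrank_eq, finrank_comapSub hinj (hle _ (hγU v hv)),
        finrank_comapSub hinj (hle x hx), (hWev _ (hγW v hv)).1]
  have hrange : ∀ v ∈ O, LinearMap.range (dγ v).toLinearMap = comapSub m F Λ (γ v) := by
    intro v hv
    ext ξ
    constructor
    · rintro ⟨w, rfl⟩
      have h1 : j w ∈ comapSub m F Λ x := (hj _).2 ⟨w, rfl⟩
      rw [← hmap v hv] at h1
      obtain ⟨ξ, hξ, h2⟩ := h1
      have h3 : ξ = dγ v w := hθinj v hv (h2.trans (hθγ v hv w).symm)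
      change dγ v w ∈ _
      rw [← h3]; exact hξ
    · intro hξ
      have h1 : vderiv m θ (γ v) ξ ∈ comapSub m F Λ x := by
        rw [← hmap v hv]; exact ⟨ξ, hξ, rfl⟩
      obtain ⟨w, hw⟩ := (hj _).1 h1
      exact ⟨w, hθinj v hv ((hθγ v hv w).trans hw)⟩
  have hdγmem : ∀ v ∈ O, ∀ w, dγ v w ∈ comapSub m F Λ (γ v) := by
    intro v hv w
    rw [← hrange v hv]; exact ⟨w, rfl⟩
  have hΛγ : ∀ v ∈ O, projField Λ (γ v) = P₀ := by
    intro v hv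
    have h1 := eq_of_vderiv_eq_zero_on hOo hOc (g := fun v => projField Λ (γ v))
      (hΛ.comp hγsm hγU) (fun v hv w => by
        have h1 := vderiv_comp (hΛd _ (hγU v hv)) (hγd v hv) w
        exact h1.trans (hpar _ (hγU v hv) _ (hdγmem v hv w))) hv hO0
    rw [h1, hγ0]
  have hFγ : ∀ v ∈ O, F (γ v) = F x + vderiv m F x (j v) := by
    intro v hv
    -- On the leaf F_*γ'(w) lies in Λ(x), where R inverts F_* at x; as θ'γ'(w) = j w, this vector
    -- equals the constant F_*(j w) at x.
    have hl : ContMDiffOn (𝓡 d) 𝓘(ℝ, Euc q) ∞ (fun v => vderiv m F x (j v)) O :=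
      ((vderiv m F x).comp j).contMDiff.contMDiffOn
    have h1 := eq_of_vderiv_eq_zero_on hOo hOc (g := fun v => F (γ v) - vderiv m F x (j v))
      ((hF.comp_contMDiffOn hγsm).sub hl) (fun v hv w => by
        have h1 := vderiv_comp (hFd (γ v)) (hγd v hv) w
        have h2 : MDifferentiableAt (𝓡 d) 𝓘(ℝ, Euc q) (fun v => F (γ v)) v :=
          (hFd (γ v)).comp v (hγd v hv)
        have h3 := (hl.contMDiffAt (hOo.mem_nhds hv)).mdifferentiableAt (by simp)
        have h4 : vderiv d (fun v => vderiv m F x (j v)) v w = vderiv m F x (j w) := by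
          rw [vderiv_euclidean]
          exact congrArg (fun L : Euc d →L[ℝ] Euc q => L w)
            ((vderiv m F x).comp j).fderiv
        have hmem := hdγmem v hv w
        have h5 : P₀ (vderiv m F (γ v) (dγ v w)) = vderiv m F (γ v) (dγ v w) := by
          rw [← hΛγ v hv]
          exact Submodule.starProjection_eq_self_iff.2 hmem
        have h6 := hθD _ (hγU v hv) _ hmem
        rw [hθγ v hv, h5] at h6
        have h7 := (hRΛ _ (Submodule.starProjection_eq_self_iff.1 h5)).2
        rw [← h6] at h7
        rw [vderiv_sub h2 h3, sub_apply, h1, h4, h7]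
        exact sub_self _) hv hO0
    rw [hγ0, map_zero, map_zero, sub_zero] at h1
    rw [← h1]; abel
  refine ⟨O, γ, AffineSubspace.mk' (F x) (Λ x), (fun u => R (u - F x)) ⁻¹' Metric.ball 0 r,
    hOo, ⟨⟨0, hO0⟩, hOc.isPreconnected⟩, ⟨0, hO0, hγ0⟩, ?_, ?_, hγsm, ?_, ?_, ?_, ?_⟩
  · rintro _ ⟨v, hv, rfl⟩
    exact hγU v hv
  · intro v hv v' hv' h
    have h1 : θ (γ v) = θ (γ v') := congrArg θ h
    exact hjinj ((hcb _ hv).2.symm.trans (h1.trans (hcb _ hv').2))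
  · intro v hv
    refine ⟨fun w w' h => hjinj ?_, hrange v hv⟩
    have h' : dγ v w = dγ v w' := h
    exact (hθγ v hv w).symm.trans ((congrArg (vderiv m θ (γ v)) h').trans (hθγ v hv w'))
  · rw [AffineSubspace.direction_mk', ← hd, finrank_comapSub hinj (hle x hx)]
  · exact Metric.isOpen_ball.preimage (R.continuous.comp (continuous_id.sub continuous_const))
  · ext u
    constructor
    · rintro ⟨_, ⟨v, hv, rfl⟩, rfl⟩
      rw [hFγ v hv]
      have hm : j v ∈ comapSub m F Λ x := (hj _).2 ⟨v, rfl⟩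
      constructor
      · rw [Set.mem_preimage, add_sub_cancel_left, hR]; exact hv
      · rw [SetLike.mem_coe, AffineSubspace.mem_mk', vsub_eq_sub, add_sub_cancel_left]
        exact hm
    · rintro ⟨h1, h2⟩
      rw [SetLike.mem_coe, AffineSubspace.mem_mk', vsub_eq_sub] at h2
      obtain ⟨h3, h4⟩ := hRΛ _ h2
      obtain ⟨v, hv⟩ := (hj _).1 h3
      have hvO : v ∈ O := by
        change j v ∈ Metric.ball 0 r
        rw [hv]; exact h1
      refine ⟨_, ⟨v, hvO, rfl⟩, ?_⟩
      rw [hFγ v hvO, hv, h4]; abel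

theorem isRuledOn_comapSub [IsManifold (𝓡 m) 1 N] : IsRuledOn F (comapSub m F Λ) U :=
  ⟨isSmoothDistributionOn_comapSub hF hinj hU hΛ hle hdim, fun _ hx =>
    exists_leaf hF hinj hU hΛ hle hdim hpar hx⟩

end Leaves

/-- A smooth field of subspaces whose projections have vanishing derivative along `D` is constant
along `D`. -/
theorem isConstantAlongOn_of_projDeriv {n q : ℕ} {M : Type u} [TopologicalSpace M]
    [ChartedSpace (Euc n) M] {S : M → Submodule ℝ (Euc q)} {D : M → Submodule ℝ (Euc n)}
    {U : Set M} (hS : ∀ x, MDifferentiableAt (𝓡 n) 𝓘(ℝ, Euc q →L[ℝ] Euc q) (projField S) x)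
    (hD : ∀ x ∈ U, ∀ X ∈ D x, projDeriv n S x X = 0) : IsConstantAlongOn S D U := by
  intro c a b hc hcD t ht t' ht'
  have hcd : ∀ t ∈ Set.Ioo a b, MDifferentiableAt 𝓘(ℝ, ℝ) (𝓡 n) c t := fun t ht =>
    (hc.contMDiffAt (isOpen_Ioo.mem_nhds ht)).mdifferentiableAt (by simp)
  have hd : ∀ t ∈ Set.Ioo a b, HasFDerivAt (fun t => projField S (c t)) (0 : ℝ →L[ℝ] _) t := by
    intro t ht
    have h1 : MDifferentiableAt 𝓘(ℝ, ℝ) 𝓘(ℝ, Euc q →L[ℝ] Euc q) (fun t => projField S (c t)) t :=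
      (hS (c t)).comp t (hcd t ht)
    have h2 := mfderiv_comp t (hS (c t)) (hcd t ht)
    have h3 : fderiv ℝ (fun t => projField S (c t)) t = 0 := by
      ext1
      rw [← mfderiv_eq_fderiv]
      refine (congrArg (fun L : ℝ →L[ℝ] (Euc q →L[ℝ] Euc q) => L 1) h2).trans ?_
      exact hD _ (hcD t ht).1 _ (hcD t ht).2
    rw [← h3]
    exact (mdifferentiableAt_iff_differentiableAt.1 h1).hasFDerivAt
  have h4 := (convex_Ioo a b).is_const_of_fderivWithin_eq_zero (𝕜 := ℝ)
    (fun t ht => (hd t ht).differentiableAt.differentiableWithinAt)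
    (fun t ht => ((hd t ht).hasFDerivWithinAt.fderivWithin
      (isOpen_Ioo.uniqueDiffWithinAt ht))) ht ht'
  ext u
  rw [← Submodule.starProjection_eq_self_iff (K := S (c t)),
    ← Submodule.starProjection_eq_self_iff (K := S (c t'))]
  exact Eq.congr (congrArg (fun L : Euc q →L[ℝ] Euc q => L u) h4) rfl

/-! ### The Riemannian metric induced by an immersion. -/

section PullbackMetric

variable {m q : ℕ} {N : Type u} [TopologicalSpace N] [ChartedSpace (Euc m) N]
  [IsManifold (𝓡 m) ∞ N] {F : N → Euc q}

theorem contMDiffOn_fderiv_chart (hF : ContMDiff (𝓡 m) 𝓘(ℝ, Euc q) ∞ F) (x : N) :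
    ContMDiffOn (𝓡 m) 𝓘(ℝ, Euc m →L[ℝ] Euc q) ∞ (fun y =>
      fderiv ℝ (F ∘ (extChartAt (𝓡 m) x).symm) (extChartAt (𝓡 m) x y))
      (chartAt (Euc m) x).source := by
  have h1 := (contDiffOn_comp_extChartAt_symm (x₀ := x) hF.contMDiffOn).fderiv_of_isOpen
    (isOpen_target_inter_preimage isOpen_univ) (m := ∞) (by simp)
  exact (contMDiffOn_iff_contDiffOn.2 h1).comp
    (contMDiffOn_extChartAt (I := 𝓡 m) (x := x)) (fun y hy =>
      ⟨(extChartAt (𝓡 m) x).map_source (by rwa [extChartAt_source]), trivial⟩)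

/-- The bilinear form induced on the model space by an injective linear map. -/
def pullbackInner {E G : Type*} [NormedAddCommGroup E] [NormedSpace ℝ E] [NormedAddCommGroup G]
    [InnerProductSpace ℝ G] (A : E →L[ℝ] G) : E →L[ℝ] E →L[ℝ] ℝ :=
  ((ContinuousLinearMap.compL ℝ E G ℝ).flip A).comp ((innerSL ℝ).comp A)

theorem pullbackInner_apply {E G : Type*} [NormedAddCommGroup E] [NormedSpace ℝ E]
    [NormedAddCommGroup G] [InnerProductSpace ℝ G] (A : E →L[ℝ] G) (v w : E) :
    pullbackInner A v w = inner ℝ (A v) (A w) := rfl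

theorem contDiff_pullbackInner {E G : Type*} [NormedAddCommGroup E] [NormedSpace ℝ E]
    [FiniteDimensional ℝ E] [NormedAddCommGroup G] [InnerProductSpace ℝ G] :
    ContDiff ℝ ∞ (fun A : E →L[ℝ] G => pullbackInner A) := by
  refine contDiff_clm_apply_iff.2 fun v => contDiff_clm_apply_iff.2 fun w => ?_
  exact (contDiff_id.clm_apply contDiff_const).inner ℝ (contDiff_id.clm_apply contDiff_const)

theorem isVonNBounded_pullbackInner {E G : Type*} [NormedAddCommGroup E] [NormedSpace ℝ E]
    [FiniteDimensional ℝ E] [NormedAddCommGroup G] [InnerProductSpace ℝ G]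
    [FiniteDimensional ℝ G] (A : E →L[ℝ] G)
    (hA : Function.Injective A) : Bornology.IsVonNBounded ℝ {v : E | pullbackInner A v v < 1} := by
  obtain ⟨R, hR⟩ := exists_left_inverse_clm A hA
  refine ((NormedSpace.isVonNBounded_ball ℝ G 1).image (R : G →L[ℝ] E)).subset ?_
  intro v hv
  refine ⟨A v, ?_, hR v⟩
  have hv' : inner ℝ (A v) (A v) < 1 := hv
  rw [real_inner_self_eq_norm_sq] at hv'
  rw [Metric.mem_ball, dist_zero_right]
  nlinarith [norm_nonneg (A v)]

/-- The bilinear form on the tangent space induced by a map into Euclidean space. -/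
def pullbackForm (m : ℕ) {q : ℕ} {N : Type u} [TopologicalSpace N] [ChartedSpace (Euc m) N]
    (F : N → Euc q) (y : N) : TangentSpace (𝓡 m) y →L[ℝ] TangentSpace (𝓡 m) y →L[ℝ] ℝ :=
  pullbackInner (vderiv m F y)

omit [IsManifold (𝓡 m) ∞ N] in
theorem pullbackForm_apply (F : N → Euc q) (y : N) (v w : Euc m) :
    pullbackForm m F y v w = inner ℝ (vderiv m F y v) (vderiv m F y w) := rfl

theorem contMDiff_pullbackForm (hF : ContMDiff (𝓡 m) 𝓘(ℝ, Euc q) ∞ F) :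
    ContMDiff (𝓡 m) ((𝓡 m).prod 𝓘(ℝ, Euc m →L[ℝ] Euc m →L[ℝ] ℝ)) ∞
      (fun y => TotalSpace.mk' (Euc m →L[ℝ] Euc m →L[ℝ] ℝ)
        (E := fun y : N => TangentSpace (𝓡 m) y →L[ℝ] TangentSpace (𝓡 m) y →L[ℝ] ℝ)
        y (pullbackForm m F y)) := by
  have : IsManifold (𝓡 m) 1 N := IsManifold.of_le (n := ∞) (by exact_mod_cast le_top)
  intro x
  refine (contMDiffAt_section x).2 ?_
  have h1 : ContMDiffAt (𝓡 m) 𝓘(ℝ, Euc m →L[ℝ] Euc m →L[ℝ] ℝ) ∞ (fun y => pullbackInner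
      (fderiv ℝ (F ∘ (extChartAt (𝓡 m) x).symm) (extChartAt (𝓡 m) x y))) x := by
    have h2 := (contMDiffOn_fderiv_chart hF x).contMDiffAt (mem_chart_source_nhds m x)
    exact contDiff_pullbackInner.contMDiff.contMDiffAt.comp x h2
  refine h1.congr_of_eventuallyEq ?_
  filter_upwards [mem_chart_source_nhds m x] with y hy
  ext v w
  have hb : y ∈ (trivializationAt (Euc m) (TangentSpace (𝓡 m) (M := N)) x).baseSet := by
    rw [TangentBundle.trivializationAt_baseSet]; exact hy
  have hs : ∀ v : Euc m, (trivializationAt (Euc m) (TangentSpace (𝓡 m)) x).symm y v =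
      chartFrame m x y v := by
    intro v
    rw [← Trivialization.symmL_apply (R := ℝ) _ hb, TangentBundle.symmL_trivializationAt hy,
      ModelWithCorners.Boundaryless.range_eq_univ, mfderivWithin_univ]
    rfl
  rw [hom_trivializationAt_apply]
  refine (inCoordinates_apply_eq₂ hb hb (by simp)).trans ?_
  rw [hs, hs, pullbackInner_apply, pullbackForm_apply]
  have hd : ∀ v, fderiv ℝ (F ∘ (extChartAt (𝓡 m) x).symm) (extChartAt (𝓡 m) x y) v =
      vderiv m F y (chartFrame m x y v) := fun v =>
    chartDeriv_eq_vderiv hy (hF.mdifferentiableAt (by simp)) v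
  rw [hd, hd]
  simp

/-- The metric induced by an immersion. -/
def inducedMetric (hF : ContMDiff (𝓡 m) 𝓘(ℝ, Euc q) ∞ F)
    (hinj : ∀ y, Function.Injective (vderiv m F y)) : SmoothMetric m N where
  inner y := pullbackForm m F y
  symm y v w := (pullbackForm_apply F y v w).trans
    ((real_inner_comm _ _).trans (pullbackForm_apply F y w v).symm)
  pos y v hv := (real_inner_self_pos (x := vderiv m F y v)).2 fun h =>
    hv (hinj y (h.trans (map_zero (vderiv m F y)).symm))
  isVonNBounded y := isVonNBounded_pullbackInner (vderiv m F y) (hinj y)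
  contMDiff := contMDiff_pullbackForm hF

theorem inducedMetric_inner (hF : ContMDiff (𝓡 m) 𝓘(ℝ, Euc q) ∞ F)
    (hinj : ∀ y, Function.Injective (vderiv m F y)) (y : N) (v w : Euc m) :
    (inducedMetric hF hinj).inner y v w = inner ℝ (vderiv m F y v) (vderiv m F y w) := rfl

theorem isIsometricImmersion_inducedMetric (hF : ContMDiff (𝓡 m) 𝓘(ℝ, Euc q) ∞ F)
    (hinj : ∀ y, Function.Injective (vderiv m F y)) :
    IsIsometricImmersion (inducedMetric hF hinj) F :=
  ⟨hF, fun y v w => (inducedMetric_inner hF hinj y v w).symm⟩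

end PullbackMetric

theorem IsIsometricImmersion.injective_vderiv {n q : ℕ} {M : Type u} [TopologicalSpace M]
    [ChartedSpace (Euc n) M] [IsManifold (𝓡 n) ∞ M] {g : SmoothMetric n M} {f : M → Euc q}
    (hf : IsIsometricImmersion g f) (x : M) : Function.Injective (vderiv n f x) := by
  rw [injective_iff_map_eq_zero]
  intro v hv
  by_contra h
  have h1 := g.pos x v h
  rw [← hf.2 x v v] at h1
  have h2 : differential n f x v = 0 := hv
  rw [h2, inner_zero_left] at h1
  exact lt_irrefl _ h1

/-! ### The total space of a subbundle of a trivial bundle, as a manifold. -/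

/-- A smooth vector subbundle of rank `l` of the trivial bundle with fibre `ℝ^q` over an open subset
of an `n`-dimensional manifold; `m` is the dimension of its total space. -/
structure Subbundle (n q l m : ℕ) (M : Type u) [TopologicalSpace M] [ChartedSpace (Euc n) M] where
  base : Set M
  isOpen_base : IsOpen base
  fiber : M → Submodule ℝ (Euc q)
  contMDiffOn_projField : ContMDiffOn (𝓡 n) 𝓘(ℝ, Euc q →L[ℝ] Euc q) ∞ (projField fiber) base
  finrank_fiber : ∀ x ∈ base, finrank ℝ (fiber x) = l
  dim_eq : m = n + l

namespace Subbundle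

variable {n q l m : ℕ} {M : Type u} [TopologicalSpace M] [ChartedSpace (Euc n) M]
  (S : Subbundle n q l m M)

/-- The total space of a subbundle. -/
def Total : Type u := {z : M × Euc q // z.1 ∈ S.base ∧ z.2 ∈ S.fiber z.1}

instance : TopologicalSpace S.Total :=
  inferInstanceAs (TopologicalSpace {z : M × Euc q // z.1 ∈ S.base ∧ z.2 ∈ S.fiber z.1})

instance [T2Space M] : T2Space S.Total :=
  inferInstanceAs (T2Space {z : M × Euc q // z.1 ∈ S.base ∧ z.2 ∈ S.fiber z.1})

instance [SecondCountableTopology M] : SecondCountableTopology S.Total :=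
  TopologicalSpace.Subtype.secondCountableTopology
    {z : M × Euc q | z.1 ∈ S.base ∧ z.2 ∈ S.fiber z.1}

variable {S} in
/-- The bundle projection. -/
def pr (z : S.Total) : M := z.1.1

variable {S} in
/-- The vector part of a point of the total space. -/
def vec (z : S.Total) : Euc q := z.1.2

variable {S} in
/-- The point of the total space with given components. -/
def mk' (x : M) (v : Euc q) (hx : x ∈ S.base) (hv : v ∈ S.fiber x) : S.Total := ⟨(x, v), hx, hv⟩

variable {S} in
@[simp] theorem pr_mk' (x : M) (v : Euc q) (hx : x ∈ S.base) (hv : v ∈ S.fiber x) :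
    pr (mk' x v hx hv) = x := rfl

variable {S} in
@[simp] theorem vec_mk' (x : M) (v : Euc q) (hx : x ∈ S.base) (hv : v ∈ S.fiber x) :
    vec (mk' x v hx hv) = v := rfl

theorem pr_mem (z : S.Total) : pr z ∈ S.base := z.2.1

theorem vec_mem (z : S.Total) : vec z ∈ S.fiber (pr z) := z.2.2

theorem continuous_pr : Continuous (pr : S.Total → M) :=
  continuous_fst.comp continuous_subtype_val

theorem continuous_vec : Continuous (vec : S.Total → Euc q) :=
  continuous_snd.comp continuous_subtype_val

variable {S} in
theorem total_ext {z z' : S.Total} (h : pr z = pr z') (h' : vec z = vec z') : z = z' :=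
  Subtype.ext (Prod.ext h h')

theorem continuousOn_total_iff {X : Type*} [TopologicalSpace X] {g : X → S.Total} {s : Set X} :
    ContinuousOn g s ↔ ContinuousOn (fun x => pr (g x)) s ∧ ContinuousOn (fun x => vec (g x)) s := by
  constructor
  · exact fun h => ⟨S.continuous_pr.comp_continuousOn h, S.continuous_vec.comp_continuousOn h⟩
  · rintro ⟨h1, h2⟩
    exact IsInducing.subtypeVal.continuousOn_iff.2 (h1.prodMk h2)

/-- The splitting of the model space of the total space. -/
def split : Euc m ≃L[ℝ] Euc n × Euc l :=
  ContinuousLinearEquiv.ofFinrankEq (by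
    rw [finrank_prod, finrank_euclideanSpace_fin, finrank_euclideanSpace_fin,
      finrank_euclideanSpace_fin, S.dim_eq])

/-- Membership in the base is a hypothesis inside the existential, so that a frame can be chosen at
every point; off the base the choice is irrelevant. -/
theorem exists_frame (x : M) : ∃ (j : Euc l →L[ℝ] Euc q) (ρ : Euc q →L[ℝ] Euc l),
    x ∈ S.base → (∀ c, j c ∈ S.fiber x) ∧ ∀ c, ρ (j c) = c := by
  by_cases hx : x ∈ S.base
  · have h := exists_clm_range_eq (S.fiber x)
    rw [S.finrank_fiber x hx] at h
    obtain ⟨j, hj, hj'⟩ := h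
    obtain ⟨ρ, hρ⟩ := exists_left_inverse_clm j hj
    exact ⟨j, ρ, fun _ => ⟨fun c => (hj' _).2 ⟨c, rfl⟩, hρ⟩⟩
  · exact ⟨0, 0, fun h => absurd h hx⟩

/-- A parametrization of the fibre at `x`. -/
def frame (x : M) : Euc l →L[ℝ] Euc q := (S.exists_frame x).choose

/-- Linear coordinates on the fibre at `x`. -/
def coframe (x : M) : Euc q →L[ℝ] Euc l := (S.exists_frame x).choose_spec.choose

theorem frame_mem {x : M} (hx : x ∈ S.base) (c : Euc l) : S.frame x c ∈ S.fiber x :=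
  ((S.exists_frame x).choose_spec.choose_spec hx).1 c

theorem coframe_frame {x : M} (hx : x ∈ S.base) (c : Euc l) : S.coframe x (S.frame x c) = c :=
  ((S.exists_frame x).choose_spec.choose_spec hx).2 c

/-- The comparison of the fibre at `y` with the fibre at `x`. -/
def transfer (x y : M) : Euc l →L[ℝ] Euc l :=
  (S.coframe x).comp ((projField S.fiber y).comp (S.frame x))

theorem transfer_self {x : M} (hx : x ∈ S.base) :
    S.transfer x x = ContinuousLinearEquiv.refl ℝ (Euc l) := by
  ext1 c
  change S.coframe x (projField S.fiber x (S.frame x c)) = c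
  rw [Submodule.starProjection_eq_self_iff.2 (S.frame_mem hx c), S.coframe_frame hx]

theorem contMDiffOn_transfer (x : M) :
    ContMDiffOn (𝓡 n) 𝓘(ℝ, Euc l →L[ℝ] Euc l) ∞ (S.transfer x) S.base :=
  contMDiffOn_const.clm_comp (S.contMDiffOn_projField.clm_comp contMDiffOn_const)

/-- The base of the coordinate chart at `x`. -/
def chartBase (x : M) : Set M :=
  (S.base ∩ S.transfer x ⁻¹' Set.range ((↑) : (Euc l ≃L[ℝ] Euc l) → Euc l →L[ℝ] Euc l)) ∩
    (chartAt (Euc n) x).source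

theorem isOpen_chartBase (x : M) : IsOpen (S.chartBase x) :=
  ((S.contMDiffOn_transfer x).continuousOn.isOpen_inter_preimage S.isOpen_base
    ContinuousLinearEquiv.isOpen).inter (chartAt (Euc n) x).open_source

theorem mem_chartBase_self {x : M} (hx : x ∈ S.base) : x ∈ S.chartBase x :=
  ⟨⟨hx, ⟨_, (S.transfer_self hx).symm⟩⟩, mem_chart_source _ x⟩

/-- The vector of the fibre at `y` with given coordinates. -/
def fiberPoint (x y : M) (c : Euc l) : Euc q :=
  projField S.fiber y (S.frame x ((S.transfer x y).inverse c))

theorem fiberPoint_mem (x y : M) (c : Euc l) : S.fiberPoint x y c ∈ S.fiber y :=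
  Submodule.starProjection_apply_mem _ _

theorem coframe_fiberPoint {x y : M} (hy : y ∈ S.chartBase x) (c : Euc l) :
    S.coframe x (S.fiberPoint x y c) = c := by
  obtain ⟨e, he⟩ := hy.1.2
  change S.transfer x y ((S.transfer x y).inverse c) = c
  rw [← he, ContinuousLinearMap.inverse_equiv]
  exact e.apply_symm_apply c

/-- Where the transfer map is invertible, P_y composed with the frame at x is injective, so by
dimension it fills the fibre at y. -/
theorem fiberPoint_coframe {x y : M} (hy : y ∈ S.chartBase x) {v : Euc q} (hv : v ∈ S.fiber y) :
    S.fiberPoint x y (S.coframe x v) = v := by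
  have hsurj : LinearMap.range ((projField S.fiber y).comp (S.frame x)).toLinearMap = S.fiber y := by
    obtain ⟨e, he⟩ := hy.1.2
    refine Submodule.eq_of_le_of_finrank_eq ?_ ?_
    · rintro _ ⟨c, rfl⟩
      exact Submodule.starProjection_apply_mem _ _
    · rw [LinearMap.finrank_range_of_inj, finrank_euclideanSpace_fin, S.finrank_fiber y hy.1.1]
      intro c c' h
      have h2 : S.transfer x y c = S.transfer x y c' := congrArg (S.coframe x) h
      rw [← he] at h2
      exact e.injective h2
  rw [← hsurj] at hv
  obtain ⟨c, rfl⟩ := hv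
  obtain ⟨e, he⟩ := hy.1.2
  have h3 : (S.transfer x y).inverse (S.transfer x y c) = c := by
    rw [← he, ContinuousLinearMap.inverse_equiv]
    exact e.symm_apply_apply c
  change projField S.fiber y (S.frame x ((S.transfer x y).inverse (S.transfer x y c))) = _
  rw [h3]
  rfl

theorem contMDiffAt_fiberPoint {d : ℕ} {X : Type*} [TopologicalSpace X] [ChartedSpace (Euc d) X]
    {x : M} {a : X → M} {c : X → Euc l} {z : X} (ha : ContMDiffAt (𝓡 d) (𝓡 n) ∞ a z)
    (hc : ContMDiffAt (𝓡 d) 𝓘(ℝ, Euc l) ∞ c z) (hz : a z ∈ S.chartBase x) :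
    ContMDiffAt (𝓡 d) 𝓘(ℝ, Euc q) ∞ (fun z => S.fiberPoint x (a z) (c z)) z := by
  have hb := S.isOpen_base.mem_nhds hz.1.1
  have h1 := (S.contMDiffOn_projField.contMDiffAt hb).comp z ha
  have h2 := ((S.contMDiffOn_transfer x).contMDiffAt hb).comp z ha
  obtain ⟨e, he⟩ := hz.1.2
  have hi : ContDiffAt ℝ ∞ ContinuousLinearMap.inverse (S.transfer x (a z)) := by
    rw [← he]; exact contDiffAt_map_inverse e
  exact h1.clm_apply (contMDiffAt_const.clm_apply ((hi.contMDiffAt.comp z h2).clm_apply hc))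

/-- The point of `M` with given chart coordinates. -/
def basePoint (x : M) (t : Euc m) : M := (chartAt (Euc n) x).symm (S.split t).1

/-- The set of coordinates of a chart of the total space. -/
def chartTarget (x : M) : Set (Euc m) :=
  (fun t => (S.split t).1) ⁻¹'
    ((chartAt (Euc n) x).target ∩ (chartAt (Euc n) x).symm ⁻¹' S.chartBase x)

variable {S} in
theorem mem_chartTarget {x : M} {t : Euc m} : t ∈ S.chartTarget x ↔
    (S.split t).1 ∈ (chartAt (Euc n) x).target ∧ S.basePoint x t ∈ S.chartBase x := Iff.rfl

theorem isOpen_chartTarget (x : M) : IsOpen (S.chartTarget x) :=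
  ((chartAt (Euc n) x).continuousOn_symm.isOpen_inter_preimage (chartAt (Euc n) x).open_target
    (S.isOpen_chartBase x)).preimage (continuous_fst.comp S.split.continuous)

variable [IsManifold (𝓡 n) ∞ M]

theorem contMDiffOn_basePoint (x : M) :
    ContMDiffOn (𝓡 m) (𝓡 n) ∞ (S.basePoint x) (S.chartTarget x) := by
  have h1 : ContMDiff (𝓡 m) (𝓡 n) ∞ (fun t => (S.split t).1) :=
    ((ContinuousLinearMap.fst ℝ (Euc n) (Euc l)).comp
      (S.split : Euc m →L[ℝ] Euc n × Euc l)).contMDiff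
  exact (contMDiffOn_chart_symm (I := 𝓡 n) (x := x)).comp h1.contMDiffOn fun t ht => ht.1

theorem contMDiffOn_fiberPoint_basePoint (x : M) : ContMDiffOn (𝓡 m) 𝓘(ℝ, Euc q) ∞
    (fun t => S.fiberPoint x (S.basePoint x t) (S.split t).2) (S.chartTarget x) := by
  intro t ht
  have h2 : ContMDiff (𝓡 m) 𝓘(ℝ, Euc l) ∞ (fun t => (S.split t).2) :=
    ((ContinuousLinearMap.snd ℝ (Euc n) (Euc l)).comp
      (S.split : Euc m →L[ℝ] Euc n × Euc l)).contMDiff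
  exact (S.contMDiffAt_fiberPoint ((S.contMDiffOn_basePoint x).contMDiffAt
    ((S.isOpen_chartTarget x).mem_nhds ht)) h2.contMDiffAt ht.2).contMDiffWithinAt

/-- The coordinates of a point of the total space. -/
def coord (x : M) (z : S.Total) : Euc m :=
  S.split.symm (chartAt (Euc n) x (pr z), S.coframe x (vec z))

omit [IsManifold (𝓡 n) ∞ M] in
theorem split_coord (x : M) (z : S.Total) :
    S.split (S.coord x z) = (chartAt (Euc n) x (pr z), S.coframe x (vec z)) :=
  S.split.apply_symm_apply _

omit [IsManifold (𝓡 n) ∞ M] in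
theorem basePoint_coord {x : M} {z : S.Total} (hz : pr z ∈ S.chartBase x) :
    S.basePoint x (S.coord x z) = pr z := by
  rw [basePoint, split_coord]
  exact (chartAt (Euc n) x).left_inv hz.2

omit [IsManifold (𝓡 n) ∞ M] in
theorem coord_mem_chartTarget {x : M} {z : S.Total} (hz : pr z ∈ S.chartBase x) :
    S.coord x z ∈ S.chartTarget x := by
  rw [mem_chartTarget, S.basePoint_coord hz, split_coord]
  exact ⟨(chartAt (Euc n) x).map_source hz.2, hz⟩

open Classical in
/-- The inverse of `coord`, with a junk value outside of the range of the chart. -/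
def coordInv (z₀ : S.Total) (t : Euc m) : S.Total :=
  if h : S.basePoint (pr z₀) t ∈ S.base then
    mk' (S.basePoint (pr z₀) t) (S.fiberPoint (pr z₀) (S.basePoint (pr z₀) t) (S.split t).2)
      h (S.fiberPoint_mem _ _ _)
  else z₀

variable {S} in
omit [IsManifold (𝓡 n) ∞ M] in
theorem pr_coordInv {z₀ : S.Total} {t : Euc m} (ht : t ∈ S.chartTarget (pr z₀)) :
    pr (S.coordInv z₀ t) = S.basePoint (pr z₀) t := by
  have h : S.basePoint (pr z₀) t ∈ S.base := ht.2.1.1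
  rw [coordInv, dif_pos h, pr_mk']

variable {S} in
omit [IsManifold (𝓡 n) ∞ M] in
theorem vec_coordInv {z₀ : S.Total} {t : Euc m} (ht : t ∈ S.chartTarget (pr z₀)) :
    vec (S.coordInv z₀ t) = S.fiberPoint (pr z₀) (S.basePoint (pr z₀) t) (S.split t).2 := by
  have h : S.basePoint (pr z₀) t ∈ S.base := ht.2.1.1
  rw [coordInv, dif_pos h, vec_mk']

/-- The chart of the total space at `z₀`. -/
def totalChart (z₀ : S.Total) : OpenPartialHomeomorph S.Total (Euc m) where
  toFun := S.coord (pr z₀)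
  invFun := S.coordInv z₀
  source := pr ⁻¹' S.chartBase (pr z₀)
  target := S.chartTarget (pr z₀)
  map_source' z hz := S.coord_mem_chartTarget hz
  map_target' t ht := by
    rw [Set.mem_preimage, pr_coordInv ht]
    exact ht.2
  left_inv' z hz := by
    have ht := S.coord_mem_chartTarget hz
    refine total_ext ((pr_coordInv ht).trans (S.basePoint_coord hz)) ?_
    rw [vec_coordInv ht, S.basePoint_coord hz, split_coord]
    exact S.fiberPoint_coframe hz (S.vec_mem z)
  right_inv' t ht := by
    have h1 := mem_chartTarget.1 ht
    rw [coord, pr_coordInv ht, vec_coordInv ht, S.coframe_fiberPoint h1.2, basePoint,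
      (chartAt (Euc n) (pr z₀)).right_inv h1.1]
    exact S.split.symm_apply_apply t
  open_source := (S.isOpen_chartBase _).preimage S.continuous_pr
  open_target := S.isOpen_chartTarget _
  continuousOn_toFun := by
    refine S.split.symm.continuous.comp_continuousOn (ContinuousOn.prodMk ?_ ?_)
    · exact (chartAt (Euc n) (pr z₀)).continuousOn.comp S.continuous_pr.continuousOn
        fun z hz => hz.2
    · exact ((S.coframe (pr z₀)).continuous.comp S.continuous_vec).continuousOn
  continuousOn_invFun := by
    rw [continuousOn_total_iff]
    exact ⟨(S.contMDiffOn_basePoint _).continuousOn.congr fun t ht => pr_coordInv ht,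
      (S.contMDiffOn_fiberPoint_basePoint _).continuousOn.congr fun t ht => vec_coordInv ht⟩

instance : ChartedSpace (Euc m) S.Total where
  atlas := Set.range S.totalChart
  chartAt := S.totalChart
  mem_chart_source z := S.mem_chartBase_self (S.pr_mem z)
  chart_mem_atlas z := ⟨z, rfl⟩

/-- This yields both the smooth transition maps and the criterion `contMDiffAt_total`. -/
theorem contMDiffAt_coord_comp {d : ℕ} {X : Type*} [TopologicalSpace X] [ChartedSpace (Euc d) X]
    (x : M) {a : X → M} {v : X → Euc q} {z : X} (ha : ContMDiffAt (𝓡 d) (𝓡 n) ∞ a z)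
    (hv : ContMDiffAt (𝓡 d) 𝓘(ℝ, Euc q) ∞ v z) (hz : a z ∈ S.chartBase x) :
    ContMDiffAt (𝓡 d) (𝓡 m) ∞
      (fun z => S.split.symm (chartAt (Euc n) x (a z), S.coframe x (v z))) z := by
  have h1 : ContMDiffAt (𝓡 d) 𝓘(ℝ, Euc n) ∞ (fun z => chartAt (Euc n) x (a z)) z :=
    ((contMDiffOn_chart (I := 𝓡 n) (x := x)).contMDiffAt
      ((chartAt (Euc n) x).open_source.mem_nhds hz.2)).comp z ha
  have h2 : ContMDiffAt (𝓡 d) 𝓘(ℝ, Euc l) ∞ (fun z => S.coframe x (v z)) z :=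
    contMDiffAt_const.clm_apply hv
  have h3 : ContMDiff 𝓘(ℝ, Euc n × Euc l) 𝓘(ℝ, Euc m) ∞ S.split.symm :=
    (S.split.symm : Euc n × Euc l →L[ℝ] Euc m).contMDiff
  exact h3.contMDiffAt.comp z (h1.prodMk_space h2)

instance : IsManifold (𝓡 m) ∞ S.Total := by
  refine isManifold_of_contDiffOn (𝓡 m) ∞ S.Total ?_
  rintro _ _ ⟨z₀, rfl⟩ ⟨z₁, rfl⟩
  have key : ContMDiffOn (𝓡 m) (𝓡 m) ∞ ((S.totalChart z₀).symm ≫ₕ S.totalChart z₁)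
      ((S.totalChart z₀).symm ≫ₕ S.totalChart z₁).source := by
    intro t ht
    rw [OpenPartialHomeomorph.trans_source] at ht
    have ht1 : t ∈ S.chartTarget (pr z₀) := ht.1
    have ht2 : pr (S.coordInv z₀ t) ∈ S.chartBase (pr z₁) := ht.2
    rw [pr_coordInv ht1] at ht2
    have hn := (S.isOpen_chartTarget (pr z₀)).mem_nhds ht1
    have h := S.contMDiffAt_coord_comp (pr z₁) ((S.contMDiffOn_basePoint (pr z₀)).contMDiffAt hn)
      ((S.contMDiffOn_fiberPoint_basePoint (pr z₀)).contMDiffAt hn) ht2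
    refine (h.congr_of_eventuallyEq ?_).contMDiffWithinAt
    filter_upwards [hn] with t ht
    change S.coord (pr z₁) (S.coordInv z₀ t) = _
    rw [coord, pr_coordInv ht, vec_coordInv ht]
  simpa using! contMDiffOn_iff_contDiffOn.1 key

theorem contMDiff_pr : ContMDiff (𝓡 m) (𝓡 n) ∞ (pr : S.Total → M) := by
  intro z
  have h := (S.contMDiffOn_basePoint (pr z)).comp (contMDiffOn_chart (I := 𝓡 m) (x := z))
    fun y hy => (S.totalChart z).map_source hy
  refine (h.congr fun y hy => ?_).contMDiffAt (mem_chart_source_nhds m z)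
  have h1 := pr_coordInv ((S.totalChart z).map_source hy)
  exact (congrArg pr ((S.totalChart z).left_inv hy)).symm.trans h1

theorem contMDiff_vec : ContMDiff (𝓡 m) 𝓘(ℝ, Euc q) ∞ (vec : S.Total → Euc q) := by
  intro z
  have h := (S.contMDiffOn_fiberPoint_basePoint (pr z)).comp
    (contMDiffOn_chart (I := 𝓡 m) (x := z)) fun y hy => (S.totalChart z).map_source hy
  refine (h.congr fun y hy => ?_).contMDiffAt (mem_chart_source_nhds m z)
  have h1 := vec_coordInv ((S.totalChart z).map_source hy)
  exact (congrArg vec ((S.totalChart z).left_inv hy)).symm.trans h1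

/-- A map into the total space is smooth if its components are. -/
theorem contMDiffAt_total {d : ℕ} {X : Type*} [TopologicalSpace X] [ChartedSpace (Euc d) X]
    {g : X → S.Total} {x : X} (h1 : ContMDiffAt (𝓡 d) (𝓡 n) ∞ (fun y => pr (g y)) x)
    (h2 : ContMDiffAt (𝓡 d) 𝓘(ℝ, Euc q) ∞ (fun y => vec (g y)) x) :
    ContMDiffAt (𝓡 d) (𝓡 m) ∞ g x := by
  have hb := S.mem_chartBase_self (S.pr_mem (g x))
  have h3 := S.contMDiffAt_coord_comp (pr (g x)) h1 h2 hb
  have h4 := (contMDiffOn_chart_symm (I := 𝓡 m) (n := ∞) (x := g x)).contMDiffAt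
    (x := S.coord (pr (g x)) (g x))
    ((S.totalChart (g x)).open_target.mem_nhds ((S.totalChart (g x)).map_source hb))
  refine (h4.comp x h3).congr_of_eventuallyEq ?_
  filter_upwards [h1.continuousAt.preimage_mem_nhds ((S.isOpen_chartBase _).mem_nhds hb)] with y hy
  exact ((S.totalChart (g x)).left_inv hy).symm

end Subbundle

/-! ### Restriction of a map to an open submanifold. -/

section OpenSubmanifold

variable {m q : ℕ} {N : Type u} [TopologicalSpace N] [ChartedSpace (Euc m) N]
  {F : N → Euc q} (W : TopologicalSpace.Opens N) (y : W)

/-- The chart of the open subset at y is the restricted ambient chart, so the local expressions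
agree near y and so do all their derivatives. -/
theorem comp_extChartAt_symm_opens :
    (fun z : W => F z) ∘ (extChartAt (𝓡 m) y).symm
      =ᶠ[𝓝 (extChartAt (𝓡 m) y y)] F ∘ (extChartAt (𝓡 m) (y : N)).symm := by
  filter_upwards [TopologicalSpace.Opens.chartAt_subtype_val_symm_eventuallyEq (H := Euc m) W
    (x := y)] with t ht
  exact (congrArg F ht).symm

theorem chartHessian_opens :
    chartHessian m (fun z : W => F z) y = chartHessian m F (y : N) :=
  (comp_extChartAt_symm_opens W y).fderiv.fderiv_eq

theorem vderiv_opens (hF : MDifferentiableAt (𝓡 m) 𝓘(ℝ, Euc q) F (y : N))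
    (hF' : MDifferentiableAt (𝓡 m) 𝓘(ℝ, Euc q) (fun z : W => F z) y) :
    vderiv m (fun z : W => F z) y = vderiv m F (y : N) := by
  rw [vderiv_eq_fderiv hF, vderiv_eq_fderiv hF']
  exact (comp_extChartAt_symm_opens W y).fderiv_eq

variable [IsManifold (𝓡 m) ∞ N] (hF : ContMDiff (𝓡 m) 𝓘(ℝ, Euc q) ∞ F)
include hF

omit [IsManifold (𝓡 m) ∞ N] in
theorem contMDiff_opens : ContMDiff (𝓡 m) 𝓘(ℝ, Euc q) ∞ (fun z : W => F z) :=
  hF.comp contMDiff_subtype_val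

omit [IsManifold (𝓡 m) ∞ N] in
theorem vderiv_opens_of_contMDiff : vderiv m (fun z : W => F z) y = vderiv m F (y : N) :=
  vderiv_opens W y (hF.mdifferentiableAt (by simp))
    ((contMDiff_opens W hF).mdifferentiableAt (by simp))

omit [IsManifold (𝓡 m) ∞ N] in
theorem tangentSub_opens : tangentSub m (fun z : W => F z) y = tangentSub m F (y : N) := by
  rw [tangentSub, tangentSub, vderiv_opens_of_contMDiff W y hF]

omit [IsManifold (𝓡 m) ∞ N] in
theorem secondForm_opens : secondForm m (fun z : W => F z) y = secondForm m F (y : N) := by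
  ext1 X
  ext1 Z
  rw [secondForm_apply, secondForm_apply, tangentSub_opens W y hF, chartHessian_opens]

omit [IsManifold (𝓡 m) ∞ N] in
theorem osculating_opens : osculating m (fun z : W => F z) y = osculating m F (y : N) := by
  rw [osculating, osculating, tangentSub_opens W y hF, firstNormal_eq_span, firstNormal_eq_span,
    secondForm_opens W y hF]

end OpenSubmanifold

/-- The differential of a map between manifolds, as a map of model spaces. -/
def mderiv (m n : ℕ) {M N : Type*} [TopologicalSpace M] [ChartedSpace (Euc n) M]
    [TopologicalSpace N] [ChartedSpace (Euc m) N] (ρ : N → M) (z : N) : Euc m →L[ℝ] Euc n :=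
  mfderiv (𝓡 m) (𝓡 n) ρ z

/-! ### Osculating spaces of a submanifold of a submanifold. -/

section Composition

variable {n m q : ℕ} {M N : Type u} [TopologicalSpace M] [ChartedSpace (Euc n) M]
  [TopologicalSpace N] [ChartedSpace (Euc m) N]
  {f : M → Euc q} {F : N → Euc q} {i : M → N}

theorem tangentSub_le_of_comp {M N : Type*} [TopologicalSpace M] [ChartedSpace (Euc n) M]
    [TopologicalSpace N] [ChartedSpace (Euc m) N] {f : M → Euc q} {F : N → Euc q} {i : M → N}
    {x : M} (hF : MDifferentiableAt (𝓡 m) 𝓘(ℝ, Euc q) F (i x))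
    (hi : MDifferentiableAt (𝓡 n) (𝓡 m) i x) (h : f =ᶠ[𝓝 x] fun y => F (i y)) :
    tangentSub n f x ≤ tangentSub m F (i x) := by
  rintro _ ⟨X, rfl⟩
  change vderiv n f x X ∈ _
  rw [vderiv_congr h, vderiv_comp hF hi]
  exact vderiv_mem_tangentSub F _ _

theorem projDeriv_comp {E : Type*} [NormedAddCommGroup E] [InnerProductSpace ℝ E]
    [FiniteDimensional ℝ E] {B : N → Submodule ℝ E} {x : M}
    (hB : MDifferentiableAt (𝓡 m) 𝓘(ℝ, E →L[ℝ] E) (projField B) (i x))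
    (hi : MDifferentiableAt (𝓡 n) (𝓡 m) i x) (X : Euc n) :
    projDeriv n (fun y => B (i y)) x X = projDeriv m B (i x) (mderiv n m i x X) :=
  vderiv_comp hB hi X

variable [IsManifold (𝓡 n) ∞ M] [IsManifold (𝓡 m) ∞ N]

/-- The osculating spaces of a submanifold are contained in those of the ambient manifold. -/
theorem osculating_le_of_comp (hf : ContMDiff (𝓡 n) 𝓘(ℝ, Euc q) ∞ f)
    (hfinj : ∀ x, Function.Injective (vderiv n f x))
    (hF : ContMDiff (𝓡 m) 𝓘(ℝ, Euc q) ∞ F) (hinj : ∀ y, Function.Injective (vderiv m F y))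
    {x : M} (hi : ∀ᶠ y in 𝓝 x, MDifferentiableAt (𝓡 n) (𝓡 m) i y)
    (h : f =ᶠ[𝓝 x] fun y => F (i y)) :
    osculating n f x ≤ osculating m F (i x) := by
  have hT : ∀ᶠ y in 𝓝 x, tangentSub n f y ≤ tangentSub m F (i y) := by
    filter_upwards [hi, h.eventuallyEq_nhds] with y hiy hy
    exact tangentSub_le_of_comp (hF.mdifferentiableAt (by simp)) hiy hy
  have hTx := hT.self_of_nhds
  refine sup_le (hTx.trans (tangentSub_le_osculating F _)) ?_
  rw [firstNormal_eq_span, Submodule.span_le]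
  rintro _ ⟨X, Z, rfl⟩
  have hTf := mdifferentiableAt_projField_tangentSub hf hfinj x
  have hTF := mdifferentiableAt_projField_tangentSub hF hinj (i x)
  -- A tangent section of f is a section of T_F ∘ i, so its derivative α_f(X, Z) is α_F(i_*X, η),
  -- where F_*η = f_*Z, plus a vector tangent to F.
  have hTFi : MDifferentiableAt (𝓡 n) 𝓘(ℝ, Euc q →L[ℝ] Euc q)
      (projField fun y => tangentSub m F (i y)) x := hTF.comp x hi.self_of_nhds
  have hw : MDifferentiableAt (𝓡 n) 𝓘(ℝ, Euc q)
      (fun y => projField (tangentSub n f) y (vderiv n f x Z)) x :=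
    hTf.clm_apply mdifferentiableAt_const
  have h1 := vderiv_of_section hTFi hw
    (hT.mono fun y hy => hy (Submodule.starProjection_apply_mem _ _)) X
  rw [vderiv_projField_apply hTf, ← secondForm_eq_projDeriv hf hfinj,
    Submodule.starProjection_eq_self_iff.2 (vderiv_mem_tangentSub f x Z),
    projDeriv_comp hTF hi.self_of_nhds] at h1
  obtain ⟨η, hη⟩ := hTx (vderiv_mem_tangentSub f x Z)
  have hη' : vderiv m F (i x) η = vderiv n f x Z := hη
  rw [← hη', ← secondForm_eq_projDeriv hF hinj] at h1
  rw [SetLike.mem_coe, h1]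
  exact Submodule.add_mem _ (firstNormal_le_osculating F _ (secondForm_mem_firstNormal F _ _ _))
    (tangentSub_le_osculating F _ (Submodule.starProjection_apply_mem _ _))

end Composition

theorem finrank_comap_add {E G : Type*} [AddCommGroup E] [Module ℝ E] [FiniteDimensional ℝ E]
    [AddCommGroup G] [Module ℝ G] [FiniteDimensional ℝ G] (A : E →ₗ[ℝ] G) (K : Submodule ℝ G) :
    finrank ℝ E + finrank ℝ K ≤ finrank ℝ (K.comap A) + finrank ℝ G := by
  have h1 := LinearMap.finrank_range_add_finrank_ker (K.mkQ ∘ₗ A)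
  have h2 := Submodule.finrank_quotient_add_finrank K
  have h3 : finrank ℝ (LinearMap.range (K.mkQ ∘ₗ A)) ≤ finrank ℝ (G ⧸ K) := Submodule.finrank_le _
  have h4 : LinearMap.ker (K.mkQ ∘ₗ A) = K.comap A := by
    rw [LinearMap.ker_comp, Submodule.ker_mkQ]
  rw [h4] at h1
  omega

/-- The affine bundle map `f ∘ pr + vec`. -/
def ruledMap {M N : Type*} {q : ℕ} (f : M → Euc q) (ρ : N → M) (v : N → Euc q) (z : N) : Euc q :=
  f (ρ z) + v z

/-! ### Geometry of F = f ∘ ρ + v with v in Λ. -/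

section RuledExtension

variable {n m q : ℕ} {M N : Type u} [TopologicalSpace M] [ChartedSpace (Euc n) M]
  [IsManifold (𝓡 n) ∞ M] [TopologicalSpace N] [ChartedSpace (Euc m) N]
  {f : M → Euc q} (hf : ContMDiff (𝓡 n) 𝓘(ℝ, Euc q) ∞ f)
  (hfinj : ∀ x, Function.Injective (vderiv n f x))
  {p : ℕ} (hp : ∀ x, finrank ℝ (firstNormal n f x) = p)
  {s : ℕ} (hs : ∀ x, finrank ℝ (nonparallelSpace n f x) = s)
  {ρ : N → M} (hρ : ContMDiff (𝓡 m) (𝓡 n) ∞ ρ)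
  {v : N → Euc q} (hv : ContMDiff (𝓡 m) 𝓘(ℝ, Euc q) ∞ v)
  (hvΛ : ∀ z, v z ∈ parallelSub n f (ρ z))

/-- The preimage of `N(α_S)` under the bundle projection. -/
def liftSub (m n : ℕ) {q : ℕ} {M N : Type u} [TopologicalSpace M] [ChartedSpace (Euc n) M]
    [TopologicalSpace N] [ChartedSpace (Euc m) N] (f : M → Euc q) (ρ : N → M) (z : N) :
    Submodule ℝ (Euc m) :=
  (nullSub n f (ρ z)).comap (mderiv m n ρ z).toLinearMap

omit [IsManifold (𝓡 n) ∞ M] in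
theorem le_finrank_liftSub (z : N) :
    m + finrank ℝ (nullSub n f (ρ z)) ≤ finrank ℝ (liftSub m n f ρ z) + n := by
  have h := finrank_comap_add (mderiv m n ρ z).toLinearMap (nullSub n f (ρ z))
  rwa [finrank_euclideanSpace_fin, finrank_euclideanSpace_fin] at h

include hf hρ hv in
omit [IsManifold (𝓡 n) ∞ M] in
theorem contMDiff_ruledMap : ContMDiff (𝓡 m) 𝓘(ℝ, Euc q) ∞ (ruledMap f ρ v) :=
  (hf.comp hρ).add hv

include hf hρ hv in
omit [IsManifold (𝓡 n) ∞ M] in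
theorem vderiv_ruledMap (z : N) (ξ : Euc m) : vderiv m (ruledMap f ρ v) z ξ =
    vderiv n f (ρ z) (mderiv m n ρ z ξ) + vderiv m v z ξ := by
  have h1 : MDifferentiableAt (𝓡 m) 𝓘(ℝ, Euc q) (fun z => f (ρ z)) z :=
    (hf.comp hρ).mdifferentiableAt (by simp)
  have h2 := vderiv_add h1 (hv.mdifferentiableAt (x := z) (by simp))
  have h3 := vderiv_comp (hf.mdifferentiableAt (x := ρ z) (by simp))
    (hρ.mdifferentiableAt (x := z) (by simp)) ξ
  refine (congrArg (fun L : Euc m →L[ℝ] Euc q => L ξ) h2).trans ?_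
  rw [add_apply, h3]
  rfl

include hf hfinj hp hs hρ

theorem mdifferentiableAt_projField_adapted_comp (z : N) :
    MDifferentiableAt (𝓡 m) 𝓘(ℝ, Euc q →L[ℝ] Euc q) (projField fun z => adapted n f (ρ z)) z :=
  (mdifferentiableAt_projField_adapted hf hfinj hp hs (ρ z)).comp z
    (hρ.mdifferentiableAt (by simp))

theorem projDeriv_adapted_comp (z : N) (ξ : Euc m) :
    projDeriv m (fun z => adapted n f (ρ z)) z ξ =
      projDeriv n (adapted n f) (ρ z) (mderiv m n ρ z ξ) :=
  projDeriv_comp (mdifferentiableAt_projField_adapted hf hfinj hp hs (ρ z))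
    (hρ.mdifferentiableAt (by simp)) ξ

/-- P'_A maps A into S, and S + A ⊆ O. -/
theorem vderiv_mem_osculating_of_section {w : N → Euc q} {z : N}
    (hw : MDifferentiableAt (𝓡 m) 𝓘(ℝ, Euc q) w z) (h : ∀ᶠ y in 𝓝 z, w y ∈ adapted n f (ρ y))
    (ξ : Euc m) : vderiv m w z ξ ∈ osculating n f (ρ z) := by
  rw [vderiv_of_section (mdifferentiableAt_projField_adapted_comp hf hfinj hp hs hρ z) hw h,
    projDeriv_adapted_comp hf hfinj hp hs hρ]
  exact Submodule.add_mem _ (nonparallelSpace_le_osculating hf hfinj hp _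
    (projDeriv_adapted_mem hf hfinj hp hs _ _ h.self_of_nhds))
    (Submodule.mem_inf.1 (Submodule.starProjection_apply_mem (adapted n f (ρ z)) _)).1

include hv hvΛ

/-- v is a section of A killed by P'_A, so its derivative has no component outside A. -/
theorem tangentSub_ruledMap_le (z : N) : tangentSub m (ruledMap f ρ v) z ≤ adapted n f (ρ z) := by
  rintro _ ⟨ξ, rfl⟩
  change vderiv m (ruledMap f ρ v) z ξ ∈ _
  rw [vderiv_ruledMap hf hρ hv]
  refine Submodule.add_mem _ (tangentSub_le_adapted hf hfinj hp _ (vderiv_mem_tangentSub f _ _)) ?_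
  rw [vderiv_of_section (mdifferentiableAt_projField_adapted_comp hf hfinj hp hs hρ z)
    (hv.mdifferentiableAt (by simp))
    (Eventually.of_forall fun z => (mem_parallelSub_iff.1 (hvΛ z)).1),
    projDeriv_adapted_comp hf hfinj hp hs hρ, (mem_parallelSub_iff.1 (hvΛ z)).2, zero_add]
  exact Submodule.starProjection_apply_mem _ _

section ParallelSmooth

variable {U : Set M} (hU : IsOpen U)
  (hsm : ContMDiffOn (𝓡 n) 𝓘(ℝ, Euc q →L[ℝ] Euc q) ∞ (projField (parallelSub n f)) U)
  (hρU : ∀ z, ρ z ∈ U)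
include hU hsm hρU

/-- If ρ_*ξ lies in N(α_S), then f_*ρ_*ξ is in Λ, and since Λ is constant in that direction the
derivative of v is in Λ too. -/
theorem vderiv_ruledMap_mem_parallelSub {z : N} {ξ : Euc m} (hξ : ξ ∈ liftSub m n f ρ z) :
    vderiv m (ruledMap f ρ v) z ξ ∈ parallelSub n f (ρ z) := by
  have hB := (hsm.contMDiffAt (hU.mem_nhds (hρU z))).mdifferentiableAt (by simp)
  have hρz : MDifferentiableAt (𝓡 m) (𝓡 n) ρ z := hρ.mdifferentiableAt (by simp)
  have hBρ : MDifferentiableAt (𝓡 m) 𝓘(ℝ, Euc q →L[ℝ] Euc q)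
      (projField fun z => parallelSub n f (ρ z)) z := hB.comp z hρz
  have hξ' : mderiv m n ρ z ξ ∈ nullSub n f (ρ z) := hξ
  rw [vderiv_ruledMap hf hρ hv]
  refine Submodule.add_mem _ ((vderiv_mem_parallelSub_iff hf hfinj hp hs _ _).2 hξ') ?_
  have h0 : projDeriv m (fun z => parallelSub n f (ρ z)) z ξ = 0 :=
    (projDeriv_comp hB hρz ξ).trans
      (projDeriv_parallelSub_eq_zero hf hfinj hp hs hU hsm (hρU z) hξ')
  rw [vderiv_of_section hBρ (hv.mdifferentiableAt (by simp)) (Eventually.of_forall hvΛ), h0,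
    zero_apply, zero_add]
  exact Submodule.starProjection_apply_mem _ _

variable (hinj : ∀ z, Function.Injective (vderiv m (ruledMap f ρ v) z))
include hinj

theorem finrank_liftSub_le (z : N) :
    finrank ℝ (liftSub m n f ρ z) ≤ finrank ℝ (parallelSub n f (ρ z)) := by
  rw [(Submodule.equivMapOfInjective (vderiv m (ruledMap f ρ v) z).toLinearMap
    (hinj z) (liftSub m n f ρ z)).finrank_eq]
  refine Submodule.finrank_mono ?_
  rintro _ ⟨ξ, hξ, rfl⟩
  exact vderiv_ruledMap_mem_parallelSub hf hfinj hp hs hρ hv hvΛ hU hsm hρU hξ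

variable {z : N} (hz : finrank ℝ (parallelSub n f (ρ z)) + n =
    m + finrank ℝ (nullSub n f (ρ z)))
include hz

/-- F_* is injective from the lift of N(α_S) into Λ, and the lift has dimension at least m + dim
N(α_S) − n, which is dim Λ. So Λ is tangent to F and comes exactly from the lift. -/
theorem map_liftSub : (liftSub m n f ρ z).map (vderiv m (ruledMap f ρ v) z).toLinearMap =
    parallelSub n f (ρ z) := by
  refine Submodule.eq_of_le_of_finrank_eq ?_ (le_antisymm ?_ ?_)
  · rintro _ ⟨ξ, hξ, rfl⟩
    exact vderiv_ruledMap_mem_parallelSub hf hfinj hp hs hρ hv hvΛ hU hsm hρU hξ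
  · rw [← (Submodule.equivMapOfInjective (vderiv m (ruledMap f ρ v) z).toLinearMap
      (hinj z) (liftSub m n f ρ z)).finrank_eq]
    exact finrank_liftSub_le hf hfinj hp hs hρ hv hvΛ hU hsm hρU hinj z
  · rw [← (Submodule.equivMapOfInjective (vderiv m (ruledMap f ρ v) z).toLinearMap
      (hinj z) (liftSub m n f ρ z)).finrank_eq]
    have := le_finrank_liftSub (m := m) (n := n) (f := f) (ρ := ρ) z
    omega

theorem parallelSub_le_tangentSub_ruledMap :
    parallelSub n f (ρ z) ≤ tangentSub m (ruledMap f ρ v) z := by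
  rw [← map_liftSub hf hfinj hp hs hρ hv hvΛ hU hsm hρU hinj hz]
  rintro _ ⟨ξ, -, rfl⟩
  exact ⟨ξ, rfl⟩

theorem mem_liftSub_of_vderiv_mem {ξ : Euc m}
    (hξ : vderiv m (ruledMap f ρ v) z ξ ∈ parallelSub n f (ρ z)) : ξ ∈ liftSub m n f ρ z := by
  rw [← map_liftSub hf hfinj hp hs hρ hv hvΛ hU hsm hρU hinj hz] at hξ
  obtain ⟨η, hη, h⟩ := hξ
  rw [← hinj z h]
  exact hη

-- A direction with F_*ξ in Λ projects into N(α_S), along which Λ is constant; this is what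
-- `isRuledOn_comapSub` requires.
omit hz in
theorem isRuledOn_ruledMap [IsManifold (𝓡 m) ∞ N] [IsManifold (𝓡 m) 1 N]
    (hz : ∀ z, finrank ℝ (parallelSub n f (ρ z)) + n = m + finrank ℝ (nullSub n f (ρ z)))
    (hdim : ∀ x ∈ U, ∀ᶠ y in 𝓝 x,
      finrank ℝ (parallelSub n f y) = finrank ℝ (parallelSub n f x)) :
    IsRuledOn (ruledMap f ρ v)
      (comapSub m (ruledMap f ρ v) fun z => parallelSub n f (ρ z)) Set.univ := by
  refine isRuledOn_comapSub (contMDiff_ruledMap hf hρ hv) hinj isOpen_univ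
    (hsm.comp hρ.contMDiffOn fun z _ => hρU z)
    (fun z _ => parallelSub_le_tangentSub_ruledMap hf hfinj hp hs hρ hv hvΛ hU hsm hρU hinj (hz z))
    (fun z _ => hρ.continuous.continuousAt.eventually (hdim _ (hρU z)))
    (fun z _ ξ hξ => ?_)
  have h1 : mderiv m n ρ z ξ ∈ nullSub n f (ρ z) :=
    mem_liftSub_of_vderiv_mem hf hfinj hp hs hρ hv hvΛ hU hsm hρU hinj (hz z) hξ
  have hB := (hsm.contMDiffAt (hU.mem_nhds (hρU z))).mdifferentiableAt (by simp)
  exact (projDeriv_comp hB (hρ.mdifferentiableAt (by simp)) ξ).trans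
      (projDeriv_parallelSub_eq_zero hf hfinj hp hs hU hsm (hρU z) h1)

end ParallelSmooth

variable [IsManifold (𝓡 m) ∞ N]
  (hinj : ∀ z, Function.Injective (vderiv m (ruledMap f ρ v) z))
include hinj

/-- Tangent sections of F are sections of A over ρ, and their derivatives stay in O. -/
theorem osculating_ruledMap_le (z : N) :
    osculating m (ruledMap f ρ v) z ≤ osculating n f (ρ z) := by
  have hF := contMDiff_ruledMap hf hρ hv
  have hT := mdifferentiableAt_projField_tangentSub hF hinj z
  have hle := tangentSub_ruledMap_le hf hfinj hp hs hρ hv hvΛ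
  refine sup_le ((hle z).trans inf_le_left) ?_
  rw [firstNormal_eq_span, Submodule.span_le]
  rintro _ ⟨ξ, η, rfl⟩
  rw [SetLike.mem_coe, secondForm_eq_projDeriv hF hinj, ← vderiv_projField_apply hT]
  exact vderiv_mem_osculating_of_section hf hfinj hp hs hρ
    (hT.clm_apply mdifferentiableAt_const)
    (Eventually.of_forall fun y => hle y (Submodule.starProjection_apply_mem _ _)) ξ

theorem osculating_ruledMap_eq {z : N} (hO : n + p ≤ finrank ℝ (osculating m (ruledMap f ρ v) z)) :
    osculating m (ruledMap f ρ v) z = osculating n f (ρ z) := by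
  refine Submodule.eq_of_le_of_finrank_le
    (osculating_ruledMap_le hf hfinj hp hs hρ hv hvΛ hinj z) ?_
  rwa [finrank_osculating (n := n), finrank_tangentSub hfinj, hp]

theorem finrank_firstNormal_ruledMap {z : N}
    (hO : n + p ≤ finrank ℝ (osculating m (ruledMap f ρ v) z)) :
    m + finrank ℝ (firstNormal m (ruledMap f ρ v) z) = n + p := by
  have h := finrank_osculating (n := m) (ruledMap f ρ v) z
  rw [osculating_ruledMap_eq hf hfinj hp hs hρ hv hvΛ hinj hO, finrank_osculating (n := n),
    finrank_tangentSub hfinj, hp, finrank_tangentSub hinj] at h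
  exact h.symm

/-- If the tangent spaces of the extension fill the adapted bundle, then its relative nullity
contains the lift of `N(α_S)`. -/
theorem secondForm_ruledMap_eq_zero (hm : m + s = n + p) {z : N} {ξ : Euc m}
    (hξ : ξ ∈ liftSub m n f ρ z) (η : Euc m) : secondForm m (ruledMap f ρ v) z ξ η = 0 := by
  have hF := contMDiff_ruledMap hf hρ hv
  -- The inclusion of tangent spaces in A is an equality by dimension, so α_F is given by P'_A,
  -- which vanishes on N(α_S).
  have hT : tangentSub m (ruledMap f ρ v) = fun z => adapted n f (ρ z) := by
    funext z
    refine Submodule.eq_of_le_of_finrank_eq (tangentSub_ruledMap_le hf hfinj hp hs hρ hv hvΛ z) ?_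
    have := finrank_adapted hf hfinj hp hs (ρ z)
    rw [finrank_tangentSub hinj]
    omega
  have hξ' : mderiv m n ρ z ξ ∈ nullSub n f (ρ z) := hξ
  rw [secondForm_eq_projDeriv hF hinj, hT, projDeriv_adapted_comp hf hfinj hp hs hρ,
    (mem_nullSub_iff hf hfinj hp hs _ _).1 hξ', zero_apply]

theorem le_finrank_relNullity_ruledMap (hm : m + s = n + p) (z : N) :
    m + finrank ℝ (nullSub n f (ρ z)) ≤
      finrank ℝ (relNullity m (ruledMap f ρ v) z) + n := by
  refine (le_finrank_liftSub z).trans (Nat.add_le_add_right ?_ n)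
  let K : Submodule ℝ (Euc m) := LinearMap.ker (secondForm m (ruledMap f ρ v) z).toLinearMap
  have h : liftSub m n f ρ z ≤ K := fun ξ hξ => by
    refine LinearMap.mem_ker.2 (ContinuousLinearMap.ext fun η => ?_)
    exact secondForm_ruledMap_eq_zero hf hfinj hp hs hρ hv hvΛ hinj hm hξ η
  have h1 : finrank ℝ (liftSub m n f ρ z) ≤ finrank ℝ K := Submodule.finrank_mono h
  exact h1

/-- The first normal bundle of the extension is nonparallel. -/
theorem nonparallelSpace_ruledMap_ne_bot {k : ℕ}
    (hO : ∀ z, n + p ≤ finrank ℝ (osculating m (ruledMap f ρ v) z)) (hk : m + k = n + p)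
    {z : N} (hC : finrank ℝ (liftSub m n f ρ z) < m) :
    nonparallelSpace m (ruledMap f ρ v) z ≠ ⊥ := by
  intro hbot
  have hF := contMDiff_ruledMap hf hρ hv
  have hpF : ∀ z, finrank ℝ (firstNormal m (ruledMap f ρ v) z) = k := fun z => by
    have := finrank_firstNormal_ruledMap hf hfinj hp hs hρ hv hvΛ hinj (hO z)
    omega
  have hOeq : osculating m (ruledMap f ρ v) = fun z => osculating n f (ρ z) :=
    funext fun z => osculating_ruledMap_eq hf hfinj hp hs hρ hv hvΛ hinj (hO z)
  -- Since F has the osculating spaces of f, a vanishing nonparallel space says that P'_O(ρ_*ξ)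
  -- kills every normal of O, that is, that every ξ lies over N(α_S).
  have htop : liftSub m n f ρ z = ⊤ := by
    rw [eq_top_iff]
    intro ξ _
    refine (mem_nullSub_iff_osculating hf hfinj hp hs _ _).2 fun μ hμ => ?_
    have hμ' : μ ∈ (osculating m (ruledMap f ρ v) z)ᗮ := by rw [hOeq]; exact hμ
    have h1 := projDeriv_osculating_mem_nonparallelSpace hF hinj hpF z ξ hμ'
    rw [hbot, Submodule.mem_bot, hOeq] at h1
    have h2 := projDeriv_comp (mdifferentiableAt_projField_osculating hf hfinj hp (ρ z))
      (hρ.mdifferentiableAt (x := z) (by simp)) ξ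
    rw [h2] at h1
    exact h1
  rw [htop, finrank_top, finrank_euclideanSpace_fin] at hC
  exact lt_irrefl _ hC

end RuledExtension

/-! ### Open sets where a map is an immersion with large osculating spaces. -/

section RegularParts

variable {m q : ℕ} {N : Type u} [TopologicalSpace N] [ChartedSpace (Euc m) N]
  [IsManifold (𝓡 m) ∞ N] {F : N → Euc q}

theorem isOpen_le_finrank_tangentSub (hF : ContMDiff (𝓡 m) 𝓘(ℝ, Euc q) ∞ F) (c : ℕ) :
    IsOpen {z | c ≤ finrank ℝ (tangentSub m F z)} := by
  rw [isOpen_iff_eventually]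
  intro z hz
  have hspan : ∀ y ∈ (chartAt (Euc m) z).source, tangentSub m F y =
      Submodule.span ℝ (Set.range fun b : Euc m => chartDeriv m z b F y) := fun y hy =>
    span_range_chartDeriv hF hy
  have h := eventually_le_finrank_span (fun (b : Euc m) y => chartDeriv m z b F y) (x₀ := z)
    (fun b => (contMDiffAt_chartDeriv hF (mem_chart_source _ z) b).continuousAt) (r := c)
    (by rw [← hspan z (mem_chart_source _ z)]; exact hz)
  filter_upwards [h, mem_chart_source_nhds m z] with y h1 h2
  exact h1.trans_eq (by rw [hspan y h2])

omit [IsManifold (𝓡 m) ∞ N] in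
theorem injective_vderiv_of_le_finrank {z : N} (h : m ≤ finrank ℝ (tangentSub m F z)) :
    Function.Injective (vderiv m F z) := by
  have h1 := LinearMap.finrank_range_add_finrank_ker (vderiv m F z).toLinearMap
  rw [finrank_euclideanSpace_fin] at h1
  have h2 : finrank ℝ (LinearMap.range (vderiv m F z).toLinearMap) =
    finrank ℝ (tangentSub m F z) := rfl
  have h3 : finrank ℝ (LinearMap.ker (vderiv m F z).toLinearMap) = 0 := by omega
  exact LinearMap.ker_eq_bot.1 (Submodule.finrank_eq_zero.1 h3)

/-- The open set on which a map is an immersion. -/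
def immersionPart (hF : ContMDiff (𝓡 m) 𝓘(ℝ, Euc q) ∞ F) : TopologicalSpace.Opens N :=
  ⟨{z | m ≤ finrank ℝ (tangentSub m F z)}, isOpen_le_finrank_tangentSub hF m⟩

omit [IsManifold (𝓡 m) ∞ N] in
theorem injective_vderiv_opens (hF : ContMDiff (𝓡 m) 𝓘(ℝ, Euc q) ∞ F)
    {W : TopologicalSpace.Opens N}
    (hW : ∀ z ∈ W, Function.Injective (vderiv m F z)) (z : W) :
    Function.Injective (vderiv m (fun z : W => F z) z) := by
  rw [vderiv_opens_of_contMDiff W z hF]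
  exact hW z z.2

/-- The open set on which the osculating spaces of an immersion have dimension at least `c`. -/
def osculatingPart (hF : ContMDiff (𝓡 m) 𝓘(ℝ, Euc q) ∞ F)
    (hinj : ∀ z, Function.Injective (vderiv m F z)) (c : ℕ) : TopologicalSpace.Opens N :=
  ⟨{z | c ≤ finrank ℝ (osculating m F z)}, isOpen_iff_eventually.2 fun _ hz =>
    eventually_le_finrank_osculating hF hinj hz⟩

end RegularParts

/-! ### Extensions obtained from a map with a smooth retraction. -/

section Extension

variable {n m q : ℕ} {M N : Type u} [TopologicalSpace M] [ChartedSpace (Euc n) M]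
  [IsManifold (𝓡 n) ∞ M] [TopologicalSpace N] [ChartedSpace (Euc m) N]
  [IsManifold (𝓡 m) ∞ N] [T2Space N] [SecondCountableTopology N]

/-- A map with a smooth retraction restricts to an extension, on the open set where it is an
immersion with osculating spaces of the right dimension. -/
theorem exists_extension_of_section {g : SmoothMetric n M} {f : M → Euc q}
    (hf : IsIsometricImmersion g f) {p : ℕ} (hp : ∀ x, finrank ℝ (firstNormal n f x) = p)
    {U : Set M} (hU : IsOpen U) (hnm : n < m) {ρ : N → M} {v : N → Euc q}
    (hρ : ContMDiff (𝓡 m) (𝓡 n) ∞ ρ) (hv : ContMDiff (𝓡 m) 𝓘(ℝ, Euc q) ∞ v)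
    {i : M → N} (hi : ∀ x ∈ U, ContMDiffAt (𝓡 n) (𝓡 m) ∞ i x)
    (hρi : ∀ x ∈ U, ρ (i x) = x) (hvi : ∀ x ∈ U, v (i x) = 0)
    (hiU : ∀ x, ∃ y ∈ U, i x = i y)
    (hT : ∀ x ∈ U, m ≤ finrank ℝ (tangentSub m (ruledMap f ρ v) (i x))) :
    ∃ (X : ExtensionOn g f U m) (j : X.N → N), ContMDiff (𝓡 m) (𝓡 m) ∞ j ∧
      X.F = ruledMap f (fun z => ρ (j z)) (fun z => v (j z)) ∧
      (∀ z, Function.Injective (vderiv m X.F z)) ∧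
      ∀ z, n + p ≤ finrank ℝ (osculating m X.F z) := by
  set F : N → Euc q := ruledMap f ρ v with hFdef
  have hF : ContMDiff (𝓡 m) 𝓘(ℝ, Euc q) ∞ F := contMDiff_ruledMap hf.1 hρ hv
  have hfinj := hf.injective_vderiv
  let W₁ := immersionPart hF
  let F₁ : W₁ → Euc q := fun z => F z
  have hF₁ : ContMDiff (𝓡 m) 𝓘(ℝ, Euc q) ∞ F₁ := contMDiff_opens W₁ hF
  have hinj₁ : ∀ z, Function.Injective (vderiv m F₁ z) := injective_vderiv_opens hF
    fun z hz => injective_vderiv_of_le_finrank hz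
  let W₂ := osculatingPart hF₁ hinj₁ (n + p)
  let F₂ : W₂ → Euc q := fun z => F₁ z
  have hF₂ : ContMDiff (𝓡 m) 𝓘(ℝ, Euc q) ∞ F₂ := contMDiff_opens W₂ hF₁
  have hinj₂ : ∀ z, Function.Injective (vderiv m F₂ z) := injective_vderiv_opens hF₁
    fun z _ => hinj₁ z
  -- The embedding is a function on all of M; off U it takes values that it already takes on U, so
  -- it still maps into W₁.
  have hi₁mem : ∀ x, i x ∈ W₁ := by
    intro x
    obtain ⟨y, hy, h⟩ := hiU x
    rw [h]
    exact hT y hy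
  let i₁ : M → W₁ := fun x => ⟨i x, hi₁mem x⟩
  have hi₁ : ∀ x ∈ U, ContMDiffAt (𝓡 n) (𝓡 m) ∞ i₁ x := fun x hx =>
    (ContMDiffAt.subtypeVal_comp_iff W₁ i₁ x).1 (hi x hx)
  have hfi : ∀ x ∈ U, f x = F (i x) := fun x hx => by
    rw [hFdef, ruledMap, hρi x hx, hvi x hx, add_zero]
  have hi₂mem : ∀ x, i₁ x ∈ W₂ := by
    have key : ∀ x ∈ U, i₁ x ∈ W₂ := by
      intro x hx
      -- The osculating space of f, of dimension n + p, is contained in that of F along the image of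
      -- i.
      have h1 : osculating n f x ≤ osculating m F₁ (i₁ x) := by
        refine osculating_le_of_comp hf.1 hfinj hF₁ hinj₁ ?_ ?_
        · filter_upwards [hU.mem_nhds hx] with y hy
          exact (hi₁ y hy).mdifferentiableAt (by simp)
        · filter_upwards [hU.mem_nhds hx] with y hy
          exact hfi y hy
      have h2 := Submodule.finrank_mono h1
      rw [finrank_osculating, finrank_tangentSub hfinj, hp] at h2
      exact h2
    intro x
    obtain ⟨y, hy, h⟩ := hiU x
    have h' : i₁ x = i₁ y := Subtype.ext h
    rw [h']
    exact key y hy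
  let i₂ : M → W₂ := fun x => ⟨i₁ x, hi₂mem x⟩
  have hi₂ : ∀ x ∈ U, ContMDiffAt (𝓡 n) (𝓡 m) ∞ i₂ x := fun x hx =>
    (ContMDiffAt.subtypeVal_comp_iff W₂ i₂ x).1 (hi₁ x hx)
  have hi₂on : ContMDiffOn (𝓡 n) (𝓡 m) ∞ i₂ U := fun x hx => (hi₂ x hx).contMDiffWithinAt
  have hj : ContMDiff (𝓡 m) (𝓡 m) ∞ (fun z : W₂ => ((z : W₁) : N)) :=
    contMDiff_subtype_val.comp contMDiff_subtype_val
  have hemb : IsEmbedding (U.domRestrict i₂) := by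
    refine IsEmbedding.of_comp (g := fun z : W₂ => ρ ((z : W₁) : N))
      hi₂on.continuousOn.domRestrict (hρ.continuous.comp hj.continuous) ?_
    have h : (fun z : W₂ => ρ ((z : W₁) : N)) ∘ U.domRestrict i₂ = Subtype.val :=
      funext fun x => hρi x x.2
    rw [h]
    exact IsEmbedding.subtypeVal
  have hiso : ∀ x ∈ U, ∀ a : Euc n, vderiv m F₂ (i₂ x) (mderiv n m i₂ x a) = vderiv n f x a := by
    intro x hx a
    have h1 : f =ᶠ[𝓝 x] fun y => F₂ (i₂ y) := by
      filter_upwards [hU.mem_nhds hx] with y hy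
      exact hfi y hy
    rw [vderiv_congr h1]
    exact (vderiv_comp (hF₂.mdifferentiableAt (by simp))
      ((hi₂ x hx).mdifferentiableAt (by simp)) a).symm
  let X : ExtensionOn g f U m :=
    { N := W₂
      dim_lt := hnm
      metric := inducedMetric hF₂ hinj₂
      F := F₂
      isometric := isIsometricImmersion_inducedMetric hF₂ hinj₂
      i := i₂
      i_smooth := hi₂on
      i_embedding := hemb
      i_isometric := by
        intro x hx a b
        refine (inducedMetric_inner hF₂ hinj₂ (i₂ x) (mderiv n m i₂ x a)
          (mderiv n m i₂ x b)).trans ?_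
        exact (congrArg₂ (fun u w : Euc q => inner ℝ u w) (hiso x hx a) (hiso x hx b)).trans
          (hf.2 x a b)
      extends_f := hfi }
  refine ⟨X, fun z : W₂ => ((z : W₁) : N), hj, rfl, hinj₂, fun z => ?_⟩
  have h1 := osculating_opens W₂ z hF₁
  have h2 : n + p ≤ finrank ℝ (osculating m F₁ (z : W₁)) := z.2
  rw [← h1] at h2
  exact h2

end Extension

/-! ### Extensions defined by transversal affine bundles. -/

section BundleExtension

variable {n q : ℕ} {M : Type u} [TopologicalSpace M] [ChartedSpace (Euc n) M]
  [IsManifold (𝓡 n) ∞ M] [T2Space M] [SecondCountableTopology M]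

namespace Subbundle

variable {l m : ℕ} {f : M → Euc q}

omit [IsManifold (𝓡 n) ∞ M] [T2Space M] [SecondCountableTopology M] in
/-- The affine bundle map is an immersion along the zero section if the fibres are transversal to
the tangent spaces. -/
theorem le_finrank_tangentSub_zero (S : Subbundle n q l m M) [IsManifold (𝓡 n) ∞ M]
    (hf : ContMDiff (𝓡 n) 𝓘(ℝ, Euc q) ∞ f)
    (hfinj : ∀ x, Function.Injective (vderiv n f x)) {x : M} (hx : x ∈ S.base)
    (h : S.fiber x ⊓ tangentSub n f x = ⊥) {i : M → S.Total}
    (hi : MDifferentiableAt (𝓡 n) (𝓡 m) i x) (hpr : ∀ᶠ y in 𝓝 x, pr (i y) = y)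
    (hvec : ∀ᶠ y in 𝓝 x, vec (i y) = 0) :
    m ≤ finrank ℝ (tangentSub m (ruledMap f (pr : S.Total → M) vec) (i x)) := by
  have hF : ContMDiff (𝓡 m) 𝓘(ℝ, Euc q) ∞ (ruledMap f (pr : S.Total → M) vec) :=
    contMDiff_ruledMap hf S.contMDiff_pr S.contMDiff_vec
  have h1 : tangentSub n f x ≤ tangentSub m (ruledMap f (pr : S.Total → M) vec) (i x) := by
    refine tangentSub_le_of_comp (hF.mdifferentiableAt (by simp)) hi ?_
    filter_upwards [hpr, hvec] with y h2 h3
    rw [ruledMap, h2, h3, add_zero]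
  have h2 : S.fiber x ≤ tangentSub m (ruledMap f (pr : S.Total → M) vec) (i x) := by
    let P : Euc q →L[ℝ] Euc q := (S.fiber x).starProjection
    -- Moving along the fibre over x only, F changes by P u, so the fibre is tangent to F at the
    -- zero section.
    let c : Euc q → S.Total := fun u =>
      mk' x (P u) hx (Submodule.starProjection_apply_mem _ _)
    have hc : ContMDiffAt (𝓡 q) (𝓡 m) ∞ c 0 := S.contMDiffAt_total contMDiffAt_const
      P.contDiff.contMDiff.contMDiffAt
    have hc0 : c 0 = i x := S.total_ext hpr.self_of_nhds.symm
      ((map_zero P).trans hvec.self_of_nhds.symm)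
    have h3 := tangentSub_le_of_comp (f := fun u : Euc q => f x + P u) (i := c) (x := 0)
      (F := ruledMap f (pr : S.Total → M) vec)
      (hF.mdifferentiableAt (x := c 0) (by simp)) (hc.mdifferentiableAt (by simp))
      (Eventually.of_forall fun _ => rfl)
    rw [hc0] at h3
    intro w hw
    refine h3 ⟨w, ?_⟩
    change vderiv q (fun u : Euc q => f x + P u) 0 w = w
    rw [vderiv_euclidean, fderiv_const_add, P.fderiv]
    exact Submodule.starProjection_eq_self_iff.2 hw
  have h3 := Submodule.finrank_mono (sup_le h1 h2)
  have h4 := Submodule.finrank_sup_add_finrank_inf_eq (tangentSub n f x) (S.fiber x)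
  rw [inf_comm, h, finrank_bot, finrank_tangentSub hfinj, S.finrank_fiber x hx] at h4
  have := S.dim_eq
  omega

/-- A transversal affine bundle defines an extension. -/
theorem exists_extension (S : Subbundle n q l m M) {g : SmoothMetric n M} {f : M → Euc q}
    (hf : IsIsometricImmersion g f) {p : ℕ} (hp : ∀ x, finrank ℝ (firstNormal n f x) = p)
    (hne : S.base.Nonempty) (hl : 0 < l)
    (htr : ∀ x ∈ S.base, S.fiber x ⊓ tangentSub n f x = ⊥) :
    ∃ (X : ExtensionOn g f S.base m) (j : X.N → S.Total), ContMDiff (𝓡 m) (𝓡 m) ∞ j ∧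
      X.F = ruledMap f (fun z => pr (j z)) (fun z => vec (j z)) ∧
      (∀ z, Function.Injective (vderiv m X.F z)) ∧
      ∀ z, n + p ≤ finrank ℝ (osculating m X.F z) := by
  classical
  obtain ⟨x₀, hx₀⟩ := hne
  -- The zero section is needed as a function on all of M; points off the base are sent to a fixed
  -- point of it.
  obtain ⟨r, hr, hrU⟩ : ∃ r : M → M, (∀ x, r x ∈ S.base) ∧ ∀ x ∈ S.base, r x = x :=
    ⟨fun x => if x ∈ S.base then x else x₀, fun x => by by_cases h : x ∈ S.base <;> simp [h, hx₀],
      fun x hx => if_pos hx⟩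
  let i : M → S.Total := fun x => mk' (r x) 0 (hr x) (Submodule.zero_mem _)
  have hpr : ∀ x ∈ S.base, pr (i x) = x := hrU
  have hvec : ∀ x, vec (i x) = 0 := fun _ => rfl
  have hi : ∀ x ∈ S.base, ContMDiffAt (𝓡 n) (𝓡 m) ∞ i x := fun x hx => by
    refine S.contMDiffAt_total (contMDiffAt_id.congr_of_eventuallyEq ?_) contMDiffAt_const
    filter_upwards [S.isOpen_base.mem_nhds hx] with y hy
    exact hrU y hy
  have hdim := S.dim_eq
  exact exists_extension_of_section hf hp S.isOpen_base (by omega)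
    S.contMDiff_pr S.contMDiff_vec hi hpr (fun x _ => hvec x)
    (fun x => ⟨r x, hr x, S.total_ext (hrU _ (hr x)).symm rfl⟩)
    (fun x hx => S.le_finrank_tangentSub_zero hf.1 hf.injective_vderiv hx
      (htr x hx) ((hi x hx).mdifferentiableAt (by simp))
      (by filter_upwards [S.isOpen_base.mem_nhds hx] with y hy using hpr y hy)
      (Eventually.of_forall hvec))

end Subbundle

open Subbundle in
/-- Over an open set where the dimensions are constant, the affine bundle spanned by
`rulingCompl` defines an extension. -/
theorem exists_ruled_extension {g : SmoothMetric n M} {f : M → Euc q}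
    (hf : IsIsometricImmersion g f) {p : ℕ} (hp : ∀ x, finrank ℝ (firstNormal n f x) = p)
    {s : ℕ} (hs : ∀ x, finrank ℝ (nonparallelSpace n f x) = s)
    {U : Set M} (hU : IsOpen U) (hne : U.Nonempty) {k m : ℕ} (hk : k < p) (hm : m + k = n + p)
    (hc : ∀ x ∈ U, ∀ᶠ y in 𝓝 x, finrank ℝ (parallelSub n f y) = finrank ℝ (parallelSub n f x))
    (hc' : ∀ x ∈ U, ∀ᶠ y in 𝓝 x, finrank ℝ (rulingSub n f y) = finrank ℝ (rulingSub n f x))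
    (hkU : ∀ x ∈ U, finrank ℝ (parallelSub n f x) + k = finrank ℝ (rulingSub n f x) + p) :
    ∃ (X : ExtensionOn g f U m) (ρ : X.N → M) (v : X.N → Euc q),
      ContMDiff (𝓡 m) (𝓡 n) ∞ ρ ∧ ContMDiff (𝓡 m) 𝓘(ℝ, Euc q) ∞ v ∧
      (∀ z, v z ∈ parallelSub n f (ρ z)) ∧ (∀ z, ρ z ∈ U) ∧ X.F = ruledMap f ρ v ∧
      (∀ z, Function.Injective (vderiv m (ruledMap f ρ v) z)) ∧
      ∀ z, n + p ≤ finrank ℝ (osculating m (ruledMap f ρ v) z) := by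
  have hfinj := hf.injective_vderiv
  -- The fibres complement f_*N in Λ and have rank dim Λ − dim f_*N = p − k, so the total space has
  -- dimension n + p − k.
  obtain ⟨S, hbase, hfib⟩ : ∃ S : Subbundle n q (p - k) m M,
      S.base = U ∧ S.fiber = rulingCompl n f :=
    ⟨{ base := U
       isOpen_base := hU
       fiber := rulingCompl n f
       contMDiffOn_projField := fun x hx => (contMDiffAt_projField_rulingCompl hf.1 hfinj hp hs
        (hc x hx) (hc' x hx)).contMDiffWithinAt
       finrank_fiber := fun x hx => by
        have h1 := finrank_rulingCompl hf.1 hfinj hp hs x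
        have h2 := hkU x hx
        omega
       dim_eq := by omega }, rfl, rfl⟩
  subst hbase
  obtain ⟨X, j, hj, hXF, hXinj, hXO⟩ := S.exists_extension hf hp hne (by omega) fun x _ => by
    rw [hfib]; exact rulingCompl_inf_tangentSub hf.1 hfinj hp hs x
  refine ⟨X, fun z => pr (j z), fun z => vec (j z), S.contMDiff_pr.comp hj,
    S.contMDiff_vec.comp hj, fun z => ?_, fun z => S.pr_mem _, hXF, ?_, ?_⟩
  · have h := S.vec_mem (j z)
    rw [hfib] at h
    exact (Submodule.mem_inf.1 h).1
  · rw [← hXF]; exact hXinj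
  · rw [← hXF]; exact hXO

end BundleExtension

/-! ### Strata and the consequences for f itself. -/

section Conclusions

variable {n q : ℕ} {M : Type u} [TopologicalSpace M] [ChartedSpace (Euc n) M]
  [IsManifold (𝓡 n) ∞ M] {f : M → Euc q} (hf : ContMDiff (𝓡 n) 𝓘(ℝ, Euc q) ∞ f)
  (hinj : ∀ x, Function.Injective (vderiv n f x))
  {p : ℕ} (hp : ∀ x, finrank ℝ (firstNormal n f x) = p)
  {s : ℕ} (hs : ∀ x, finrank ℝ (nonparallelSpace n f x) = s)
include hf hinj hp hs

/-- Otherwise every generator P'_O(X)μ of S would vanish. -/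
theorem nullSub_ne_top (hs0 : 0 < s) (x : M) : nullSub n f x ≠ ⊤ := by
  intro h
  have h1 : nonparallelSpace n f x = ⊥ := by
    rw [nonparallelSpace_eq hf hinj hp, Submodule.span_eq_bot]
    rintro _ ⟨X, μ, hμ, rfl⟩
    exact (mem_nullSub_iff_osculating hf hinj hp hs x X).1 (h ▸ Submodule.mem_top) μ hμ
  have h2 := hs x
  rw [h1, finrank_bot] at h2
  omega

/-- Here S = N_1, so N(α_S) lies in the relative nullity. -/
theorem le_finrank_relNullity (hs6 : s ≤ 6) (hsp : s = p) (x : M) :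
    n - p ≤ finrank ℝ (relNullity n f x) := by
  have hS : nonparallelSpace n f x = firstNormal n f x :=
    Submodule.eq_of_le_of_finrank_eq (nonparallelSpace_le_firstNormal hf hinj hp x)
      (by rw [hs, hp, hsp])
  let K : Submodule ℝ (Euc n) := LinearMap.ker (secondForm n f x).toLinearMap
  have h : nullSub n f x ≤ K := fun Y hY => by
    refine LinearMap.mem_ker.2 (ContinuousLinearMap.ext fun Z => ?_)
    have h1 : (nonparallelSpace n f x).starProjection (secondForm n f x Y Z) = 0 := hY Z
    rw [hS, Submodule.starProjection_eq_self_iff.2 (secondForm_mem_firstNormal f x Y Z)] at h1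
    exact h1
  have h1 : finrank ℝ (nullSub n f x) ≤ finrank ℝ K := Submodule.finrank_mono h
  have h2 := le_finrank_nullSub hf hinj hp hs hs6 x
  have h3 : n - p ≤ finrank ℝ K := by omega
  exact h3

/-- The set of points around which the dimensions of `parallelSub` and `rulingSub` are constant and
such that the corresponding extension has first normal spaces of dimension `k`. -/
def stratum (n : ℕ) {q : ℕ} {M : Type u} [TopologicalSpace M] [ChartedSpace (Euc n) M]
    (f : M → Euc q) (p k : ℕ) : Set M :=
  {x | (∀ᶠ y in 𝓝 x, finrank ℝ (parallelSub n f y) = finrank ℝ (parallelSub n f x)) ∧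
    (∀ᶠ y in 𝓝 x, finrank ℝ (rulingSub n f y) = finrank ℝ (rulingSub n f x)) ∧
    finrank ℝ (parallelSub n f x) + k = finrank ℝ (rulingSub n f x) + p}

omit [IsManifold (𝓡 n) ∞ M] hf hinj hp hs in
theorem isOpen_stratum (k : ℕ) : IsOpen (stratum n f p k) := by
  rw [isOpen_iff_eventually]
  rintro x ⟨h1, h2, h3⟩
  filter_upwards [h1.eventually_nhds, h2.eventually_nhds] with y h4 h5
  have h6 := h4.self_of_nhds
  have h7 := h5.self_of_nhds
  exact ⟨h4.mono fun z hz => hz.trans h6.symm, h5.mono fun z hz => hz.trans h7.symm, by omega⟩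

omit [IsManifold (𝓡 n) ∞ M] hf hinj hp hs in
theorem disjoint_stratum {j k : ℕ} (h : j ≠ k) : Disjoint (stratum n f p j) (stratum n f p k) :=
  Set.disjoint_left.2 fun _ h1 h2 => h (by have := h1.2.2; have := h2.2.2; omega)

/-- The lower bound is Λ + T ⊆ A, the upper bound f_*N ⊆ Λ. -/
theorem le_of_mem_stratum {k : ℕ} {x : M} (hx : x ∈ stratum n f p k) : s ≤ k ∧ k ≤ p := by
  have h1 := hx.2.2
  have h2 := finrank_parallelSub_add_le hf hinj hp hs x
  have h3 := Submodule.finrank_mono (rulingSub_le hf hinj hp hs x)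
  omega

theorem dense_iUnion_stratum : Dense (⋃ k, stratum n f p k) := by
  rw [dense_iff_inter_open]
  intro V hV hne
  obtain ⟨x, hx, h1, h2⟩ := exists_generic_point hf hinj hp hs hV hne
  have h3 := finrank_parallelSub_add_le hf hinj hp hs x
  refine ⟨x, hx, Set.mem_iUnion.2
    ⟨finrank ℝ (rulingSub n f x) + p - finrank ℝ (parallelSub n f x), h1, h2, ?_⟩⟩
  omega

/-- With e = n − dim N(α_S) ≤ s, the bound dim Λ ≥ n + p − s − s e gives k ≤ s + (s − 1) e ≤ s². -/
theorem stratum_eq_empty_of_lt (hs6 : s ≤ 6) {k : ℕ} (hk : s * s < k) : stratum n f p k = ∅ := by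
  refine Set.eq_empty_of_forall_notMem fun x hx => ?_
  have h1 := hx.2.2
  have h2 := le_finrank_parallelSub hf hinj hp hs x
  have h3 := le_finrank_nullSub hf hinj hp hs hs6 x
  have h4 := finrank_rulingSub hinj x
  have h5 : finrank ℝ (nullSub n f x) ≤ n := by
    simpa using Submodule.finrank_le (nullSub n f x)
  obtain ⟨e, he⟩ : ∃ e, n - finrank ℝ (nullSub n f x) = e := ⟨_, rfl⟩
  have h6 : e ≤ s := by omega
  rw [he] at h2
  rcases s with _ | t
  · omega
  · have h7 : t * e ≤ t * (t + 1) := Nat.mul_le_mul_left t h6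
    simp only [add_mul, mul_add, one_mul, mul_one] at h2 hk h7
    omega

theorem contMDiffOn_projField_parallelSub_stratum (k : ℕ) :
    ContMDiffOn (𝓡 n) 𝓘(ℝ, Euc q →L[ℝ] Euc q) ∞ (projField (parallelSub n f))
      (stratum n f p k) := fun _ hx =>
  (contMDiffAt_projField_parallelSub hf hinj hp hs hx.1).contMDiffWithinAt

/-- For k = p the dimensions of Λ and f_*N agree, so Λ itself is tangent to f and constant along
N(α_S). -/
theorem isRuledOn_nullityS_stratum [IsManifold (𝓡 n) 1 M] :
    IsRuledOn f (nullityS n f) (stratum n f p p) := by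
  have hU : IsOpen (stratum n f p p) := isOpen_stratum p
  have hsm := contMDiffOn_projField_parallelSub_stratum hf hinj hp hs p
  have h := isRuledOn_comapSub hf hinj hU hsm (fun y hy => by
    have h1 : rulingSub n f y = parallelSub n f y :=
      Submodule.eq_of_le_of_finrank_eq (rulingSub_le hf hinj hp hs y) (by
        have := hy.2.2; omega)
    rw [← h1, rulingSub_eq hf hinj hp hs]
    exact inf_le_right) (fun x hx => hx.1) fun y hy ξ hξ =>
      projDeriv_parallelSub_eq_zero hf hinj hp hs hU hsm hy
        ((vderiv_mem_parallelSub_iff hf hinj hp hs y ξ).1 hξ)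
  have h1 : comapSub n f (parallelSub n f) = nullSub n f := by
    funext y
    ext ξ
    exact vderiv_mem_parallelSub_iff hf hinj hp hs y ξ
  rw [h1] at h
  exact h

theorem isConstantAlongOn_nonparallelSpace (U : Set M) :
    IsConstantAlongOn (nonparallelSpace n f) (nullityS n f) U :=
  isConstantAlongOn_of_projDeriv (D := nullSub n f)
    (mdifferentiableAt_projField_nonparallelSpace hf hinj hp hs) fun x _ _ hX =>
      projDeriv_nonparallelSpace_eq_zero hf hinj hp hs x hX

end Conclusions

/-! ### The extension over a stratum. -/

section ExtensionOfStratum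

variable {n q : ℕ} {M : Type u} [TopologicalSpace M] [ChartedSpace (Euc n) M]
  [IsManifold (𝓡 n) ∞ M] [T2Space M] [SecondCountableTopology M]
  {g : SmoothMetric n M} {f : M → Euc q} (hf : IsIsometricImmersion g f)
  {p : ℕ} (hp : ∀ x, finrank ℝ (firstNormal n f x) = p)
  {s : ℕ} (hs : ∀ x, finrank ℝ (nonparallelSpace n f x) = s)
include hf hp hs

/-- The dimension formula of the stratum is exactly the one under which Λ is tangent to F. It also
makes the lift of N(α_S) proper, whence nonparallelism, and gives the ruling dimension dim Λ = dim
N(α_S) + p − k ≥ m − s. -/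
theorem exists_extension_stratum (hs0 : 0 < s) (hs6 : s ≤ 6) {k m : ℕ}
    (hne : (stratum n f p k).Nonempty) (hk : k < p) (hm : m + k = n + p) :
    ∃ X : ExtensionOn g f (stratum n f p k) m,
      (∀ y, finrank ℝ (firstNormal m X.F y) = k) ∧
      (∀ y, nonparallelSpace m X.F y ≠ ⊥) ∧
      (s = k → ∀ y, m - k ≤ finrank ℝ (relNullity m X.F y)) ∧
      ∃ Δ : ∀ y : X.N, Submodule ℝ (TangentSpace (𝓡 m) y),
        IsRuledOn X.F Δ Set.univ ∧ ∀ y, m - s ≤ finrank ℝ (Δ y) := by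
  have hinj := hf.injective_vderiv
  have hU : IsOpen (stratum n f p k) := isOpen_stratum k
  have hsm := contMDiffOn_projField_parallelSub_stratum hf.1 hinj hp hs k
  obtain ⟨X, ρ, v, hρ, hv, hvΛ, hρU, hXF, hXinj, hXO⟩ := exists_ruled_extension hf hp hs hU hne hk
    hm (fun x hx => hx.1) (fun x hx => hx.2.1) (fun x hx => hx.2.2)
  have hz : ∀ z, finrank ℝ (parallelSub n f (ρ z)) + n = m + finrank ℝ (nullSub n f (ρ z)) :=
    fun z => by
      have h1 := (hρU z).2.2
      have h2 := finrank_rulingSub hinj (ρ z)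
      omega
  have hnull := fun z => le_finrank_nullSub hf.1 hinj hp hs hs6 (ρ z)
  refine ⟨X, ?_⟩
  rw [hXF]
  refine ⟨?_, ?_, ?_, ?_⟩
  · intro z
    have := finrank_firstNormal_ruledMap hf.1 hinj hp hs hρ hv hvΛ hXinj (hXO z)
    omega
  · intro z
    refine nonparallelSpace_ruledMap_ne_bot hf.1 hinj hp hs hρ hv hvΛ hXinj hXO hm ?_
    have h1 := finrank_liftSub_le hf.1 hinj hp hs hρ hv hvΛ hU hsm hρU hXinj z
    have h2 := hz z
    have h3 := Submodule.finrank_lt (nullSub_ne_top hf.1 hinj hp hs hs0 (ρ z))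
    rw [finrank_euclideanSpace_fin] at h3
    omega
  · rintro rfl z
    have h1 := le_finrank_relNullity_ruledMap hf.1 hinj hp hs hρ hv hvΛ hXinj hm z
    have h2 := hnull z
    omega
  · refine ⟨_, isRuledOn_ruledMap hf.1 hinj hp hs hρ hv hvΛ hU hsm hρU hXinj hz
      fun x hx => hx.1, fun z => ?_⟩
    have h1 := finrank_comapSub (m := m) (F := ruledMap f ρ v)
      (Λ := fun z => parallelSub n f (ρ z)) (y := z) hXinj
      (parallelSub_le_tangentSub_ruledMap hf.1 hinj hp hs hρ hv hvΛ hU hsm hρU hXinj (hz z))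
    have h2 := hz z
    have h3 := hnull z
    have h4 : m - s ≤ finrank ℝ
      (comapSub m (ruledMap f ρ v) (fun z => parallelSub n f (ρ z)) z) := by omega
    exact h4

omit [T2Space M] [SecondCountableTopology M] in
/-- If the nonparallel spaces are lines, the whole manifold is a single stratum. -/
theorem stratum_one_eq_univ (hs1 : s = 1) : stratum n f p 1 = Set.univ := by
  have hinj := hf.injective_vderiv
  have h1 : ∀ x, finrank ℝ (rulingSub n f x) + 1 = n := fun x => by
    have h2 := le_finrank_nullSub hf.1 hinj hp hs (by omega) x
    have h3 := Submodule.finrank_lt (nullSub_ne_top hf.1 hinj hp hs (by omega) x)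
    rw [finrank_euclideanSpace_fin] at h3
    rw [finrank_rulingSub hinj]
    omega
  -- For s = 1 the inclusion Λ + T ⊆ A and the kernel bound for Λ coincide, since N(α_S) has
  -- codimension exactly one.
  have h2 : ∀ x, finrank ℝ (parallelSub n f x) + 1 = finrank ℝ (rulingSub n f x) + p := fun x => by
    have h3 := finrank_parallelSub_add_le hf.1 hinj hp hs x
    have h4 := le_finrank_parallelSub hf.1 hinj hp hs x
    have h5 := h1 x
    rw [finrank_rulingSub hinj] at h3 h5 ⊢
    subst hs1
    omega
  refine Set.eq_univ_of_forall fun x => ⟨Eventually.of_forall fun y => ?_,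
    Eventually.of_forall fun y => ?_, h2 x⟩
  · have := h1 x
    have := h1 y
    have := h2 x
    have := h2 y
    omega
  · have := h1 x
    have := h1 y
    omega

end ExtensionOfStratum

theorem finrank_relNullity_lt {m q : ℕ} {N : Type u} [TopologicalSpace N] [ChartedSpace (Euc m) N]
    {F : N → Euc q} {y : N} (h : firstNormal m F y ≠ ⊥) : finrank ℝ (relNullity m F y) < m := by
  let K : Submodule ℝ (Euc m) := LinearMap.ker (secondForm m F y).toLinearMap
  have h1 : K ≠ ⊤ := fun htop => h <| by
    rw [firstNormal_eq_span, Submodule.span_eq_bot]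
    rintro _ ⟨X, Y, rfl⟩
    have h2 : X ∈ K := htop ▸ Submodule.mem_top
    exact congrArg (fun L : Euc m →L[ℝ] Euc q => L Y) (LinearMap.mem_ker.1 h2)
  have h2 : finrank ℝ K < m := by
    have := Submodule.finrank_lt h1
    rwa [finrank_euclideanSpace_fin] at this
  exact h2

end

end

/-! ### The three cases of the theorem. -/

theorem theorem1 {n q p s : ℕ} {M : Type u} [TopologicalSpace M] [ChartedSpace (Euc n) M]
    [IsManifold (𝓡 n) ∞ M] [T2Space M] [SecondCountableTopology M] [ConnectedSpace M]
    (g : SmoothMetric n M) (f : M → Euc q) (hf : IsIsometricImmersion g f)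
    (hsub : IsLocallySubstantial f)
    (hp : ∀ x, Module.finrank ℝ (firstNormal n f x) = p)
    (hs : ∀ x, Module.finrank ℝ (nonparallelSpace n f x) = s)
    (hs0 : 0 < s) (hsn : s < n) (hs6 : s ≤ 6) :
    (s = p ∧ ∀ x, n - p ≤ Module.finrank ℝ (relNullity n f x)) ∨
    (1 = s ∧ s < p ∧ ∃ X : ExtensionOn g f Set.univ (n + p - 1),
      (∀ y, Module.finrank ℝ (relNullity (n + p - 1) X.F y) = n + p - 1 - 1) ∧
      (∀ y, Module.finrank ℝ (firstNormal (n + p - 1) X.F y) = 1) ∧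
      (∀ y, nonparallelSpace (n + p - 1) X.F y ≠ ⊥)) ∨
    (1 < s ∧ s < p ∧ ∃ U : ℕ → Set M,
      (∀ k, IsOpen (U k)) ∧ (∀ j k, j ≠ k → Disjoint (U j) (U k)) ∧
      (∀ k, (U k).Nonempty → s ≤ k ∧ k ≤ p) ∧ Dense (⋃ k, U k) ∧
      (IsRuledOn f (nullityS n f) (U p) ∧
        (∀ x ∈ U p, n - s ≤ Module.finrank ℝ (nullityS n f x)) ∧
        IsConstantAlongOn (nonparallelSpace n f) (nullityS n f) (U p)) ∧
      (∀ k, s ≤ k → k < p → (U k).Nonempty →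
        ∃ X : ExtensionOn g f (U k) (n + p - k),
          (∀ y, Module.finrank ℝ (firstNormal (n + p - k) X.F y) = k) ∧
          (s = k → ∀ y, n + p - k - k ≤ Module.finrank ℝ (relNullity (n + p - k) X.F y)) ∧
          (s < k → ∃ Δ : ∀ y : X.N, Submodule ℝ (TangentSpace (𝓡 (n + p - k)) y),
            IsRuledOn X.F Δ Set.univ ∧
            ∀ y, n + p - k - s ≤ Module.finrank ℝ (Δ y))) ∧
      (s = 2 → U 5 = ∅ ∧ U 6 = ∅)) := by
  have hinj := hf.injective_vderiv
  obtain ⟨x₀⟩ : Nonempty M := inferInstance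
  have hsp : s ≤ p := by
    have h := Submodule.finrank_mono (nonparallelSpace_le_firstNormal hf.1 hinj hp x₀)
    rwa [hs, hp] at h
  rcases hsp.eq_or_lt with hsp | hsp
  · exact Or.inl ⟨hsp, le_finrank_relNullity hf.1 hinj hp hs hs6 hsp⟩
  refine Or.inr ?_
  rcases Nat.eq_or_lt_of_le (Nat.one_le_iff_ne_zero.2 hs0.ne') with hs1 | hs1
  · refine Or.inl ⟨hs1, hsp, ?_⟩
    have hst := stratum_one_eq_univ hf hp hs hs1.symm
    have h := exists_extension_stratum hf hp hs hs0 hs6 (k := 1) (m := n + p - 1)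
      ⟨x₀, hst ▸ Set.mem_univ x₀⟩ (by omega) (by omega)
    rw [hst] at h
    obtain ⟨X, h1, h2, h3, -⟩ := h
    -- The nullity is at least m − 1 because k = s = 1, and less than m because the first normal
    -- space is nonzero.
    refine ⟨X, fun y => le_antisymm ?_ (h3 hs1.symm y), h1, h2⟩
    have h4 := finrank_relNullity_lt (F := X.F) (y := y) fun hbot => by
      have := h1 y
      rw [hbot, finrank_bot] at this
      omega
    omega
  · refine Or.inr ⟨hs1, hsp, stratum n f p, isOpen_stratum, fun _ _ => disjoint_stratum,
      fun k hk => ?_, dense_iUnion_stratum hf.1 hinj hp hs,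
      ⟨isRuledOn_nullityS_stratum hf.1 hinj hp hs, fun x _ => ?_,
        isConstantAlongOn_nonparallelSpace hf.1 hinj hp hs _⟩, fun k hsk hkp hne => ?_,
      fun hs2 => ⟨?_, ?_⟩⟩
    · obtain ⟨x, hx⟩ := hk
      exact le_of_mem_stratum hf.1 hinj hp hs hx
    · have h := le_finrank_nullSub hf.1 hinj hp hs hs6 x
      exact Nat.sub_le_iff_le_add.2 h
    · obtain ⟨X, h1, -, h3, h4⟩ := exists_extension_stratum hf hp hs hs0 hs6 (k := k)
        (m := n + p - k) hne hkp (by omega)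
      exact ⟨X, h1, h3, fun _ => h4⟩
    -- For s = 2 every nonempty stratum has k ≤ s² = 4.
    · exact stratum_eq_empty_of_lt hf.1 hinj hp hs hs6 (by subst hs2; omega)
    · exact stratum_eq_empty_of_lt hf.1 hinj hp hs hs6 (by subst hs2; omega)
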